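/- Model: a randomized real RAM. Registers and memory cells hold real numbers; a program is a finite (structured) program whose constants are rational; each of the following takes one unit of time: addition, subtraction, multiplication, division, square root, the floor function, comparison, and drawing an integer uniformly from $\{0,\dots,m-1\}$; and a cell of an array (hash table) that is addressed by a tuple of $j$ integers is read or written in time $O(1+j)$. Array cells initially hold $0$, except those that hold the input. Theorem. Let $d$ be a fixed dimension. There are a program in this model and a constant $C$, both depending only on $d$, with the following property. Given any set $P\subseteq\mathbb{R}^d$ of $n$ (distinct) points, in any order, an integer $k$ with $1\le k\le n-1$ and a real $\varepsilon\in(0,1]$, the program has expected running time at most $C\,n/\varepsilon^{d}$, where the expectation is over its random choices only (in particular, it halts almost surely), and whenever it halts, it outputs a number $r$ with $$\ell \;\le\; r\;\le\;(1+\varepsilon)\,\ell ,$$ where $\ell$ is the length of the $k$-th longest edge, counted with multiplicity, of a Euclidean minimum spanning tree of $P$ (a spanning tree of the complete graph on $P$ of minimum total Euclidean edge length; the bound holds for every such tree). The same is true, with another program and another constant, for the $k$-th shortest edge in place of the $k$-th longest. -/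

import Mathlib

namespace RealRAM

/-! A randomized real RAM with the floor function and hash tables.

Registers and memory cells hold real numbers. The memory consists of arrays (hash tables); the cells
of an array are addressed by finite tuples of integers, and every cell that has not been written
holds `0`. -/

/-- Arithmetic expressions over the registers. The only constants are rational. -/
inductive Expr : Type
  | const (q : ℚ)
  | reg (i : ℕ)
  | add (a b : Expr)
  | sub (a b : Expr)
  | mul (a b : Expr)
  | div (a b : Expr)
  | sqrt (a : Expr)
  | floor (a : Expr)

/-- Comparisons of expressions. -/
inductive Test : Type
  | le (a b : Expr)
  | not (t : Test)
  | and (t u : Test)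

/-- Programs.
* `assign x e` : register `x` gets the value of `e`;
* `load x a js` : register `x` gets the content of the cell of array `a` whose address is the tuple
  of the (rounded down) contents of the registers `js`;
* `store a js x` : the same cell gets the content of register `x`;
* `rand x e` : register `x` gets an integer uniformly distributed in `{0, …, m - 1}`, where `m` is
  the value of `e` rounded down (and `0` if `m ≤ 0`);
* `ite t P Q` and `loop t P` : `if t then P else Q` and `while t do P`. -/
inductive Program : Type
  | skip
  | assign (x : ℕ) (e : Expr)
  | load (x a : ℕ) (js : List ℕ)
  | store (a : ℕ) (js : List ℕ) (x : ℕ)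
  | rand (x : ℕ) (e : Expr)
  | seq (P Q : Program)
  | ite (t : Test) (P Q : Program)
  | loop (t : Test) (P : Program)

/-- Contents of the registers and of the arrays. -/
structure State : Type where
  reg : ℕ → ℝ
  mem : ℕ → List ℤ → ℝ

/-- Value of an expression (division by `0` and square roots of negative numbers give `0`). -/
noncomputable def Expr.eval (s : State) : Expr → ℝ
  | .const q => (q : ℝ)
  | .reg i => s.reg i
  | .add a b => a.eval s + b.eval s
  | .sub a b => a.eval s - b.eval s
  | .mul a b => a.eval s * b.eval s
  | .div a b => a.eval s / b.eval s
  | .sqrt a => Real.sqrt (a.eval s)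
  | .floor a => ((⌊a.eval s⌋ : ℤ) : ℝ)

/-- Number of nodes of an expression: every operation costs one. -/
def Expr.cost : Expr → ℕ
  | .const _ => 1
  | .reg _ => 1
  | .add a b => a.cost + b.cost + 1
  | .sub a b => a.cost + b.cost + 1
  | .mul a b => a.cost + b.cost + 1
  | .div a b => a.cost + b.cost + 1
  | .sqrt a => a.cost + 1
  | .floor a => a.cost + 1

def Test.Holds (s : State) : Test → Prop
  | .le a b => a.eval s ≤ b.eval s
  | .not t => ¬ t.Holds s
  | .and t u => t.Holds s ∧ u.Holds s

def Test.cost : Test → ℕ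
  | .le a b => a.cost + b.cost + 1
  | .not t => t.cost + 1
  | .and t u => t.cost + u.cost + 1

/-- Write `v` into register `x`. -/
def State.setReg (s : State) (x : ℕ) (v : ℝ) : State :=
  { s with reg := Function.update s.reg x v }

/-- Write `v` into the cell of array `a` with address `key`. -/
def State.setMem (s : State) (a : ℕ) (key : List ℤ) (v : ℝ) : State :=
  { s with mem := Function.update s.mem a (Function.update (s.mem a) key v) }

/-- The address given by the contents of the registers `js`. -/
noncomputable def State.key (s : State) (js : List ℕ) : List ℤ :=
  js.map fun j => ⌊s.reg j⌋

/-- The uniform distribution on `{0, …, m - 1}` (the point mass at `0` if `m = 0`). -/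
noncomputable def uniformBelow : ℕ → PMF ℝ
  | 0 => PMF.pure 0
  | m + 1 => (PMF.uniformOfFintype (Fin (m + 1))).map fun i => ((i : ℕ) : ℝ)

/-- A configuration: the list of programs that remain to be executed, and the state.
The machine has halted when this list is empty. -/
abbrev Config : Type := List Program × State

open Classical in
/-- One step of the machine; a halted configuration does not change. -/
noncomputable def step : Config → PMF Config
  | ([], s) => PMF.pure ([], s)
  | (.skip :: K, s) => PMF.pure (K, s)
  | (.assign x e :: K, s) => PMF.pure (K, s.setReg x (e.eval s))
  | (.load x a js :: K, s) => PMF.pure (K, s.setReg x (s.mem a (s.key js)))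
  | (.store a js x :: K, s) => PMF.pure (K, s.setMem a (s.key js) (s.reg x))
  | (.rand x e :: K, s) => (uniformBelow ⌊e.eval s⌋₊).map fun v => (K, s.setReg x v)
  | (.seq P Q :: K, s) => PMF.pure (P :: Q :: K, s)
  | (.ite t P Q :: K, s) => PMF.pure (if t.Holds s then (P :: K, s) else (Q :: K, s))
  | (.loop t P :: K, s) =>
      PMF.pure (if t.Holds s then (P :: .loop t P :: K, s) else (K, s))

/-- Running time of the next step: positive unless the machine has halted. -/
def stepCost : Config → ℕ
  | ([], _) => 0
  | (.skip :: _, _) => 1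
  | (.assign _ e :: _, _) => e.cost + 1
  | (.load _ _ js :: _, _) => js.length + 1
  | (.store _ js _ :: _, _) => js.length + 1
  | (.rand _ e :: _, _) => e.cost + 1
  | (.seq _ _ :: _, _) => 1
  | (.ite t _ _ :: _, _) => t.cost + 1
  | (.loop t _ :: _, _) => t.cost + 1

/-- Distribution of the configuration after `t` steps. -/
noncomputable def run : ℕ → Config → PMF Config
  | 0, c => PMF.pure c
  | t + 1, c => (step c).bind (run t)

/-- Expected running time of `P` started in the state `s`. It is infinite unless `P` halts almost
surely. -/
noncomputable def expectedTime (P : Program) (s : State) : ENNReal :=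
  ∑' t : ℕ, ∑' c : Config, run t ([P], s) c * (stepCost c : ENNReal)

/-- `r` is a possible output of `P` started in the state `s`: with positive probability, `P` halts
with the content `r` in register `0`. -/
def IsOutput (P : Program) (s : State) (r : ℝ) : Prop :=
  ∃ (t : ℕ) (s' : State), (([], s') : Config) ∈ (run t ([P], s)).support ∧ s'.reg 0 = r

/-- The initial memory: the cell `(i, j)` of array `0` holds the `j`-th coordinate of the `i`-th
point (for `i < n`, `j < d`), and all other cells hold `0`. -/
noncomputable def inputMem {d n : ℕ} (p : Fin n → EuclideanSpace ℝ (Fin d)) : ℕ → List ℤ → ℝ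
  | 0, [Int.ofNat i, Int.ofNat j] => if h : i < n ∧ j < d then p ⟨i, h.1⟩ ⟨j, h.2⟩ else 0
  | _, _ => 0

/-- The initial registers: `n`, `k` and `ε`, and then zeros. -/
noncomputable def inputReg (n k : ℕ) (ε : ℝ) : ℕ → ℝ
  | 0 => (n : ℝ)
  | 1 => (k : ℝ)
  | 2 => ε
  | _ => 0

/-- The input state for the points `p 0, …, p (n - 1)` and the parameters `k` and `ε`. -/
noncomputable def input {d n : ℕ} (p : Fin n → EuclideanSpace ℝ (Fin d)) (k : ℕ) (ε : ℝ) : State :=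
  { reg := inputReg n k ε, mem := inputMem p }

end RealRAM

namespace EuclideanMST

/-- Euclidean length of an edge of the complete graph on the points `p`. -/
noncomputable def edgeLength {d n : ℕ} (p : Fin n → EuclideanSpace ℝ (Fin d)) :
    Sym2 (Fin n) → ℝ :=
  Sym2.lift ⟨fun i j => dist (p i) (p j), fun i j => dist_comm (p i) (p j)⟩

/-- The multiset of the lengths of the edges of `T`. -/
noncomputable def edgeLengths {d n : ℕ} (p : Fin n → EuclideanSpace ℝ (Fin d))
    (T : SimpleGraph (Fin n)) : Multiset ℝ :=
  T.edgeSet.toFinite.toFinset.val.map (edgeLength p)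

/-- `T` is a minimum spanning tree of the points `p`. -/
def IsMST {d n : ℕ} (p : Fin n → EuclideanSpace ℝ (Fin d)) (T : SimpleGraph (Fin n)) : Prop :=
  T.IsTree ∧ ∀ T' : SimpleGraph (Fin n), T'.IsTree → (edgeLengths p T).sum ≤ (edgeLengths p T').sum

/-- Length of the `k`-th longest edge of `T`, where `k = 1, 2, …`. -/
noncomputable def kthLongest {d n : ℕ} (p : Fin n → EuclideanSpace ℝ (Fin d))
    (T : SimpleGraph (Fin n)) (k : ℕ) : ℝ :=
  ((edgeLengths p T).sort (· ≥ ·)).getD (k - 1) 0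

/-- Length of the `k`-th shortest edge of `T`, where `k = 1, 2, …`. -/
noncomputable def kthShortest {d n : ℕ} (p : Fin n → EuclideanSpace ℝ (Fin d))
    (T : SimpleGraph (Fin n)) (k : ℕ) : ℝ :=
  ((edgeLengths p T).sort (· ≤ ·)).getD (k - 1) 0

end EuclideanMST

/-! Let the clusters of a point set at distance `x` be the connected components of the graph that
joins points at distance at most `x`. By Kruskal's exchange argument the edges of length at most `x`
of a minimum spanning tree have the same components as this graph, so the `k`-th longest edge `L` is
the least `x` with at most `k` clusters (`IsMST.kthLongest_le_iff`). The tree plays no further role: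
a threshold of a monotone counting function has to be approximated. The `k`-th shortest edge is the
`(n - k)`-th longest.

Rounding to a grid of mesh `δ` changes distances, measured in meshes, by at most `d`; hence the
cluster counts before and after rounding compare up to this blur (`Snapped.clusters_le`,
`Snapped.le_clusters`). With a hash table on the cells, breadth-first search counts the clusters of
`m` rounded points at distance `b` meshes in time `O(m (2b+1)^d)` (`comp_spec`). So comparing `L`
with a given number, up to a constant factor, takes linear time.

To locate `L` up to a constant factor, a random point is drawn and its distance `r` to its nearest
neighbour is computed. If `L` turns out to be small compared with `r`, every point that is isolated
at about that distance is a cluster by itself; it is removed and `k` is lowered by one for each.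
This removes all points whose nearest neighbour is at distance at least `r`. Otherwise the points
are rounded to a randomly shifted grid of mesh `2dr`. Either the cluster count shows that `L` is
`O(r)`, and the search is over, or `L` is large compared with the mesh, and the occupied cells
replace the points. In that case a point with nearest-neighbour distance at most `r` shares its cell
with its neighbour for at least half of the shifts. As the rank of `r` is random, a fixed fraction
of the points disappears in expectation (`le_sum_min_card`), and the expected costs of the rounds
form a geometric series with sum `O(n)`. The rounding errors do not pile up: the invariant `Approx`
bounds the total error by the current least distance and by `L / 2`, and `Approx.coarsen` shows that
it persists.

Once `L` lies in an interval whose ends have a constant ratio, trisection on the original points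
shrinks the interval by `2/3` per step. With gap `γ` a step costs `O(n (L/γ)^d)`, so the last step,
with `γ` about `ε L`, dominates and costs `O(n/ε^d)` (`refine_spec`).

The expected cost is followed through `ec`, the expected cost of the first `N` steps, where halting
in a state `s` is charged `F s`. With an infinite charge for wrong answers, one finite bound,
uniform in `N`, yields both the running time and the correctness of every output of positive
probability. -/

namespace RealRAM
open scoped ENNReal

/-! ### Expected cost -/

/-- Cost of the next step, where halting in the state `s` costs `F s`. -/
noncomputable def weight (F : State → ℝ≥0∞) : Config → ℝ≥0∞
  -- A halted configuration repeats forever and pays this charge in each further step. Only the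
  -- charges `0` and `∞` of `penalty` are used in the end, for which the repetition is harmless.
  | ([], s) => F s
  | (P :: K, s) => (stepCost (P :: K, s) : ℝ≥0∞)

/-- Expected cost of the first `N` steps. -/
noncomputable def ec (F : State → ℝ≥0∞) : ℕ → Config → ℝ≥0∞
  | 0, _ => 0
  | N + 1, c => weight F c + ∑' c', step c c' * ec F N c'

theorem stepCost_le_weight (F : State → ℝ≥0∞) (c : Config) :
    (stepCost c : ℝ≥0∞) ≤ weight F c := by
  rcases c with ⟨_ | ⟨P, K⟩, s⟩
  · simp [stepCost]
  · exact le_rfl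

theorem tsum_run_succ (w : Config → ℝ≥0∞) (t : ℕ) (c : Config) :
    ∑' c', run (t + 1) c c' * w c' = ∑' c', step c c' * ∑' c'', run t c' c'' * w c'' := by
  simp only [run, PMF.bind_apply, ← ENNReal.tsum_mul_right, ← ENNReal.tsum_mul_left]
  rw [ENNReal.tsum_comm]
  simp only [mul_assoc]

theorem tsum_run_zero (w : Config → ℝ≥0∞) (c : Config) :
    ∑' c', run 0 c c' * w c' = w c := by
  rw [tsum_eq_single c]
  · simp [run]
  · intro c' h
    simp [run, h]

theorem sum_run_eq_ec (F : State → ℝ≥0∞) (N : ℕ) : ∀ c : Config,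
    ∑ t ∈ Finset.range N, ∑' c', run t c c' * weight F c' = ec F N c := by
  induction N with
  | zero => intro c; simp [ec]
  | succ N ih =>
    intro c
    rw [Finset.sum_range_succ', tsum_run_zero, add_comm]
    simp only [tsum_run_succ, ec]
    congr 1
    rw [← Summable.tsum_finsetSum (fun _ _ => ENNReal.summable)]
    simp only [← Finset.mul_sum, ih]

theorem expectedTime_le {F : State → ℝ≥0∞} {P : Program} {s : State} {B : ℝ≥0∞}
    (h : ∀ N, ec F N ([P], s) ≤ B) : expectedTime P s ≤ B := by
  refine ENNReal.tsum_le_of_sum_range_le fun N => le_trans ?_ (h N)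
  rw [← sum_run_eq_ec]
  exact Finset.sum_le_sum fun t _ => ENNReal.tsum_le_tsum fun c =>
    mul_le_mul_right (stepCost_le_weight F c) _

/-- A state that is reached with positive probability and has infinite charge would make a partial
sum infinite. So the bound that controls the time also excludes wrong outputs. -/
theorem of_isOutput {Q : ℝ → Prop} {F : State → ℝ≥0∞} (hF : ∀ s, F s ≠ ⊤ → Q (s.reg 0))
    {P : Program} {s : State} {B : ℝ≥0∞} (hB : B ≠ ⊤)
    (h : ∀ N, ec F N ([P], s) ≤ B) {r : ℝ} (hr : IsOutput P s r) : Q r := by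
  obtain ⟨t, s', hs, rfl⟩ := hr
  apply hF
  intro htop
  apply hB
  rw [← top_le_iff]
  refine le_trans ?_ (h (t + 1))
  rw [← sum_run_eq_ec]
  refine le_trans ?_ (Finset.single_le_sum (f := fun t => ∑' c', run t ([P], s) c' * weight F c')
    (fun _ _ => zero_le) (Finset.self_mem_range_succ t))
  refine le_trans ?_ (ENNReal.le_tsum (([], s') : Config))
  simp only [weight, htop]
  rw [ENNReal.mul_top]
  exact (PMF.mem_support_iff _ _).1 hs

theorem tsum_pure (f : Config → ℝ≥0∞) (c : Config) : ∑' c', PMF.pure c c' * f c' = f c := by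
  rw [tsum_eq_single c]
  · simp
  · intro c' h
    simp [h]

theorem ec_mono_succ (F : State → ℝ≥0∞) (N : ℕ) : ∀ c, ec F N c ≤ ec F (N + 1) c := by
  induction N with
  | zero => intro c; simp [ec]
  | succ N ih =>
    intro c
    rw [ec, ec]
    gcongr
    exact ih _

theorem ec_succ_of_pure (F : State → ℝ≥0∞) (N : ℕ) {P : Program} {K : List Program} {s : State}
    {c : Config} (h : step (P :: K, s) = PMF.pure c) :
    ec F (N + 1) (P :: K, s) = stepCost (P :: K, s) + ec F N c := by
  rw [ec, h, tsum_pure]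
  rfl

/-- Big-step semantics of programs without random choices. -/
inductive Exec : Program → State → State → ℕ → Prop
  | skip (s : State) : Exec .skip s s 1
  | assign (x : ℕ) (e : Expr) (s : State) :
      Exec (.assign x e) s (s.setReg x (e.eval s)) (e.cost + 1)
  | load (x a : ℕ) (js : List ℕ) (s : State) :
      Exec (.load x a js) s (s.setReg x (s.mem a (s.key js))) (js.length + 1)
  | store (a : ℕ) (js : List ℕ) (x : ℕ) (s : State) :
      Exec (.store a js x) s (s.setMem a (s.key js) (s.reg x)) (js.length + 1)
  | seq {P Q : Program} {s s₁ s₂ : State} {T₁ T₂ : ℕ} :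
      Exec P s s₁ T₁ → Exec Q s₁ s₂ T₂ → Exec (.seq P Q) s s₂ (1 + T₁ + T₂)
  | ite_true {t : Test} {P Q : Program} {s s' : State} {T : ℕ} :
      t.Holds s → Exec P s s' T → Exec (.ite t P Q) s s' (t.cost + 1 + T)
  | ite_false {t : Test} {P Q : Program} {s s' : State} {T : ℕ} :
      ¬ t.Holds s → Exec Q s s' T → Exec (.ite t P Q) s s' (t.cost + 1 + T)
  | loop_false {t : Test} {P : Program} {s : State} :
      ¬ t.Holds s → Exec (.loop t P) s s (t.cost + 1)
  | loop_true {t : Test} {P : Program} {s s₁ s₂ : State} {T₁ T₂ : ℕ} :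
      t.Holds s → Exec P s s₁ T₁ → Exec (.loop t P) s₁ s₂ T₂ →
      Exec (.loop t P) s s₂ (t.cost + 1 + T₁ + T₂)

/-- Monotonicity in `N` allows the same `N` on both sides, so that the number of steps spent on
deterministic code never has to be tracked. -/
theorem ec_le_of_step (F : State → ℝ≥0∞) {P : Program} {K : List Program} {s : State}
    {c : Config} (h : step (P :: K, s) = PMF.pure c) (N : ℕ) :
    ec F N (P :: K, s) ≤ stepCost (P :: K, s) + ec F N c := by
  cases N with
  | zero => simp [ec]
  | succ N =>
    rw [ec_succ_of_pure F N h]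
    gcongr
    exact ec_mono_succ F N c

/-- The bridge between big-step runs and expected cost. The continuation `K` is arbitrary, so
deterministic pieces can be placed between random draws. -/
theorem Exec.ec_le (F : State → ℝ≥0∞) {P : Program} {s s' : State} {T : ℕ} (h : Exec P s s' T) :
    ∀ (N : ℕ) (K : List Program), ec F N (P :: K, s) ≤ T + ec F N (K, s') := by
  induction h with
  | skip s => intro N K; simpa [stepCost] using ec_le_of_step F (P := .skip) (K := K) (s := s) rfl N
  | assign x e s =>
    intro N K; simpa [stepCost] using ec_le_of_step F (P := .assign x e) (K := K) (s := s) rfl N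
  | load x a js s =>
    intro N K; simpa [stepCost] using ec_le_of_step F (P := .load x a js) (K := K) (s := s) rfl N
  | store a js x s =>
    intro N K; simpa [stepCost] using ec_le_of_step F (P := .store a js x) (K := K) (s := s) rfl N
  | @seq P Q s s₁ s₂ T₁ T₂ _ _ ih₁ ih₂ =>
    intro N K
    refine (ec_le_of_step F (c := (P :: Q :: K, s)) rfl N).trans ?_
    simp only [stepCost, Nat.cast_add, Nat.cast_one, add_assoc]
    gcongr
    exact (ih₁ N _).trans (by gcongr; exact ih₂ N K)
  | @ite_true t P Q s s' T ht _ ih =>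
    intro N K
    refine (ec_le_of_step F (c := (P :: K, s)) (by simp [step, ht]) N).trans ?_
    simp only [stepCost, Nat.cast_add, Nat.cast_one, add_assoc]
    gcongr
    exact ih N K
  | @ite_false t P Q s s' T ht _ ih =>
    intro N K
    refine (ec_le_of_step F (c := (Q :: K, s)) (by simp [step, ht]) N).trans ?_
    simp only [stepCost, Nat.cast_add, Nat.cast_one, add_assoc]
    gcongr
    exact ih N K
  | @loop_false t P s ht =>
    intro N K
    refine (ec_le_of_step F (c := (K, s)) (by simp [step, ht]) N).trans ?_
    simp only [stepCost, Nat.cast_add, Nat.cast_one]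
    exact le_rfl
  | @loop_true t P s s₁ s₂ T₁ T₂ ht _ _ ih₁ ih₂ =>
    intro N K
    refine (ec_le_of_step F (c := (P :: .loop t P :: K, s)) (by simp [step, ht]) N).trans ?_
    simp only [stepCost, Nat.cast_add, Nat.cast_one, add_assoc]
    gcongr
    exact (ih₁ N _).trans (by gcongr; exact ih₂ N K)

theorem uniformBelow_succ (m : ℕ) : uniformBelow (m + 1) =
    (PMF.uniformOfFintype (Fin (m + 1))).map fun i : Fin (m + 1) => ((i : ℕ) : ℝ) := by
  simp only [uniformBelow]
  rw [← PMF.monad_map_eq_map, ← PMF.monad_map_eq_map]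
  simp

theorem ec_rand_le (F : State → ℝ≥0∞) (N : ℕ) (x : ℕ) (e : Expr) (K : List Program) (s : State)
    {m : ℕ} (hm : 0 < m) (he : e.eval s = m) :
    ec F N (.rand x e :: K, s) ≤
      (e.cost + 1 : ℕ) + (m : ℝ≥0∞)⁻¹ * ∑ i ∈ Finset.range m, ec F N (K, s.setReg x (i : ℝ)) := by
  cases N with
  | zero => simp [ec]
  | succ N =>
    obtain ⟨m, rfl⟩ := Nat.exists_eq_succ_of_ne_zero hm.ne'
    rw [ec]
    gcongr
    · exact le_rfl
    · have : step (.rand x e :: K, s) = (PMF.uniformOfFintype (Fin (m + 1))).map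
          fun i : Fin (m + 1) => (K, s.setReg x ((i : ℕ) : ℝ)) := by
        simp only [step, he, Nat.floor_natCast, Nat.succ_eq_add_one, uniformBelow_succ]
        exact PMF.map_comp _ _ _
      rw [this, PMF.map]
      simp only [PMF.bind_apply, ← ENNReal.tsum_mul_right]
      rw [ENNReal.tsum_comm]
      simp only [mul_assoc, ENNReal.tsum_mul_left, tsum_pure, Function.comp]
      rw [tsum_fintype, Nat.succ_eq_add_one, ← Fin.sum_univ_eq_sum_range
        (fun i : ℕ => ec F (N + 1) (K, s.setReg x (i : ℝ))) (m + 1), Finset.mul_sum]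
      gcongr with i
      · simp
      · exact ec_mono_succ F N _

/-! ### Frames -/

/-- `P` contains an instruction that writes the register `x`. -/
def Program.Writes (x : ℕ) : Program → Prop
  | .skip => False
  | .assign y _ => x = y
  | .load y _ _ => x = y
  | .store _ _ _ => False
  | .rand y _ => x = y
  | .seq P Q => P.Writes x ∨ Q.Writes x
  | .ite _ P Q => P.Writes x ∨ Q.Writes x
  | .loop _ P => P.Writes x

@[simp] theorem State.reg_setReg (s : State) (x y : ℕ) (v : ℝ) :
    (s.setReg x v).reg y = if y = x then v else s.reg y := by
  simp [State.setReg, Function.update_apply]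

@[simp] theorem State.mem_setReg (s : State) (x : ℕ) (v : ℝ) : (s.setReg x v).mem = s.mem := rfl

@[simp] theorem State.reg_setMem (s : State) (a : ℕ) (key : List ℤ) (v : ℝ) :
    (s.setMem a key v).reg = s.reg := rfl

@[simp] theorem State.mem_setMem (s : State) (a b : ℕ) (key key' : List ℤ) (v : ℝ) :
    (s.setMem a key v).mem b key' = if b = a ∧ key' = key then v else s.mem b key' := by
  by_cases h : b = a
  · subst h; simp [State.setMem, Function.update_apply]
  · simp [State.setMem, h]

theorem Exec.reg_eq {P : Program} {s s' : State} {T : ℕ} (h : Exec P s s' T) {x : ℕ}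
    (hx : ¬ P.Writes x) : s'.reg x = s.reg x := by
  induction h with
  | skip s => rfl
  | assign y e s => simp only [Program.Writes] at hx; simp [hx]
  | load y a js s => simp only [Program.Writes] at hx; simp [hx]
  | store a js y s => rfl
  | seq _ _ ih₁ ih₂ =>
    simp only [Program.Writes, not_or] at hx
    rw [ih₂ hx.2, ih₁ hx.1]
  | ite_true _ _ ih => simp only [Program.Writes, not_or] at hx; exact ih hx.1
  | ite_false _ _ ih => simp only [Program.Writes, not_or] at hx; exact ih hx.2
  | loop_false _ => rfl
  | loop_true _ _ _ ih₁ ih₂ => rw [ih₂ hx, ih₁ hx]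

/-! ### Programs without loops and random choices -/

/-- No loops and no random choices. -/
def Program.Flat : Program → Prop
  | .rand _ _ => False
  | .seq P Q => P.Flat ∧ Q.Flat
  | .ite _ P Q => P.Flat ∧ Q.Flat
  | .loop _ _ => False
  | _ => True

open Classical in
/-- The state after running a flat program. -/
noncomputable def Program.sem : Program → State → State
  | .assign x e, s => s.setReg x (e.eval s)
  | .load x a js, s => s.setReg x (s.mem a (s.key js))
  | .store a js x, s => s.setMem a (s.key js) (s.reg x)
  | .seq P Q, s => Q.sem (P.sem s)
  | .ite t P Q, s => if t.Holds s then P.sem s else Q.sem s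
  | _, s => s

/-- Bound for the running time of a flat program. -/
def Program.bound : Program → ℕ
  | .skip => 1
  | .assign _ e => e.cost + 1
  | .load _ _ js => js.length + 1
  | .store _ js _ => js.length + 1
  | .rand _ _ => 0
  | .seq P Q => 1 + P.bound + Q.bound
  | .ite t P Q => t.cost + 1 + (P.bound + Q.bound)
  | .loop _ _ => 0

theorem Program.Flat.exec {P : Program} (h : P.Flat) :
    ∀ s, ∃ T ≤ P.bound, Exec P s (P.sem s) T := by
  induction P with
  | skip => exact fun s => ⟨_, le_rfl, .skip s⟩
  | assign x e => exact fun s => ⟨_, le_rfl, .assign x e s⟩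
  | load x a js => exact fun s => ⟨_, le_rfl, .load x a js s⟩
  | store a js x => exact fun s => ⟨_, le_rfl, .store a js x s⟩
  | rand x e => exact h.elim
  | seq P Q ih₁ ih₂ =>
    intro s
    obtain ⟨T₁, h₁, e₁⟩ := ih₁ h.1 s
    obtain ⟨T₂, h₂, e₂⟩ := ih₂ h.2 (P.sem s)
    exact ⟨_, by simp only [Program.bound]; omega, .seq e₁ e₂⟩
  | ite t P Q ih₁ ih₂ =>
    intro s
    by_cases ht : t.Holds s
    · obtain ⟨T, h', e⟩ := ih₁ h.1 s
      refine ⟨t.cost + 1 + T, by simp only [Program.bound]; omega, ?_⟩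
      simp only [Program.sem, ht, if_true]
      exact .ite_true ht e
    · obtain ⟨T, h', e⟩ := ih₂ h.2 s
      refine ⟨t.cost + 1 + T, by simp only [Program.bound]; omega, ?_⟩
      simp only [Program.sem, ht, if_false]
      exact .ite_false ht e
  | loop t P _ => exact h.elim

theorem Program.Flat.reg_eq {P : Program} (h : P.Flat) (s : State) {x : ℕ} (hx : ¬ P.Writes x) :
    (P.sem s).reg x = s.reg x := by
  obtain ⟨T, -, e⟩ := h.exec s
  exact e.reg_eq hx

/-! ### Total correctness with running time -/

/-- Started in `s`, the program `P` halts within time `B`, in a state that satisfies `Q`. -/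
def Tri (P : Program) (s : State) (B : ℝ) (Q : State → Prop) : Prop :=
  ∃ (s' : State) (T : ℕ), Exec P s s' T ∧ (T : ℝ) ≤ B ∧ Q s'

theorem Tri.mono {P : Program} {s : State} {B B' : ℝ} {Q Q' : State → Prop} (h : Tri P s B Q)
    (hB : B ≤ B') (hQ : ∀ s', (∀ x, ¬ P.Writes x → s'.reg x = s.reg x) → Q s' → Q' s') :
    Tri P s B' Q' := by
  obtain ⟨s', T, e, hT, hq⟩ := h
  exact ⟨s', T, e, hT.trans hB, hQ s' (fun x hx => e.reg_eq hx) hq⟩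

theorem Tri.of_flat {P : Program} {s : State} {Q : State → Prop} (h : P.Flat)
    (hQ : Q (P.sem s)) : Tri P s P.bound Q := by
  obtain ⟨T, hT, e⟩ := h.exec s
  exact ⟨_, T, e, by exact_mod_cast hT, hQ⟩

theorem Tri.seq {P P' : Program} {s : State} {B B' : ℝ} {Q Q' : State → Prop} (h : Tri P s B Q)
    (h' : ∀ s', (∀ x, ¬ P.Writes x → s'.reg x = s.reg x) → Q s' → Tri P' s' B' Q') :
    Tri (.seq P P') s (1 + B + B') Q' := by
  obtain ⟨s₁, T₁, e₁, hT₁, hq⟩ := h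
  obtain ⟨s₂, T₂, e₂, hT₂, hq'⟩ := h' s₁ (fun x hx => e₁.reg_eq hx) hq
  exact ⟨s₂, _, .seq e₁ e₂, by push_cast; linarith, hq'⟩

theorem Tri.ite {t : Test} {P P' : Program} {s : State} {B : ℝ} {Q : State → Prop}
    (h : t.Holds s → Tri P s B Q) (h' : ¬ t.Holds s → Tri P' s B Q) :
    Tri (.ite t P P') s (t.cost + 1 + B) Q := by
  by_cases ht : t.Holds s
  · obtain ⟨s₁, T₁, e₁, hT₁, hq⟩ := h ht
    exact ⟨s₁, _, .ite_true ht e₁, by push_cast; linarith, hq⟩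
  · obtain ⟨s₁, T₁, e₁, hT₁, hq⟩ := h' ht
    exact ⟨s₁, _, .ite_false ht e₁, by push_cast; linarith, hq⟩

/-- The loop rule: the potential `Φ` pays for the iterations. -/
theorem Tri.loop {t : Test} {P : Program} (I : State → Prop) (Φ : State → ℝ)
    (hΦ : ∀ s, I s → 0 ≤ Φ s)
    (h : ∀ s, I s → t.Holds s →
      ∃ B, Tri P s B (fun s' => I s' ∧ t.cost + 1 + B + Φ s' ≤ Φ s))
    {s : State} (hs : I s) :
    Tri (.loop t P) s (t.cost + 1 + Φ s) (fun s' => I s' ∧ ¬ t.Holds s') := by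
  -- The real potential drops by at least `1` in each iteration, since the test alone costs that
  -- much; this permits induction on an integer bound for it.
  suffices H : ∀ (n : ℕ) (s : State), I s → Φ s ≤ n →
      Tri (.loop t P) s (t.cost + 1 + Φ s) (fun s' => I s' ∧ ¬ t.Holds s') by
    obtain ⟨n, hn⟩ := exists_nat_ge (Φ s)
    exact H n s hs hn
  intro n
  induction n with
  | zero =>
    intro s hI hn
    by_cases ht : t.Holds s
    · obtain ⟨B, s₁, T₁, e₁, hT₁, hI₁, hq⟩ := h s hI ht
      have := hΦ s₁ hI₁
      have h0 : (0 : ℝ) ≤ T₁ := T₁.cast_nonneg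
      have h1 : (0 : ℝ) ≤ t.cost := t.cost.cast_nonneg
      simp only [Nat.cast_zero] at hn
      linarith
    · refine ⟨s, _, .loop_false ht, ?_, hI, ht⟩
      have := hΦ s hI
      push_cast; linarith
  | succ n ih =>
    intro s hI hn
    by_cases ht : t.Holds s
    · obtain ⟨B, s₁, T₁, e₁, hT₁, hI₁, hq⟩ := h s hI ht
      have h0 : (0 : ℝ) ≤ T₁ := T₁.cast_nonneg
      have h1 : (0 : ℝ) ≤ t.cost := t.cost.cast_nonneg
      push_cast at hn
      obtain ⟨s₂, T₂, e₂, hT₂, hq₂⟩ := ih s₁ hI₁ (by linarith)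
      exact ⟨s₂, _, .loop_true ht e₁ e₂, by push_cast; linarith, hq₂⟩
    · refine ⟨s, _, .loop_false ht, ?_, hI, ht⟩
      have := hΦ s hI
      push_cast; linarith

theorem Tri.ec_le {P : Program} {s : State} {B : ℝ} {Q : State → Prop} (h : Tri P s B Q)
    (F : State → ℝ≥0∞) (N : ℕ) (K : List Program) :
    ∃ s', Q s' ∧ ec F N (P :: K, s) ≤ ENNReal.ofReal B + ec F N (K, s') := by
  obtain ⟨s', T, e, hT, hq⟩ := h
  refine ⟨s', hq, (e.ec_le F N K).trans ?_⟩
  gcongr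
  rw [← ENNReal.ofReal_natCast]
  exact ENNReal.ofReal_le_ofReal hT

/-! ### Blocks -/

/-- Sequential composition of a list of programs. -/
def block : List Program → Program
  | [] => .skip
  | P :: L => .seq P (block L)

/-- Sequential composition of `f 0, …, f (n - 1)`. -/
def unroll : ℕ → (ℕ → Program) → Program
  | 0, _ => .skip
  | n + 1, f => .seq (unroll n f) (f n)

theorem sem_block_nil (s : State) : (block []).sem s = s := rfl

theorem sem_block_cons (P : Program) (L : List Program) (s : State) :
    (block (P :: L)).sem s = (block L).sem (P.sem s) := rfl

theorem flat_block {L : List Program} : (block L).Flat ↔ ∀ P ∈ L, P.Flat := by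
  induction L with
  | nil => simp [block, Program.Flat]
  | cons P L ih => simp [block, Program.Flat, ih]

theorem writes_block {L : List Program} {x : ℕ} : (block L).Writes x ↔ ∃ P ∈ L, P.Writes x := by
  induction L with
  | nil => simp [block, Program.Writes]
  | cons P L ih => simp [block, Program.Writes, ih]

theorem sem_unroll_zero (f : ℕ → Program) (s : State) : (unroll 0 f).sem s = s := rfl

theorem sem_unroll_succ (n : ℕ) (f : ℕ → Program) (s : State) :
    (unroll (n + 1) f).sem s = (f n).sem ((unroll n f).sem s) := rfl

theorem flat_unroll {n : ℕ} {f : ℕ → Program} (h : ∀ j, (f j).Flat) : (unroll n f).Flat := by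
  induction n with
  | zero => trivial
  | succ n ih => exact ⟨ih, h n⟩

theorem writes_unroll {n : ℕ} {f : ℕ → Program} {x : ℕ} :
    (unroll n f).Writes x ↔ ∃ j < n, (f j).Writes x := by
  induction n with
  | zero => simp [unroll, Program.Writes]
  | succ n ih =>
    simp only [unroll, Program.Writes, ih, Nat.lt_succ_iff_lt_or_eq, or_and_right, exists_or,
      exists_eq_left]

/-- The test `a < b`. -/
def Test.lt (a b : Expr) : Test := .not (.le b a)

@[simp] theorem Test.holds_lt (s : State) (a b : Expr) :
    (Test.lt a b).Holds s ↔ a.eval s < b.eval s := by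
  simp [Test.lt, Test.Holds]

end RealRAM

/-! ### Components of graphs, and counting edges of subforests -/

namespace SimpleGraph

/-- The induced map on components is surjective, because every vertex of `H` is joined to the image
of `f`. All comparisons of cluster counts by rounding or by monotonicity go through this. -/
theorem card_connectedComponent_le_of_map {V W : Type*} [Finite V] {G : SimpleGraph V}
    {H : SimpleGraph W} (f : V → W) (hf : ∀ u v, G.Adj u v → H.Reachable (f u) (f v))
    (hs : ∀ w, ∃ v, H.Reachable (f v) w) :
    Nat.card H.ConnectedComponent ≤ Nat.card G.ConnectedComponent := by
  have hr : ∀ u v, G.Reachable u v → H.Reachable (f u) (f v) := by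
    rintro u v ⟨p⟩
    induction p with
    | nil => exact Reachable.refl _
    | cons h _ ih => exact (hf _ _ h).trans ih
  refine Nat.card_le_card_of_surjective (fun c : G.ConnectedComponent =>
    c.lift (fun v => H.connectedComponentMk (f v))
      fun u v p _ => ConnectedComponent.sound (hr u v ⟨p⟩)) ?_
  intro c
  induction c using ConnectedComponent.ind with
  | h w =>
    obtain ⟨v, hv⟩ := hs w
    exact ⟨G.connectedComponentMk v, ConnectedComponent.sound hv⟩

theorem Reachable.sup_edge_cases {V : Type*} {G : SimpleGraph V} {u v a b : V}
    (h : (G ⊔ edge u v).Reachable a b) :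
    G.Reachable a b ∨ (G.Reachable a u ∧ G.Reachable v b) ∨
      (G.Reachable a v ∧ G.Reachable u b) := by
  obtain ⟨p⟩ := h
  induction p with
  | nil => exact .inl (Reachable.refl _)
  | @cons a c b hac _ ih =>
    rw [sup_adj, edge_adj] at hac
    rcases hac with hac | ⟨⟨rfl, rfl⟩ | ⟨rfl, rfl⟩, _⟩
    · rcases ih with h | ⟨h, h'⟩ | ⟨h, h'⟩
      · exact .inl (hac.reachable.trans h)
      · exact .inr (.inl ⟨hac.reachable.trans h, h'⟩)
      · exact .inr (.inr ⟨hac.reachable.trans h, h'⟩)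
    · rcases ih with h | ⟨h, h'⟩ | ⟨h, h'⟩
      · exact .inr (.inl ⟨Reachable.refl _, h⟩)
      · exact .inr (.inl ⟨Reachable.refl _, h'⟩)
      · exact .inl h'
    · rcases ih with h | ⟨h, h'⟩ | ⟨h, h'⟩
      · exact .inr (.inr ⟨Reachable.refl _, h⟩)
      · exact .inl h'
      · exact .inr (.inr ⟨Reachable.refl _, h'⟩)

/-- A new edge can only merge the component of `v` with another one: once that component is set
aside as `none`, the map on the remaining components is injective. -/
theorem card_connectedComponent_le_sup_edge {V : Type*} [Finite V] (G : SimpleGraph V) (u v : V) :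
    Nat.card G.ConnectedComponent ≤ Nat.card (G ⊔ edge u v).ConnectedComponent + 1 := by
  classical
  have : Finite (Option (G ⊔ edge u v).ConnectedComponent) := inferInstance
  rw [← Finite.card_option]
  refine Nat.card_le_card_of_injective (fun c : G.ConnectedComponent =>
    if c = G.connectedComponentMk v then none else
      some (c.map (Hom.ofLE (le_sup_left : G ≤ G ⊔ edge u v)))) ?_
  intro c c' h
  induction c using ConnectedComponent.ind with
  | h a =>
  induction c' using ConnectedComponent.ind with
  | h b =>
    simp only at h
    split_ifs at h with h₁ h₂ h₂
    · rw [h₁, h₂]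
    · simp only [ConnectedComponent.map_mk, Option.some.injEq, ConnectedComponent.eq,
        Hom.coe_ofLE, id] at h h₁ h₂
      rw [ConnectedComponent.eq]
      rcases h.sup_edge_cases with h | ⟨h, h'⟩ | ⟨h, h'⟩
      · exact h
      · exact (h₂ h'.symm).elim
      · exact (h₁ h).elim

/-- Each added pair raises the cardinality by one and lowers the number of components by at most
one. -/
theorem card_add_card_connectedComponent_mono {V : Type*} [Finite V] {S S' : Finset (Sym2 V)}
    (h : S ⊆ S') :
    S.card + Nat.card (fromEdgeSet (S : Set (Sym2 V))).ConnectedComponent ≤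
      S'.card + Nat.card (fromEdgeSet (S' : Set (Sym2 V))).ConnectedComponent := by
  classical
  have h2 : ∀ R : Finset (Sym2 V), Disjoint R S →
      S.card + Nat.card (fromEdgeSet (S : Set (Sym2 V))).ConnectedComponent ≤ (R ∪ S).card +
        Nat.card (fromEdgeSet ((R ∪ S : Finset (Sym2 V)) : Set (Sym2 V))).ConnectedComponent := by
    intro R hR
    induction R using Finset.induction_on with
    | empty => simp
    | insert e R he ih =>
      rw [Finset.disjoint_insert_left] at hR
      refine (ih hR.2).trans ?_
      rw [Finset.insert_union, Finset.card_insert_of_notMem (by simp [he, hR.1]), add_assoc,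
        add_comm 1]
      gcongr
      induction e with
      | h u v =>
        rw [Finset.coe_insert, Set.insert_eq, Set.union_comm, fromEdgeSet_union]
        exact card_connectedComponent_le_sup_edge _ u v
  have := h2 (S' \ S) Finset.sdiff_disjoint
  rwa [Finset.sdiff_union_of_subset h] at this

/-- In a tree, the number of edges of a subforest and of its components add up. -/
theorem IsTree.card_add_card_connectedComponent {V : Type*} [Fintype V] {T : SimpleGraph V}
    (hT : T.IsTree) {S : Finset (Sym2 V)} (hS : (S : Set (Sym2 V)) ⊆ T.edgeSet) :
    S.card + Nat.card (fromEdgeSet (S : Set (Sym2 V))).ConnectedComponent = Fintype.card V := by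
  classical
  -- `S` lies between the empty set and the edge set of `T`. By monotonicity its sum lies between `0
  -- + |V|` and `(|V| - 1) + 1`.
  refine le_antisymm ?_ ?_
  · have h := card_add_card_connectedComponent_mono (S := S) (S' := T.edgeFinset)
      (by intro e he; simpa using hS he)
    have hc : Nat.card (fromEdgeSet (T.edgeFinset : Set (Sym2 V))).ConnectedComponent = 1 := by
      rw [coe_edgeFinset, fromEdgeSet_edgeSet]
      have := hT.connected.preconnected.subsingleton_connectedComponent
      have := hT.connected.nonempty
      exact Nat.card_eq_one_iff_unique.2 ⟨inferInstance, inferInstance⟩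
    rw [hc, hT.card_edgeFinset] at h
    exact h
  · have h := card_add_card_connectedComponent_mono (Finset.empty_subset S)
    refine le_trans ?_ h
    rw [Finset.card_empty, zero_add, ← Nat.card_eq_fintype_card]
    refine Nat.card_le_card_of_injective
      (fun v => (fromEdgeSet ((∅ : Finset (Sym2 V)) : Set (Sym2 V))).connectedComponentMk v) ?_
    intro a b hab
    simpa [ConnectedComponent.eq] using hab

end SimpleGraph

/-! ### Clusters and minimum spanning trees -/

namespace EuclideanMST

open SimpleGraph

variable {ι κ : Type*} {d : ℕ}

/-- The graph of the pairs of points at distance at most `x`. -/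
def nearGraph (q : ι → EuclideanSpace ℝ (Fin d)) (x : ℝ) : SimpleGraph ι where
  Adj i j := i ≠ j ∧ dist (q i) (q j) ≤ x
  symm := ⟨fun i j h => ⟨h.1.symm, by rw [_root_.dist_comm]; exact h.2⟩⟩
  loopless := ⟨fun _ h => h.1 rfl⟩

/-- The number of clusters of the points `q` at distance `x`. -/
noncomputable def clusters (q : ι → EuclideanSpace ℝ (Fin d)) (x : ℝ) : ℕ :=
  Nat.card (nearGraph q x).ConnectedComponent

theorem nearGraph_reachable (q : ι → EuclideanSpace ℝ (Fin d)) {x : ℝ} {i j : ι}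
    (h : dist (q i) (q j) ≤ x) : (nearGraph q x).Reachable i j := by
  by_cases hij : i = j
  · rw [hij]
  · exact SimpleGraph.Adj.reachable ⟨hij, h⟩

theorem clusters_le [Finite ι] {q : ι → EuclideanSpace ℝ (Fin d)}
    {q' : κ → EuclideanSpace ℝ (Fin d)} {x y : ℝ} (f : ι → κ)
    (hf : ∀ i j, dist (q i) (q j) ≤ x → dist (q' (f i)) (q' (f j)) ≤ y)
    (hs : ∀ w, ∃ i, dist (q' (f i)) (q' w) ≤ y) : clusters q' y ≤ clusters q x :=
  card_connectedComponent_le_of_map f (fun i j h => nearGraph_reachable q' (hf i j h.2))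
    fun w => (hs w).imp fun _ h => nearGraph_reachable q' h

theorem clusters_antitone [Finite ι] (q : ι → EuclideanSpace ℝ (Fin d)) :
    Antitone (clusters q) := by
  intro x y hxy
  exact card_connectedComponent_le_of_map id
    (fun i j h => nearGraph_reachable q (h.2.trans hxy)) fun w => ⟨w, Reachable.refl _⟩

theorem clusters_le_card [Finite ι] (q : ι → EuclideanSpace ℝ (Fin d)) (x : ℝ) :
    clusters q x ≤ Nat.card ι :=
  Nat.card_le_card_of_surjective (nearGraph q x).connectedComponentMk
    fun c => c.ind fun v => ⟨v, rfl⟩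

theorem clusters_of_lt [Finite ι] {q : ι → EuclideanSpace ℝ (Fin d)} {x : ℝ}
    (h : ∀ i j, i ≠ j → x < dist (q i) (q j)) : clusters q x = Nat.card ι := by
  refine le_antisymm (clusters_le_card q x) ?_
  refine Nat.card_le_card_of_injective (nearGraph q x).connectedComponentMk ?_
  intro i j hij
  rw [ConnectedComponent.eq] at hij
  obtain ⟨p⟩ := hij
  cases p with
  | nil => rfl
  | cons h' _ => exact absurd h'.2 (not_le.2 (h _ _ h'.1))

variable {n : ℕ} {p : Fin n → EuclideanSpace ℝ (Fin d)} {T : SimpleGraph (Fin n)}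

theorem edgeLength_nonneg (p : Fin n → EuclideanSpace ℝ (Fin d)) (e : Sym2 (Fin n)) : 0 ≤ edgeLength p e := by
  induction e with
  | h u v => exact dist_nonneg (x := p u) (y := p v)

theorem sum_edgeLengths_mono {T' : SimpleGraph (Fin n)} (h : T ≤ T') :
    (edgeLengths p T).sum ≤ (edgeLengths p T').sum := by
  refine Finset.sum_le_sum_of_subset_of_nonneg (f := edgeLength p) ?_
    fun _ _ _ => edgeLength_nonneg p _
  intro e he
  simp only [Set.Finite.mem_toFinset] at he ⊢
  exact edgeSet_mono h he

/-- Lengths are nonnegative, so passing to a spanning tree does not increase the sum. The exchange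
argument then only has to produce a connected graph. -/
theorem IsMST.le_of_connected (hT : IsMST p T) {T' : SimpleGraph (Fin n)} (h : T'.Connected) :
    (edgeLengths p T).sum ≤ (edgeLengths p T').sum := by
  obtain ⟨T'', hle, ht⟩ := h.exists_isTree_le
  exact (hT.2 T'' ht).trans (sum_edgeLengths_mono hle)

/-- The edges of a minimum spanning tree of length at most `x` connect any two points at distance
at most `x`. -/
theorem IsMST.reachable_of_dist_le (hT : IsMST p T) {x : ℝ} {a b : Fin n}
    (h : dist (p a) (p b) ≤ x) : (T ⊓ nearGraph p x).Reachable a b := by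
  classical
  by_contra hab
  obtain ⟨P, hP⟩ := (hT.1.connected a b).exists_isPath
  -- The tree path from `a` to `b` leaves the set of vertices that short tree edges reach from `a`;
  -- the edge `uv` where it does so is longer than `x`.
  obtain ⟨D, hD, h1, h2⟩ := P.exists_boundary_dart
    {v | (T ⊓ nearGraph p x).Reachable a v} (Reachable.refl _) hab
  obtain ⟨⟨u, v⟩, huv⟩ := D
  simp only [Set.mem_ofPred_eq] at h1 h2
  have hlen : x < dist (p u) (p v) := by
    by_contra hle
    refine h2 (h1.trans (SimpleGraph.Adj.reachable ?_))
    exact ⟨huv, huv.ne, not_lt.1 hle⟩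
  have hPe : s(u, v) ∈ P.edges := by
    simp only [Walk.edges, List.mem_map]
    exact ⟨_, hD, rfl⟩
  set T₀ := T.deleteEdges {s(u, v)} with hT₀
  have hTe : T = T₀ ⊔ edge u v := by
    ext i j
    simp only [hT₀, sup_adj, deleteEdges_adj, edge_adj, Set.mem_singleton_iff]
    constructor
    · intro hij
      by_cases hh : s(i, j) = s(u, v)
      · right
        exact ⟨by simpa [Sym2.eq_iff] using hh, hij.ne⟩
      · exact .inl ⟨hij, hh⟩
    · rintro (hij | ⟨⟨rfl, rfl⟩ | ⟨rfl, rfl⟩, _⟩)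
      · exact hij.1
      · exact huv
      · exact huv.symm
  have hle : T₀ ≤ T := deleteEdges_le _
  -- The tree path is unique and uses `uv`. Without `uv` the vertices `a` and `b` are therefore
  -- disconnected, and each of them lies on the side of one end of `uv`.
  have hsplit : (T₀.Reachable a u ∧ T₀.Reachable v b) ∨ (T₀.Reachable a v ∧ T₀.Reachable u b) := by
    have hr : (T₀ ⊔ edge u v).Reachable a b := by rw [← hTe]; exact hT.1.connected a b
    refine hr.sup_edge_cases.resolve_left fun h0 => ?_
    obtain ⟨P', hP'⟩ := h0.exists_isPath
    have hPP : P = P'.mapLe hle := congrArg Subtype.val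
      ((hT.1.isAcyclic.subsingleton_path a b).elim ⟨P, hP⟩ ⟨P'.mapLe hle, hP'.mapLe hle⟩)
    rw [hPP, Walk.edges_mapLe_eq_edges] at hPe
    have := P'.edges_subset_edgeSet hPe
    rw [hT₀, edgeSet_deleteEdges] at this
    exact this.2 rfl
  have hab' : a ≠ b := by rintro rfl; exact hab (Reachable.refl _)
  set T' := T₀ ⊔ edge a b with hT'
  have hT'ab : T'.Reachable a b := by
    refine SimpleGraph.Adj.reachable ?_
    rw [hT', sup_adj, edge_adj]
    exact .inr ⟨.inl ⟨rfl, rfl⟩, hab'⟩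
  have hle' : T₀ ≤ T' := le_sup_left
  have hT'uv : T'.Reachable u v := by
    rcases hsplit with ⟨h, h'⟩ | ⟨h, h'⟩
    · exact (h.symm.mono hle').trans (hT'ab.trans (h'.symm.mono hle'))
    · exact (h'.mono hle').trans (hT'ab.symm.trans (h.mono hle'))
  have hconn : T'.Connected := by
    have := hT.1.connected.nonempty
    refine ⟨fun i j => ?_⟩
    obtain ⟨q⟩ := hT.1.connected i j
    induction q with
    | nil => exact Reachable.refl _
    | @cons i k j hik _ ih =>
      refine Reachable.trans ?_ ih
      rw [hTe, sup_adj, edge_adj] at hik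
      rcases hik with hik | ⟨⟨rfl, rfl⟩ | ⟨rfl, rfl⟩, _⟩
      · exact (hik.reachable).mono hle'
      · exact hT'uv
      · exact hT'uv.symm
  have hsum := hT.le_of_connected hconn
  have e1 : (edgeLengths p T).sum = dist (p u) (p v) + (edgeLengths p T₀).sum := by
    have : T.edgeSet.toFinite.toFinset = insert s(u, v) T₀.edgeSet.toFinite.toFinset := by
      ext e
      simp only [Set.Finite.mem_toFinset, Finset.mem_insert, hT₀, edgeSet_deleteEdges,
        Set.mem_sdiff, Set.mem_singleton_iff]
      by_cases he : e = s(u, v)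
      · subst he; simpa using huv
      · simp [he]
    change ∑ e ∈ T.edgeSet.toFinite.toFinset, edgeLength p e = _
    rw [this, Finset.sum_insert (by simp [hT₀])]
    rfl
  -- An inequality suffices, and it makes it unnecessary to show that `s(a, b)` is not yet an edge
  -- of `T₀`.
  have e2 : (edgeLengths p T').sum ≤ dist (p a) (p b) + (edgeLengths p T₀).sum := by
    have : T'.edgeSet.toFinite.toFinset ⊆ insert s(a, b) T₀.edgeSet.toFinite.toFinset := by
      intro e
      simp only [Set.Finite.mem_toFinset, Finset.mem_insert, hT', edgeSet_sup]
      rintro (he | he)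
      · exact .inr he
      · left
        have := edgeSet_fromEdgeSet {s(a, b)} ▸ he
        exact this.1
    calc (edgeLengths p T').sum ≤ ∑ e ∈ insert s(a, b) T₀.edgeSet.toFinite.toFinset,
          edgeLength p e :=
          Finset.sum_le_sum_of_subset_of_nonneg this fun _ _ _ => edgeLength_nonneg p _
      _ ≤ _ := by
        by_cases hm : s(a, b) ∈ T₀.edgeSet.toFinite.toFinset
        · rw [Finset.insert_eq_of_mem hm]
          exact le_add_of_nonneg_left dist_nonneg
        · rw [Finset.sum_insert hm]
          exact le_rfl
  -- Replacing `uv`, longer than `x`, by `ab`, of length at most `x`, contradicts minimality.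
  linarith

/-- The tree edges of length at most `x` form a forest with the same components as the near graph,
so the count of edges and components in a subforest applies. -/
theorem IsMST.countP_add_clusters (hT : IsMST p T) (x : ℝ) :
    (edgeLengths p T).countP (· ≤ x) + clusters p x = n := by
  classical
  set S := T.edgeSet.toFinite.toFinset.filter fun e => edgeLength p e ≤ x with hS
  have hSm : ∀ e, e ∈ S ↔ e ∈ T.edgeSet ∧ edgeLength p e ≤ x := by
    intro e
    rw [hS, Finset.mem_filter, Set.Finite.mem_toFinset]
  have h := hT.1.card_add_card_connectedComponent (S := S) fun e he => ((hSm e).1 he).1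
  rw [Fintype.card_fin] at h
  have h1 : (edgeLengths p T).countP (· ≤ x) = S.card := by
    rw [edgeLengths, Multiset.countP_map]
    rfl
  have h2 : fromEdgeSet (S : Set (Sym2 (Fin n))) = T ⊓ nearGraph p x := by
    ext i j
    simp only [fromEdgeSet_adj, inf_adj, nearGraph, Finset.mem_coe, hSm, mem_edgeSet, edgeLength,
      Sym2.lift_mk]
    tauto
  have h3 : clusters p x = Nat.card (T ⊓ nearGraph p x).ConnectedComponent := by
    refine le_antisymm (ConnectedComponent.card_le_card_of_le inf_le_right) ?_
    exact card_connectedComponent_le_of_map id (fun i j h => hT.reachable_of_dist_le h.2)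
      fun w => ⟨w, Reachable.refl _⟩
  rw [h1, h3, ← h2]
  exact h

theorem card_edgeLengths (hT : T.IsTree) : Multiset.card (edgeLengths p T) + 1 = n := by
  classical
  have h := hT.card_edgeFinset
  rw [Fintype.card_fin] at h
  have h' : T.edgeFinset = T.edgeSet.toFinite.toFinset := by ext e; simp
  rw [edgeLengths, Multiset.card_map, Finset.card_val, ← h', h]

/-- In a nonincreasing list the entries above `x` form an initial segment. -/
theorem getElem_le_iff_countP {l : List ℝ} (hl : l.Pairwise (· ≥ ·)) (x : ℝ) :
    ∀ (i : ℕ) (h : i < l.length), l[i] ≤ x ↔ l.countP (x < ·) ≤ i := by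
  induction l with
  | nil => intro i h; simp at h
  | cons a t ih =>
    intro i h
    rw [List.pairwise_cons] at hl
    have hc : a ≤ x → t.countP (x < ·) = 0 := by
      intro ha
      rw [List.countP_eq_zero]
      intro b hb
      simpa using (hl.1 b hb).trans ha
    rw [List.countP_cons]
    cases i with
    | zero =>
      by_cases ha : a ≤ x
      · simp [ha, hc ha]
      · simp [ha, not_le.1 ha]
    | succ i =>
      have := ih hl.2 i (by simpa using h)
      simp only [List.getElem_cons_succ, this]
      by_cases ha : a ≤ x
      · simp [hc ha, not_lt.2 ha]
      · simp [not_le.1 ha]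

/-- The tree has `n - 1` edges, of which `n - clusters p x` have length at most `x`; so `clusters p
x - 1` are longer, to be compared with the zero-based index `k - 1`. This is the only property of
the tree that the algorithm for the longest edges uses; in particular the value is the same for all
minimum spanning trees. -/
theorem IsMST.kthLongest_le_iff (hT : IsMST p T) {k : ℕ} (h1 : 1 ≤ k) (hk : k < n) (x : ℝ) :
    kthLongest p T k ≤ x ↔ clusters p x ≤ k := by
  have hc := card_edgeLengths (p := p) hT.1
  have hlen : ((edgeLengths p T).sort (· ≥ ·)).length = n - 1 := by
    rw [Multiset.length_sort]; omega
  have hi : k - 1 < ((edgeLengths p T).sort (· ≥ ·)).length := by omega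
  rw [kthLongest, List.getD_eq_getElem _ _ hi,
    getElem_le_iff_countP (Multiset.pairwise_sort _ _) x _ hi]
  have h2 : ((edgeLengths p T).sort (· ≥ ·)).countP (x < ·) = (edgeLengths p T).countP (x < ·) := by
    conv_rhs => rw [← Multiset.sort_eq (edgeLengths p T) (· ≥ ·)]
    rw [Multiset.coe_countP]
  have h3 := hT.countP_add_clusters x
  have h4 := Multiset.card_eq_countP_add_countP (· ≤ x) (edgeLengths p T)
  simp only [not_le] at h4
  rw [h2]
  omega

theorem IsMST.kthShortest_eq (hT : IsMST p T) {k : ℕ} (h1 : 1 ≤ k) (hk : k < n) :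
    kthShortest p T k = kthLongest p T (n - k) := by
  have hc := card_edgeLengths (p := p) hT.1
  have hrev : (edgeLengths p T).sort (· ≥ ·) = ((edgeLengths p T).sort (· ≤ ·)).reverse := by
    refine List.Perm.eq_of_pairwise' (r := (· ≥ ·)) (Multiset.pairwise_sort _ _) ?_ ?_
    · rw [List.pairwise_reverse]
      exact Multiset.pairwise_sort _ _
    · rw [← Multiset.coe_eq_coe, Multiset.sort_eq, Multiset.coe_reverse, Multiset.sort_eq]
  have hlen : ((edgeLengths p T).sort (· ≤ ·)).length = n - 1 := by
    rw [Multiset.length_sort]; omega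
  rw [kthShortest, kthLongest, hrev, List.getD_eq_getElem _ _ (by omega),
    List.getD_eq_getElem _ _ (by rw [List.length_reverse]; omega), List.getElem_reverse]
  congr 1
  omega

theorem exists_isMST (p : Fin n → EuclideanSpace ℝ (Fin d)) (hn : 0 < n) : ∃ T, IsMST p T := by
  have : Nonempty (Fin n) := ⟨⟨0, hn⟩⟩
  obtain ⟨T₀, -, h₀⟩ := (SimpleGraph.connected_top (V := Fin n)).exists_isTree_le
  obtain ⟨T, hT, hmin⟩ := Set.exists_min_image {T : SimpleGraph (Fin n) | T.IsTree}
    (fun T => (edgeLengths p T).sum) (Set.toFinite _) ⟨T₀, h₀⟩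
  exact ⟨T, hT, hmin⟩

/-- The least distance with at most `k` clusters lies between `lo` and `hi`. -/
def Brackets (q : ι → EuclideanSpace ℝ (Fin d)) (k : ℕ) (lo hi : ℝ) : Prop :=
  (∀ x, clusters q x ≤ k → lo ≤ x) ∧ clusters q hi ≤ k

theorem IsMST.brackets (hT : IsMST p T) {k : ℕ} (h1 : 1 ≤ k) (hk : k < n) :
    Brackets p k (kthLongest p T k) (kthLongest p T k) :=
  ⟨fun x hx => (hT.kthLongest_le_iff h1 hk x).2 hx, (hT.kthLongest_le_iff h1 hk _).1 le_rfl⟩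

end EuclideanMST

namespace EuclideanMST

open SimpleGraph

variable {ι κ : Type*} {d : ℕ}

/-! ### Snapping to a grid -/

/-- The cruder bound `d` in place of `√d` keeps the constants in the programs rational. -/
theorem norm_le_of_abs_le_one {v : EuclideanSpace ℝ (Fin d)} (h : ∀ j, |v j| ≤ 1) : ‖v‖ ≤ d := by
  rw [EuclideanSpace.norm_eq, Real.sqrt_le_left (Nat.cast_nonneg d)]
  calc ∑ j, ‖v j‖ ^ 2 ≤ ∑ _j : Fin d, (1 : ℝ) :=
        Finset.sum_le_sum fun j _ => by
          rw [Real.norm_eq_abs]; exact pow_le_one₀ (abs_nonneg _) (h j)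
    _ = d := by simp
    _ ≤ (d : ℝ) ^ 2 := by exact_mod_cast Nat.le_self_pow (by norm_num) d

/-- The points `q`, rounded to a grid of mesh `δ`, become the points `z` (in units of the mesh). -/
structure Snapped (q : ι → EuclideanSpace ℝ (Fin d)) (z : κ → EuclideanSpace ℝ (Fin d))
    (f : ι → κ) (δ : ℝ) : Prop where
  pos : 0 < δ
  surj : Function.Surjective f
  -- Only differences are compared, so a common shift of the grid cancels; two roundings down change
  -- a difference by less than `1`.
  close : ∀ i i' j, |(q i j - q i' j) / δ - (z (f i) j - z (f i') j)| ≤ 1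

namespace Snapped

variable {q : ι → EuclideanSpace ℝ (Fin d)} {z : κ → EuclideanSpace ℝ (Fin d)} {f : ι → κ} {δ : ℝ}

theorem norm_sub_le (h : Snapped q z f δ) (i i' : ι) :
    ‖δ⁻¹ • (q i - q i') - (z (f i) - z (f i'))‖ ≤ d := by
  refine norm_le_of_abs_le_one fun j => ?_
  have := h.close i i' j
  simpa [div_eq_inv_mul] using this

theorem dist_le (h : Snapped q z f δ) (i i' : ι) :
    dist (z (f i)) (z (f i')) ≤ dist (q i) (q i') / δ + d := by
  have h1 := h.norm_sub_le i i'
  have h2 := norm_sub_norm_le (z (f i) - z (f i')) (δ⁻¹ • (q i - q i'))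
  rw [norm_sub_rev (z (f i) - z (f i')), norm_smul, norm_inv, Real.norm_of_nonneg h.pos.le] at h2
  rw [dist_eq_norm, dist_eq_norm, div_eq_inv_mul]
  linarith

theorem dist_le' (h : Snapped q z f δ) (i i' : ι) :
    dist (q i) (q i') ≤ δ * (dist (z (f i)) (z (f i')) + d) := by
  have h1 := h.norm_sub_le i i'
  have h2 := norm_sub_norm_le (δ⁻¹ • (q i - q i')) (z (f i) - z (f i'))
  rw [norm_smul, norm_inv, Real.norm_of_nonneg h.pos.le] at h2
  rw [dist_eq_norm, dist_eq_norm, ← div_le_iff₀' h.pos, div_eq_inv_mul]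
  linarith

theorem clusters_le [Finite ι] (h : Snapped q z f δ) {x y : ℝ} (hxy : x / δ + d ≤ y) :
    clusters z y ≤ clusters q x := by
  refine card_connectedComponent_le_of_map f (fun i i' hi => nearGraph_reachable z ?_)
    fun w => ?_
  · refine (h.dist_le i i').trans (le_trans ?_ hxy)
    have := hi.2
    have := h.pos
    gcongr
  · obtain ⟨i, rfl⟩ := h.surj w
    exact ⟨i, Reachable.refl _⟩

/-- A right inverse of `f` carries near cells to near points. Points in one cell are at distance at
most `δ d`, and `0 ≤ y` makes this at most `x`, so every point is joined to the representative of
its cell. -/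
theorem le_clusters [Finite κ] (h : Snapped q z f δ) {x y : ℝ} (hy : 0 ≤ y)
    (hxy : δ * (y + d) ≤ x) : clusters q x ≤ clusters z y := by
  obtain ⟨g, hg⟩ := h.surj.hasRightInverse
  refine EuclideanMST.clusters_le g (fun u v huv => ?_) fun i => ⟨f i, ?_⟩
  · refine (h.dist_le' _ _).trans (le_trans ?_ hxy)
    rw [hg, hg]
    have := h.pos
    gcongr
  · refine (h.dist_le' _ _).trans (le_trans ?_ hxy)
    rw [hg, _root_.dist_self]
    have := h.pos
    gcongr

theorem brackets [Finite ι] [Finite κ] (h : Snapped q z f δ) {k : ℕ} {lo hi : ℝ}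
    (hq : Brackets q k lo hi) (hk : k < Nat.card κ) :
    Brackets z k (lo / δ - d) (hi / δ + d) := by
  refine ⟨fun y hy => ?_, (h.clusters_le le_rfl).trans hq.2⟩
  -- At a negative distance every cell is a cluster of its own, which `k < Nat.card κ` rules out.
  rcases lt_or_ge y 0 with h0 | h0
  · rw [clusters_of_lt fun i j _ => h0.trans_le dist_nonneg] at hy
    omega
  · have := hq.1 _ ((h.le_clusters h0 le_rfl).trans hy)
    rw [sub_le_iff_le_add, div_le_iff₀' h.pos]
    exact this

end Snapped

/-! ### Removing isolated points -/

/-- Every discarded point is a singleton component at distances up to `y`, and the other components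
are those of the kept points. So the number of clusters drops by exactly the number of discarded
points. -/
theorem clusters_comp [Finite ι] {q : ι → EuclideanSpace ℝ (Fin d)} {f : κ → ι}
    (hf : Function.Injective f) {y : ℝ}
    (h : ∀ i ∉ Set.range f, ∀ i', i' ≠ i → y < dist (q i) (q i')) {x : ℝ} (hx : x ≤ y) :
    clusters q x + Nat.card κ = clusters (q ∘ f) x + Nat.card ι := by
  have : Finite κ := Finite.of_injective f hf
  have hadj : ∀ a c, (nearGraph q x).Adj a c → a ∈ Set.range f := by
    intro a c hac
    by_contra ha
    exact absurd (hac.2.trans hx) (not_le.2 (h a ha c hac.1.symm))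
  have hr : ∀ a b, (nearGraph q x).Reachable a b →
      a = b ∨ ∃ a' b', f a' = a ∧ f b' = b ∧ (nearGraph (q ∘ f) x).Reachable a' b' := by
    rintro a b ⟨p⟩
    induction p with
    | nil => exact .inl rfl
    | @cons a c b hac _ ih =>
      right
      obtain ⟨a', rfl⟩ := hadj a c hac
      obtain ⟨c', rfl⟩ := hadj c _ hac.symm
      have hac' : (nearGraph (q ∘ f) x).Reachable a' c' := nearGraph_reachable _ hac.2
      rcases ih with rfl | ⟨c'', b', hc, rfl, hcb⟩
      · exact ⟨a', c', rfl, rfl, hac'⟩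
      · obtain rfl := hf hc
        exact ⟨a', b', rfl, rfl, hac'.trans hcb⟩
  have hr' : ∀ a' b', (nearGraph (q ∘ f) x).Reachable a' b' →
      (nearGraph q x).Reachable (f a') (f b') := by
    rintro a b ⟨p⟩
    induction p with
    | nil => exact Reachable.refl _
    | cons hac _ ih => exact (nearGraph_reachable q hac.2).trans ih
  let Φ : (nearGraph (q ∘ f) x).ConnectedComponent ⊕ ↥(Set.range f)ᶜ →
      (nearGraph q x).ConnectedComponent :=
    Sum.elim (fun c => c.lift (fun v => (nearGraph q x).connectedComponentMk (f v))
      fun u v p _ => ConnectedComponent.sound (hr' u v ⟨p⟩))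
      (fun i => (nearGraph q x).connectedComponentMk i)
  have hΦ : Function.Bijective Φ := by
    constructor
    · rintro (c | ⟨i, hi⟩) (c' | ⟨i', hi'⟩) hcc
      · induction c using ConnectedComponent.ind with
        | h a =>
        induction c' using ConnectedComponent.ind with
        | h b =>
          rcases hr _ _ (ConnectedComponent.exact hcc) with hab | ⟨a', b', ha, hb, hab⟩
          · rw [hf hab]
          · rw [hf ha, hf hb] at hab
            exact congrArg Sum.inl (ConnectedComponent.sound hab)
      · induction c using ConnectedComponent.ind with
        | h a =>
          rcases hr _ _ (ConnectedComponent.exact hcc) with hab | ⟨a', b', ha, hb, hab⟩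
          · exact (hi' ⟨a, hab⟩).elim
          · exact (hi' ⟨b', hb⟩).elim
      · induction c' using ConnectedComponent.ind with
        | h a =>
          rcases hr _ _ (ConnectedComponent.exact hcc) with hab | ⟨a', b', ha, hb, hab⟩
          · exact (hi ⟨a, hab.symm⟩).elim
          · exact (hi ⟨a', ha⟩).elim
      · rcases hr _ _ (ConnectedComponent.exact hcc) with hab | ⟨a', b', ha, hb, hab⟩
        · congr 1
          exact Subtype.ext hab
        · exact (hi ⟨a', ha⟩).elim
    · intro c
      induction c using ConnectedComponent.ind with
      | h a =>
        by_cases ha : a ∈ Set.range f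
        · obtain ⟨a', rfl⟩ := ha
          exact ⟨.inl ((nearGraph (q ∘ f) x).connectedComponentMk a'), rfl⟩
        · exact ⟨.inr ⟨a, ha⟩, rfl⟩
  classical
  have h1 := Nat.card_eq_of_bijective Φ hΦ
  rw [Nat.card_sum] at h1
  have h2 := Nat.card_congr (Equiv.Set.sumCompl (Set.range f))
  rw [Nat.card_sum, Nat.card_range_of_injective hf] at h2
  simp only [clusters]
  omega

/-- Since `clusters q y ≤ k`, the threshold is at most `y`. Up to `y` the two cluster counts differ
by the constant `k - k'`, so lowering `k` accordingly leaves the threshold in place. -/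
theorem Brackets.comp [Finite ι] {q : ι → EuclideanSpace ℝ (Fin d)} {f : κ → ι}
    (hf : Function.Injective f) {y : ℝ}
    (h : ∀ i ∉ Set.range f, ∀ i', i' ≠ i → y < dist (q i) (q i')) {k k' : ℕ}
    (hk : k + Nat.card κ = k' + Nat.card ι) (hy : clusters q y ≤ k) {lo hi : ℝ}
    (hq : Brackets q k lo hi) : Brackets (q ∘ f) k' lo hi := by
  have : Finite κ := Finite.of_injective f hf
  constructor
  · intro x hx
    rcases le_total x y with hxy | hxy
    · have := clusters_comp hf h hxy
      exact hq.1 x (by omega)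
    · exact (hq.1 y hy).trans hxy
  · rcases le_total hi y with hxy | hxy
    · have := clusters_comp hf h hxy
      have := hq.2
      omega
    · have h1 := clusters_comp hf h le_rfl
      have h2 := clusters_antitone (q ∘ f) hxy
      omega

/-! ### Progress of a random iteration -/

/-- `r` is the distance of the `i`-th point to its nearest neighbour. -/
def IsNearest (q : ι → EuclideanSpace ℝ (Fin d)) (i : ι) (r : ℝ) : Prop :=
  (∃ j, j ≠ i ∧ dist (q i) (q j) = r) ∧ ∀ j, j ≠ i → r ≤ dist (q i) (q j)

theorem IsNearest.unique {q : ι → EuclideanSpace ℝ (Fin d)} {i : ι} {r r' : ℝ}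
    (h : IsNearest q i r) (h' : IsNearest q i r') : r = r' := by
  obtain ⟨⟨j, hj, rfl⟩, h1⟩ := h
  obtain ⟨⟨j', hj', rfl⟩, h1'⟩ := h'
  exact le_antisymm (h1 _ hj') (h1' _ hj)

theorem exists_isNearest [Finite ι] [Nontrivial ι] (q : ι → EuclideanSpace ℝ (Fin d)) (i : ι) :
    ∃ r, IsNearest q i r := by
  obtain ⟨j, hj, hmin⟩ := Set.exists_min_image {j | j ≠ i} (fun j => dist (q i) (q j))
    (Set.toFinite _) (exists_ne i)
  exact ⟨_, ⟨j, hj, rfl⟩, hmin⟩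

/-- The grid cell of the point `x`. -/
noncomputable def cell (δ τ : ℝ) (x : EuclideanSpace ℝ (Fin d)) : Fin d → ℤ :=
  fun j => ⌊x j / δ + τ⌋

/-- The shift `t / L` separates `X ≤ Y` only if some number `n - t / L` with integral `n` lies in
the interval `(X, Y]`. Its length is at most `1 / L`, so it contains at most one multiple of `1 /
L`, which determines `t` modulo `L`. -/
theorem eq_of_floor_ne {L : ℕ} {X Y : ℝ} (hXY : |X - Y| ≤ 1 / L) {t t' : ℕ} (ht : t < L)
    (ht' : t' < L) (h : ⌊X + t / L⌋ ≠ ⌊Y + t / L⌋) (h' : ⌊X + t' / L⌋ ≠ ⌊Y + t' / L⌋) :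
    t = t' := by
  wlog hlt : X ≤ Y generalizing X Y
  · exact this (by rwa [abs_sub_comm]) h.symm h'.symm (le_of_not_ge hlt)
  have hL : (0 : ℝ) < L := by exact_mod_cast (by omega : 0 < L)
  have key : ∀ s : ℕ, ⌊X + s / L⌋ ≠ ⌊Y + s / L⌋ →
      ∃ n : ℤ, L * X < L * n - s ∧ L * n - s ≤ L * Y := by
    intro s hs
    have hl : ⌊X + s / L⌋ < ⌊Y + s / L⌋ := lt_of_le_of_ne (Int.floor_mono (by linarith)) hs
    refine ⟨⌊Y + s / L⌋, ?_, ?_⟩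
    · have := Int.floor_lt.1 hl
      have h2 : L * (X + s / L) < L * (⌊Y + s / L⌋ : ℝ) := by gcongr
      rw [mul_add, mul_div_cancel₀ _ hL.ne'] at h2
      linarith
    · have h2 : L * (⌊Y + s / L⌋ : ℝ) ≤ L * (Y + s / L) := by gcongr; exact Int.floor_le _
      rw [mul_add, mul_div_cancel₀ _ hL.ne'] at h2
      linarith
  obtain ⟨n, h1, h2⟩ := key t h
  obtain ⟨n', h1', h2'⟩ := key t' h'
  have h3 : L * Y - L * X ≤ 1 := by
    rw [abs_sub_comm, abs_of_nonneg (by linarith), le_div_iff₀ hL] at hXY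
    linarith
  have e1 : ((L * n - t : ℤ) : ℝ) < ((L * n' - t' + 1 : ℤ) : ℝ) := by push_cast; linarith
  have e2 : ((L * n' - t' : ℤ) : ℝ) < ((L * n - t + 1 : ℤ) : ℝ) := by push_cast; linarith
  rw [Int.cast_lt] at e1 e2
  have e3 : (t : ℤ) - t' = L * (n - n') := by
    have : (L : ℤ) * (n - n') = L * n - L * n' := by ring
    omega
  have e4 : |(t : ℤ) - t'| < L := by rw [abs_lt]; omega
  have e5 := Int.eq_zero_of_abs_lt_dvd ⟨_, e3⟩ e4
  omega

open Classical in
/-- The points that share their grid cell with another point. -/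
noncomputable def shared [Fintype ι] {β : Type*} (c : ι → β) : Finset ι :=
  Finset.univ.filter fun i => ∃ i', i' ≠ i ∧ c i' = c i

/-- Count every point once and every unshared point once more. Each fibre then has weight at least
`2`: it contains two points or an unshared one. So identifying points by `f` loses at least half the
number of shared points. -/
theorem two_mul_card_add_card_shared_le [Fintype ι] [Fintype κ] {f : ι → κ}
    (hf : Function.Surjective f) :
    2 * Fintype.card κ + (shared f).card ≤ 2 * Fintype.card ι := by
  classical
  have h1 : (Finset.univ : Finset ι).card =
      ∑ c : κ, (Finset.univ.filter fun i => f i = c).card :=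
    Finset.card_eq_sum_card_fiberwise fun _ _ => Finset.mem_coe.2 (Finset.mem_univ _)
  have h2 : (shared f)ᶜ.card = ∑ c : κ, ((shared f)ᶜ.filter fun i => f i = c).card :=
    Finset.card_eq_sum_card_fiberwise fun _ _ => Finset.mem_coe.2 (Finset.mem_univ _)
  have h3 : ∀ c : κ, 2 ≤ (Finset.univ.filter fun i => f i = c).card +
      ((shared f)ᶜ.filter fun i => f i = c).card := by
    intro c
    obtain ⟨i, rfl⟩ := hf c
    by_cases hi : i ∈ shared f
    · obtain ⟨i', hne, hi'⟩ := (Finset.mem_filter.1 hi).2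
      have : 1 < (Finset.univ.filter fun j => f j = f i).card :=
        Finset.one_lt_card.2 ⟨i, by simp, i', by simp [hi'], hne.symm⟩
      omega
    · have h4 : 0 < (Finset.univ.filter fun j => f j = f i).card :=
        Finset.card_pos.2 ⟨i, by simp⟩
      have h5 : 0 < ((shared f)ᶜ.filter fun j => f j = f i).card :=
        Finset.card_pos.2 ⟨i, by simp [hi]⟩
      omega
  have h6 : ∑ _c : κ, 2 ≤ ∑ c : κ, ((Finset.univ.filter fun i => f i = c).card +
      ((shared f)ᶜ.filter fun i => f i = c).card) := Finset.sum_le_sum fun c _ => h3 c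
  rw [Finset.sum_add_distrib, ← h1, ← h2, Finset.card_compl, Finset.sum_const, Finset.card_univ,
    Finset.card_univ, smul_eq_mul] at h6
  have := Finset.card_le_univ (shared f)
  omega

-- Among the elements of rank below `B`, take one that has all the others below it: its rank is at
-- least the number of these elements. Used for the order by nearest-neighbour distance and for its
-- reverse.
open Classical in
theorem card_filter_card_lt_le [Fintype ι] (rel : ι → ι → Prop)
    (htot : ∀ S : Finset ι, S.Nonempty → ∃ i ∈ S, ∀ j ∈ S, rel j i) {B : ℝ} (hB : 0 ≤ B) :
    ((Finset.univ.filter fun i => ((Finset.univ.filter fun j => rel j i).card : ℝ) < B).card : ℝ)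
      ≤ B := by
  rcases Finset.eq_empty_or_nonempty
    (Finset.univ.filter fun i => ((Finset.univ.filter fun j => rel j i).card : ℝ) < B) with h | h
  · simpa [h] using hB
  · obtain ⟨i, hi, hmax⟩ := htot _ h
    refine le_trans ?_ (Finset.mem_filter.1 hi).2.le
    exact_mod_cast Finset.card_le_card fun j hj => by simpa using hmax j hj

-- In every coordinate, a point `j` with `r j ≤ r i` and its nearest neighbour differ by at most `1
-- / (2 * d)` of the mesh. Each of the `d` coordinates separates them for at most one of the `2 * d`
-- shifts, hence at least `d` shifts leave them in a common cell. Then the pairs of a point and a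
-- shift are counted in two ways.
open Classical in
theorem le_sum_card_shared [Fintype ι] (hd : 0 < d) {q : ι → EuclideanSpace ℝ (Fin d)} {r : ι → ℝ}
    (hr : ∀ i, IsNearest q i (r i)) {i : ι} (hi : 0 < r i) :
    d * (Finset.univ.filter fun j => r j ≤ r i).card ≤
      ∑ t ∈ Finset.range (2 * d),
        (shared fun j => cell (2 * d * r i) (t / (2 * d)) (q j)).card := by
  have key : ∀ j, r j ≤ r i → d ≤ ((Finset.range (2 * d)).filter fun t : ℕ =>
      j ∈ shared fun j => cell (2 * d * r i) (t / (2 * d)) (q j)).card := by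
    intro j hj
    obtain ⟨⟨j', hne, hdist⟩, -⟩ := hr j
    set bad : Fin d → Finset ℕ := fun c => (Finset.range (2 * d)).filter fun t : ℕ =>
      cell (2 * d * r i) (t / (2 * d)) (q j) c ≠ cell (2 * d * r i) (t / (2 * d)) (q j') c with hbad
    have hbad1 : ∀ c, (bad c).card ≤ 1 := by
      intro c
      refine Finset.card_le_one.2 fun t ht t' ht' => ?_
      have ht := Finset.mem_filter.1 ht
      have ht' := Finset.mem_filter.1 ht'
      simp only [Finset.mem_range, cell] at ht ht'
      refine eq_of_floor_ne (L := 2 * d) (X := q j c / (2 * d * r i))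
        (Y := q j' c / (2 * d * r i)) ?_ ht.1 ht'.1 (by simpa using ht.2) (by simpa using ht'.2)
      have h1 : |q j c - q j' c| ≤ r i := by
        have := PiLp.norm_apply_le (q j - q j') c
        rw [← dist_eq_norm, hdist, Real.norm_eq_abs] at this
        exact this.trans hj
      have hd' : (0 : ℝ) < d := by exact_mod_cast hd
      rw [← sub_div, abs_div, abs_of_pos (by positivity : (0 : ℝ) < 2 * d * r i)]
      rw [div_le_div_iff₀ (by positivity) (by positivity)]
      push_cast
      nlinarith
    have hsub : Finset.range (2 * d) ⊆ ((Finset.range (2 * d)).filter fun t : ℕ =>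
        j ∈ shared fun j => cell (2 * d * r i) (t / (2 * d)) (q j)) ∪
          Finset.univ.biUnion bad := by
      intro t ht
      rw [Finset.mem_union]
      by_cases hb : t ∈ Finset.univ.biUnion bad
      · exact .inr hb
      · left
        simp only [Finset.mem_biUnion, Finset.mem_univ, true_and, not_exists, hbad,
          Finset.mem_filter, not_and, not_not] at hb
        simp only [Finset.mem_filter, shared, Finset.mem_univ, true_and]
        exact ⟨ht, j', hne, funext fun c => (hb c ht).symm⟩
    have h1 := Finset.card_le_card hsub
    have h2 := Finset.card_union_le ((Finset.range (2 * d)).filter fun t : ℕ =>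
        j ∈ shared fun j => cell (2 * d * r i) (t / (2 * d)) (q j)) (Finset.univ.biUnion bad)
    have h3 : (Finset.univ.biUnion bad).card ≤ d := by
      refine Finset.card_biUnion_le.trans ?_
      refine (Finset.sum_le_sum fun c _ => hbad1 c).trans ?_
      simp
    rw [Finset.card_range] at h1
    omega
  have hswap : ∑ t ∈ Finset.range (2 * d),
        (shared fun j => cell (2 * d * r i) (t / (2 * d)) (q j)).card =
      ∑ j : ι, ((Finset.range (2 * d)).filter fun t : ℕ =>
        j ∈ shared fun j => cell (2 * d * r i) (t / (2 * d)) (q j)).card := by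
    have := Finset.sum_card_bipartiteAbove_eq_sum_card_bipartiteBelow
      (s := Finset.range (2 * d)) (t := (Finset.univ : Finset ι))
      (fun t j => j ∈ shared fun j => cell (2 * d * r i) ((t : ℕ) / (2 * d)) (q j))
    simpa [Finset.bipartiteAbove, Finset.bipartiteBelow] using this
  rw [hswap, mul_comm, ← smul_eq_mul, ← Finset.sum_const]
  refine (Finset.sum_le_sum fun j hj => key j (Finset.mem_filter.1 hj).2).trans ?_
  exact Finset.sum_le_sum_of_subset (Finset.filter_subset _ _)

open Classical in
/-- On average over the point `i` and the shift `t`, a constant fraction of the points disappears. -/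
theorem le_sum_min_card [Fintype ι] (hd : 0 < d) {q : ι → EuclideanSpace ℝ (Fin d)} {r : ι → ℝ}
    (hr : ∀ i, IsNearest q i (r i)) (hpos : ∀ i, 0 < r i) :
    (Fintype.card ι : ℝ) * (2 * d) * (Fintype.card ι / 64) ≤
      ∑ i : ι, ∑ t ∈ Finset.range (2 * d),
        min ((Finset.univ.filter fun j => r i ≤ r j).card : ℝ)
          ((shared fun j => cell (2 * d * r i) (t / (2 * d)) (q j)).card / 2) := by
  set m : ℝ := (Fintype.card ι : ℝ) with hm
  have hm0 : 0 ≤ m := Nat.cast_nonneg _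
  have hA := card_filter_card_lt_le (fun j i => r j ≤ r i)
    (fun S hS => by
      obtain ⟨i, hi, h⟩ := S.exists_max_image r hS
      exact ⟨i, hi, h⟩) (B := m / 4) (by positivity)
  have hB := card_filter_card_lt_le (fun j i => r i ≤ r j)
    (fun S hS => by
      obtain ⟨i, hi, h⟩ := S.exists_min_image r hS
      exact ⟨i, hi, h⟩) (B := m / 4) (by positivity)
  set A := Finset.univ.filter fun i => ((Finset.univ.filter fun j => r j ≤ r i).card : ℝ) < m / 4
  set B := Finset.univ.filter fun i => ((Finset.univ.filter fun j => r i ≤ r j).card : ℝ) < m / 4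
  -- `A` and `B` hold the points with fewer than `m / 4` points at or below them, respectively at or
  -- above them. Each has at most `m / 4` elements.
  have hgood : m / 2 ≤ ((A ∪ B)ᶜ.card : ℝ) := by
    have h1 := Finset.card_union_le A B
    have h2 := Finset.card_add_card_compl (A ∪ B)
    have h1' : ((A ∪ B).card : ℝ) ≤ A.card + B.card := by exact_mod_cast h1
    have h2' : ((A ∪ B).card : ℝ) + ((A ∪ B)ᶜ.card : ℝ) = m := by
      rw [hm]; exact_mod_cast h2
    linarith
  have hterm : ∀ i ∈ (A ∪ B)ᶜ, d * m / 16 ≤ ∑ t ∈ Finset.range (2 * d),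
        min ((Finset.univ.filter fun j => r i ≤ r j).card : ℝ)
          ((shared fun j => cell (2 * d * r i) (t / (2 * d)) (q j)).card / 2) := by
    intro i hi
    simp only [Finset.mem_compl, Finset.mem_union, not_or, A, B, Finset.mem_filter,
      Finset.mem_univ, true_and, not_lt] at hi
    have h1 : ∑ t ∈ Finset.range (2 * d),
        ((shared fun j => cell (2 * d * r i) (t / (2 * d)) (q j)).card : ℝ) / 4 ≤
        ∑ t ∈ Finset.range (2 * d),
        min ((Finset.univ.filter fun j => r i ≤ r j).card : ℝ)
          ((shared fun j => cell (2 * d * r i) (t / (2 * d)) (q j)).card / 2) := by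
      -- Both terms of the minimum are at least a quarter of the number of shared points, the first
      -- because it is at least `m / 4`. Over all shifts this gives `d * (m / 4) / 4`.
      refine Finset.sum_le_sum fun t _ => le_min ?_ ?_
      · have : ((shared fun j => cell (2 * d * r i) (t / (2 * d)) (q j)).card : ℝ) ≤ m :=
          Nat.cast_le.2 (Finset.card_le_univ _)
        linarith [hi.2]
      · have : (0 : ℝ) ≤ ((shared fun j => cell (2 * d * r i) (t / (2 * d)) (q j)).card : ℝ) :=
          Nat.cast_nonneg _
        linarith
    refine le_trans ?_ h1
    rw [← Finset.sum_div]
    have h2 : (d : ℝ) * (Finset.univ.filter fun j => r j ≤ r i).card ≤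
      ∑ t ∈ Finset.range (2 * d),
        ((shared fun j => cell (2 * d * r i) (t / (2 * d)) (q j)).card : ℝ) := by
      exact_mod_cast le_sum_card_shared hd hr (hpos i)
    have h3 : (d : ℝ) * (m / 4) ≤ d * (Finset.univ.filter fun j => r j ≤ r i).card := by
      gcongr
      exact hi.1
    linarith
  refine le_trans ?_ (Finset.sum_le_sum_of_subset_of_nonneg (Finset.subset_univ (A ∪ B)ᶜ)
    fun i _ _ => Finset.sum_nonneg fun t _ => le_min (by positivity) (by positivity))
  refine le_trans ?_ (Finset.sum_le_sum hterm)
  rw [Finset.sum_const, nsmul_eq_mul]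
  have : m / 2 * (d * m / 16) ≤ ((A ∪ B)ᶜ.card : ℝ) * (d * m / 16) := by gcongr
  linarith

end EuclideanMST

namespace RealRAM

open EuclideanMST

/-! ### Registers and addresses -/

/-- Registers for the coordinates of a point. -/
def X (j : ℕ) : ℕ := 100 + 2 * j

/-- Registers for the coordinates of an offset. -/
def Y (j : ℕ) : ℕ := 101 + 2 * j

-- Numbered registers stay below `100`, clear of the coordinates. `0`–`2`: `n`, `k`, `ε`; `3`–`6`:
-- current generation, its size, its number of clusters, its scale; `7`: next free stamp; `8`:
-- whether `L` is located; `9`, `10`: bounds for `L`; `11`–`14`: mesh, shift, search radius, flag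
-- radius; `15`, `16`: numbers of cells and of clusters found; `22`, `23`: tail and head of the
-- queue; `31`–`33`: random point, random shift, nearest distance. Arrays: `0` input, `1` points by
-- generation, `2` hash table of cells, `3` cell of each point, `4` flags, `5` visited marks, `6`
-- queue.
@[simp] theorem X_inj {i j : ℕ} : X i = X j ↔ i = j := by simp [X]
@[simp] theorem X_eq_Y {i j : ℕ} : X i = Y j ↔ False := by simp only [X, Y, iff_false]; omega
@[simp] theorem Y_eq_X {i j : ℕ} : Y i = X j ↔ False := by simp only [X, Y, iff_false]; omega
@[simp] theorem X_eq {n j : ℕ} (h : n < 100) : X j = n ↔ False := by simp only [X, iff_false]; omega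
@[simp] theorem Y_eq {n j : ℕ} (h : n < 100) : Y j = n ↔ False := by simp only [Y, iff_false]; omega
@[simp] theorem eq_X {n j : ℕ} (h : n < 100) : n = X j ↔ False := by simp only [X, iff_false]; omega
@[simp] theorem eq_Y {n j : ℕ} (h : n < 100) : n = Y j ↔ False := by simp only [Y, iff_false]; omega

/-- The registers `X 0, …, X (d - 1)`. -/
def Xs (d : ℕ) : List ℕ := List.ofFn fun j : Fin d => X j

/-- The address of the cell `c` in the hash table with stamp `S`. -/
def cellKey {d : ℕ} (S : ℕ) (c : Fin d → ℤ) : List ℤ := (S : ℤ) :: List.ofFn c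

@[simp] theorem cellKey_inj {d S : ℕ} {c c' : Fin d → ℤ} :
    cellKey S c = cellKey S c' ↔ c = c' := by
  simp [cellKey, List.ofFn_injective.eq_iff]

theorem key_Xs {d : ℕ} {s : State} {x S : ℕ} {c : Fin d → ℤ} (hS : s.reg x = S)
    (hc : ∀ j : Fin d, s.reg (X j) = c j) : s.key (x :: Xs d) = cellKey S c := by
  simp only [State.key, Xs, List.map_cons, hS, Int.floor_natCast, List.map_ofFn, cellKey]
  congr 2
  funext j
  simp [hc]

@[simp] theorem key_cons (s : State) (x : ℕ) (js : List ℕ) :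
    s.key (x :: js) = ⌊s.reg x⌋ :: s.key js := rfl

@[simp] theorem key_nil (s : State) : s.key [] = [] := rfl

/-- The `i`-th point of generation `g`. -/
noncomputable def pt (d : ℕ) (s : State) (g i : ℕ) : EuclideanSpace ℝ (Fin d) :=
  WithLp.toLp 2 fun j => s.mem 1 [(g : ℤ), (i : ℤ), ((j : ℕ) : ℤ)]

/-- Nothing has been written with stamps `S, S + 1, …`. -/
def Fresh (s : State) (S : ℕ) : Prop :=
  ∀ a : ℕ, 1 ≤ a → ∀ g : ℕ, S ≤ g → ∀ key : List ℤ, s.mem a ((g : ℤ) :: key) = 0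

/-- The memories differ at stamp `S` only. -/
def AgreeOff (S : ℕ) (s s' : State) : Prop :=
  ∀ (a g : ℕ) (key : List ℤ), g ≠ S → s'.mem a ((g : ℤ) :: key) = s.mem a ((g : ℤ) :: key)

theorem AgreeOff.pt_eq {d S : ℕ} {s s' : State} (h : AgreeOff S s s') {g i : ℕ} (hg : g ≠ S) :
    pt d s' g i = pt d s g i := by
  simp only [pt, h _ _ _ hg]

/-- Every address outside the input array starts with a stamp. Each pass takes a new stamp, so its
tables are initially zero and no time is spent on clearing old ones. -/
theorem AgreeOff.fresh {S : ℕ} {s s' : State} (h : AgreeOff S s s') (hs : Fresh s S) :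
    Fresh s' (S + 1) := by
  intro a ha g hg key
  rw [h _ _ _ (by omega)]
  exact hs a ha g (by omega) key

/-! ### Rounding to a grid -/

abbrev lit (q : ℚ) : Expr := .const q

/-- Load the `i`-th point of generation `G` and compute its cell. -/
def cellCode (d : ℕ) : Program :=
  unroll d fun j => block [.assign 29 (lit j), .load (X j) 1 [3, 17, 29],
    .assign (X j) (.floor (.add (.div (.reg (X j)) (.reg 11)) (.reg 12)))]

/-- Store the registers `X` as the point `reg y` of generation `reg x`. -/
def storeCode (d x y : ℕ) : Program :=
  unroll d fun j => block [.assign 29 (lit j), .store 1 [x, y, 29] (X j)]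

theorem flat_cellCode (d : ℕ) : (cellCode d).Flat :=
  flat_unroll fun j => by simp [flat_block, Program.Flat]

theorem flat_storeCode (d x y : ℕ) : (storeCode d x y).Flat :=
  flat_unroll fun j => by simp [flat_block, Program.Flat]

theorem sem_cellCode {d : ℕ} {s : State} {G i : ℕ} {δ τ : ℝ} (h3 : s.reg 3 = G) (h17 : s.reg 17 = i)
    (h11 : s.reg 11 = δ) (h12 : s.reg 12 = τ) :
    (∀ j : Fin d, ((cellCode d).sem s).reg (X j) = cell δ τ (pt d s G i) j) ∧
    ((cellCode d).sem s).mem = s.mem ∧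
    (∀ x < 100, x ≠ 29 → ((cellCode d).sem s).reg x = s.reg x) := by
  -- The code is unrolled over the coordinates; the induction is on the number of coordinates
  -- already treated.
  suffices H : ∀ n, (∀ j < n, ((cellCode n).sem s).reg (X j) =
      (⌊s.mem 1 [(G : ℤ), (i : ℤ), (j : ℤ)] / δ + τ⌋ : ℤ)) ∧
      ((cellCode n).sem s).mem = s.mem ∧
      (∀ x < 100, x ≠ 29 → ((cellCode n).sem s).reg x = s.reg x) by
    exact ⟨fun j => (H d).1 j j.2, (H d).2⟩
  intro n
  induction n with
  | zero => simp [cellCode, sem_unroll_zero]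
  | succ n ih =>
    obtain ⟨ih1, ih2, ih3⟩ := ih
    change _ = _ at ih2
    simp only [cellCode, sem_unroll_succ] at *
    set s1 := Program.sem (unroll n _) s
    have e3 := ih3 3 (by norm_num) (by norm_num)
    have e17 := ih3 17 (by norm_num) (by norm_num)
    have e11 := ih3 11 (by norm_num) (by norm_num)
    have e12 := ih3 12 (by norm_num) (by norm_num)
    simp only [sem_block_cons, sem_block_nil, Program.sem, Expr.eval]
    refine ⟨?_, ?_, ?_⟩
    · intro j hj
      rcases Nat.lt_succ_iff_lt_or_eq.1 hj with hj | rfl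
      · simp [hj.ne, ih1 j hj]
      · simp [e3, e17, e11, e12, h3, h17, h11, h12, ih2]
    · simp [ih2]
    · intro x hx hx'
      simp [hx, hx', ih3 x hx hx']

theorem sem_storeCode {d : ℕ} {s : State} {x y g i : ℕ} (hx : s.reg x = g) (hy : s.reg y = i)
    (hx29 : x ≠ 29) (hy29 : y ≠ 29) :
    (∀ j : Fin d, ((storeCode d x y).sem s).mem 1 [(g : ℤ), (i : ℤ), ((j : ℕ) : ℤ)] =
      s.reg (X j)) ∧
    (∀ a key, (a = 1 → ∀ j : ℤ, key ≠ [(g : ℤ), (i : ℤ), j]) →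
      ((storeCode d x y).sem s).mem a key = s.mem a key) ∧
    (∀ x', x' ≠ 29 → ((storeCode d x y).sem s).reg x' = s.reg x') := by
  suffices H : ∀ n, (∀ j < n, ((storeCode n x y).sem s).mem 1 [(g : ℤ), (i : ℤ), (j : ℤ)] =
      s.reg (X j)) ∧ (∀ a key, (a = 1 → ∀ j : ℤ, key ≠ [(g : ℤ), (i : ℤ), j]) →
      ((storeCode n x y).sem s).mem a key = s.mem a key) ∧
    (∀ x', x' ≠ 29 → ((storeCode n x y).sem s).reg x' = s.reg x') by
    exact ⟨fun j => (H d).1 j j.2, (H d).2⟩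
  intro n
  induction n with
  | zero => simp [storeCode, sem_unroll_zero]
  | succ n ih =>
    obtain ⟨ih1, ih2, ih3⟩ := ih
    simp only [storeCode, sem_unroll_succ] at *
    set s1 := Program.sem (unroll n _) s
    simp only [sem_block_cons, sem_block_nil, Program.sem, Expr.eval]
    refine ⟨?_, ?_, ?_⟩
    · intro j hj
      rcases Nat.lt_succ_iff_lt_or_eq.1 hj with hj | rfl
      · simp [hj.ne, ih1 j hj, ih3 _ hx29, ih3 _ hy29, hx, hy, hx29, hy29]
      · simp [ih3 _ hx29, ih3 _ hy29, hx, hy, hx29, hy29, ih3 (X j) (by simp)]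
    · intro a key hk
      rw [← ih2 a key hk]
      simp only [State.mem_setMem, State.mem_setReg]
      rw [if_neg]
      rintro ⟨ha, hkey⟩
      refine hk ha n ?_
      rw [hkey]
      simp [ih3 _ hx29, ih3 _ hy29, hx, hy, hx29, hy29]
    · intro x' hx'
      simp [hx', ih3 x' hx']

/-- Insert the `i`-th point into the grid. -/
def snapBody (d : ℕ) : Program :=
  block [cellCode d, .load 18 2 (7 :: Xs d),
    -- The hash table stores the index plus one, so that content `0` means a new cell. In the other
    -- case a second point has entered the cell, and the cell is flagged.
    .ite (.le (.reg 18) (lit 0))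
      (block [.assign 28 (.reg 15), .assign 15 (.add (.reg 15) (lit 1)), .store 2 (7 :: Xs d) 15,
        storeCode d 7 28])
      (block [.assign 28 (.sub (.reg 18) (lit 1)), .assign 30 (lit 1), .store 4 [7, 28] 30]),
    .store 3 [7, 17] 28, .assign 17 (.add (.reg 17) (lit 1))]

/-- Round the points of generation `G` to the grid of mesh `δ`; the distinct cells become the points
of generation `S`. -/
def snap (d : ℕ) : Program :=
  block [.assign 15 (lit 0), .assign 17 (lit 0), .loop (.lt (.reg 17) (.reg 4)) (snapBody d)]

theorem flat_snapBody (d : ℕ) : (snapBody d).Flat := by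
  simp [snapBody, flat_block, Program.Flat, flat_cellCode, flat_storeCode]

theorem sem_snapBody_new {d : ℕ} {s : State} {G S i m₂ : ℕ} {δ τ : ℝ} (h3 : s.reg 3 = G)
    (h7 : s.reg 7 = S) (h17 : s.reg 17 = i) (h15 : s.reg 15 = m₂)
    (h11 : s.reg 11 = δ) (h12 : s.reg 12 = τ)
    (h0 : s.mem 2 (cellKey S (cell δ τ (pt d s G i))) = 0) :
    ((snapBody d).sem s).reg 15 = (m₂ + 1 : ℕ) ∧ ((snapBody d).sem s).reg 17 = (i + 1 : ℕ) ∧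
    (∀ j : Fin d, ((snapBody d).sem s).mem 1 [(S : ℤ), (m₂ : ℤ), ((j : ℕ) : ℤ)] =
      cell δ τ (pt d s G i) j) ∧
    (∀ key, (∀ j : ℤ, key ≠ [(S : ℤ), (m₂ : ℤ), j]) →
      ((snapBody d).sem s).mem 1 key = s.mem 1 key) ∧
    (∀ key, ((snapBody d).sem s).mem 2 key =
      if key = cellKey S (cell δ τ (pt d s G i)) then (m₂ + 1 : ℝ) else s.mem 2 key) ∧
    (∀ key, ((snapBody d).sem s).mem 3 key =
      if key = [(S : ℤ), (i : ℤ)] then (m₂ : ℝ) else s.mem 3 key) ∧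
    (∀ a, a ≠ 1 → a ≠ 2 → a ≠ 3 → ((snapBody d).sem s).mem a = s.mem a) := by
  obtain ⟨c1, c2, c3⟩ := sem_cellCode (d := d) h3 h17 h11 h12
  set s1 := (cellCode d).sem s with hs1
  set c := cell δ τ (pt d s G i) with hc
  have k1 : ∀ s' : State, s'.reg 7 = S → (∀ j : Fin d, s'.reg (X j) = s1.reg (X j)) →
      s'.key (7 :: Xs d) = cellKey S c := fun s' h h' => key_Xs h fun j => by rw [h', c1]
  have e7 : s1.reg 7 = S := by rw [c3 7 (by norm_num) (by norm_num), h7]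
  have e15 : s1.reg 15 = m₂ := by rw [c3 15 (by norm_num) (by norm_num), h15]
  have e17 : s1.reg 17 = i := by rw [c3 17 (by norm_num) (by norm_num), h17]
  set s2 := (s1.setReg 18 0).setReg 28 m₂ |>.setReg 15 ((m₂ : ℝ) + 1)
    |>.setMem 2 (cellKey S c) (m₂ + 1) with hs2
  have hbody : (snapBody d).sem s = (((storeCode d 7 28).sem s2).setMem 3 [(S : ℤ), (i : ℤ)]
      m₂).setReg 17 (i + 1) := by
    simp only [snapBody, sem_block_cons, sem_block_nil, Program.sem, ← hs1]
    rw [k1 s1 e7 fun _ => rfl, c2, h0]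
    have ht : Test.Holds (s1.setReg 18 0) (.le (.reg 18) (lit 0)) := by
      simp [Test.Holds, Expr.eval]
    simp only [ht, if_true, Expr.eval]
    rw [k1 _ (by simp [e7]) (by simp)]
    have e2 : (((s1.setReg 18 0).setReg 28 ((s1.setReg 18 0).reg 15)).setReg 15
        ((((s1.setReg 18 0).setReg 28 ((s1.setReg 18 0).reg 15)).reg 15) + ((1 : ℚ) : ℝ))).setMem 2
        (cellKey S c) ((((s1.setReg 18 0).setReg 28 ((s1.setReg 18 0).reg 15)).setReg 15
        ((((s1.setReg 18 0).setReg 28 ((s1.setReg 18 0).reg 15)).reg 15) + ((1 : ℚ) : ℝ))).reg 15)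
        = s2 := by
      simp [hs2, e15]
    rw [e2]
    obtain ⟨-, -, d3⟩ := sem_storeCode (d := d) (s := s2) (x := 7) (y := 28) (g := S) (i := m₂)
      (by simp [hs2, e7]) (by simp [hs2]) (by norm_num) (by norm_num)
    generalize (storeCode d 7 28).sem s2 = s3 at d3 ⊢
    simp [d3, hs2, e7, e17]
  obtain ⟨d1, d2, d3⟩ := sem_storeCode (d := d) (s := s2) (x := 7) (y := 28) (g := S) (i := m₂)
      (by simp [hs2, e7]) (by simp [hs2]) (by norm_num) (by norm_num)
  rw [hbody]
  clear hbody
  generalize (storeCode d 7 28).sem s2 = s3 at d1 d2 d3 ⊢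
  refine ⟨?_, ?_, ?_, ?_, ?_, ?_, ?_⟩
  · simp [d3, hs2]
  · simp
  · intro j
    simp [d1, hs2, c1]
  · intro key hk
    simp [d2 1 key fun _ => hk, hs2, c2]
  · intro key
    simp [d2 2 key (by simp), hs2, c2]
  · intro key
    simp [d2 3 key (by simp), hs2, c2]
  · intro a h1 h2 h3
    funext key
    simp [d2 a key (fun h => absurd h h1), hs2, c2, h2, h3]

theorem sem_snapBody_old {d : ℕ} {s : State} {G S i u : ℕ} {δ τ : ℝ} (h3 : s.reg 3 = G)
    (h7 : s.reg 7 = S) (h17 : s.reg 17 = i)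
    (h11 : s.reg 11 = δ) (h12 : s.reg 12 = τ)
    (h0 : s.mem 2 (cellKey S (cell δ τ (pt d s G i))) = u + 1) :
    ((snapBody d).sem s).reg 15 = s.reg 15 ∧ ((snapBody d).sem s).reg 17 = (i + 1 : ℕ) ∧
    (∀ key, ((snapBody d).sem s).mem 4 key =
      if key = [(S : ℤ), (u : ℤ)] then (1 : ℝ) else s.mem 4 key) ∧
    (∀ key, ((snapBody d).sem s).mem 3 key =
      if key = [(S : ℤ), (i : ℤ)] then (u : ℝ) else s.mem 3 key) ∧
    (∀ a, a ≠ 3 → a ≠ 4 → ((snapBody d).sem s).mem a = s.mem a) := by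
  obtain ⟨c1, c2, c3⟩ := sem_cellCode (d := d) h3 h17 h11 h12
  set s1 := (cellCode d).sem s with hs1
  set c := cell δ τ (pt d s G i) with hc
  have k1 : s1.key (7 :: Xs d) = cellKey S c := key_Xs
    (by rw [c3 7 (by norm_num) (by norm_num), h7]) c1
  have e7 : s1.reg 7 = S := by rw [c3 7 (by norm_num) (by norm_num), h7]
  have e15 : s1.reg 15 = s.reg 15 := by rw [c3 15 (by norm_num) (by norm_num)]
  have e17 : s1.reg 17 = i := by rw [c3 17 (by norm_num) (by norm_num), h17]
  have hbody : (snapBody d).sem s = (((((s1.setReg 18 (u + 1)).setReg 28 u).setReg 30 1).setMem 4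
      [(S : ℤ), (u : ℤ)] 1).setMem 3 [(S : ℤ), (i : ℤ)] u).setReg 17 (i + 1) := by
    simp only [snapBody, sem_block_cons, sem_block_nil, Program.sem, ← hs1]
    rw [k1, c2, h0]
    have ht : ¬ Test.Holds (s1.setReg 18 (u + 1)) (.le (.reg 18) (lit 0)) := by
      simp only [Test.Holds, Expr.eval, State.reg_setReg, if_true, Rat.cast_zero, not_le]
      positivity
    simp only [ht, if_false, Expr.eval]
    simp [e7, e17]
  rw [hbody]
  refine ⟨?_, ?_, ?_, ?_, ?_⟩
  · simp [e15]
  · simp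
  · intro key
    simp [c2]
  · intro key
    simp [c2]
  · intro a h3 h4
    funext key
    simp [h3, h4, c2]

end RealRAM

/-! ### Invariant and cost of the rounding loop -/

namespace RealRAM

open EuclideanMST

/-- After the insertion of the first `i` points of generation `G`, the grid with stamp `S` has the
cells `z 0, …, z (m₂ - 1)`, and the `l`-th point lies in the cell `z (f l)`. -/
structure Grid {d : ℕ} (s₀ s : State) (G S i m₂ : ℕ) (δ τ : ℝ) (z : ℕ → Fin d → ℤ) (f : ℕ → ℕ) :
    Prop where
  inj : ∀ a < m₂, ∀ b < m₂, z a = z b → a = b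
  lt : ∀ l < i, f l < m₂
  cell_eq : ∀ l < i, z (f l) = cell δ τ (pt d s₀ G l)
  surj : ∀ a < m₂, ∃ l < i, f l = a
  points : ∀ a < m₂, ∀ j : Fin d, s.mem 1 [(S : ℤ), (a : ℤ), ((j : ℕ) : ℤ)] = z a j
  hash : ∀ a < m₂, s.mem 2 (cellKey S (z a)) = a + 1
  hash_zero : ∀ c, (∀ a < m₂, z a ≠ c) → s.mem 2 (cellKey S c) = 0
  id : ∀ l < i, s.mem 3 [(S : ℤ), (l : ℤ)] = f l
  -- So far a flag means that at least two points lie in the cell; the search adds the flags caused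
  -- by neighbouring cells.
  flag : ∀ a < m₂, s.mem 4 [(S : ℤ), (a : ℤ)] ≠ 0 ↔
    ∃ l < i, ∃ l' < i, l ≠ l' ∧ f l = a ∧ f l' = a
  flag_zero : ∀ a, m₂ ≤ a → s.mem 4 [(S : ℤ), (a : ℤ)] = 0
  -- The marks and the queue of this stamp are untouched, so the search starts from empty ones.
  rest : ∀ a, 5 ≤ a → ∀ key, s.mem a ((S : ℤ) :: key) = 0
  agree : AgreeOff S s₀ s

theorem Grid.init {d : ℕ} {s₀ s : State} {G S : ℕ} {δ τ : ℝ} (hs : s.mem = s₀.mem)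
    (hf : Fresh s₀ S) : Grid (d := d) s₀ s G S 0 0 δ τ (fun _ _ => 0) fun _ => 0 where
  inj := by simp
  lt := by simp
  cell_eq := by simp
  surj := by simp
  points := by simp
  hash := by simp
  hash_zero := fun c _ => by rw [hs]; exact hf 2 (by norm_num) S le_rfl _
  id := by simp
  flag := by simp
  flag_zero := fun c _ => by rw [hs]; exact hf 4 (by norm_num) S le_rfl _
  rest := fun a ha c => by rw [hs]; exact hf a (by omega) S le_rfl _
  agree := fun a g key _ => by rw [hs]

theorem Grid.step {d : ℕ} {s₀ s : State} {G S i m₂ : ℕ} {δ τ : ℝ} {z : ℕ → Fin d → ℤ} {f : ℕ → ℕ}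
    (h : Grid s₀ s G S i m₂ δ τ z f) (hGS : G ≠ S) (h3 : s.reg 3 = G)
    (h7 : s.reg 7 = S) (h17 : s.reg 17 = i) (h15 : s.reg 15 = m₂) (h11 : s.reg 11 = δ)
    (h12 : s.reg 12 = τ) :
    ∃ (m₂' : ℕ) (z' : ℕ → Fin d → ℤ) (f' : ℕ → ℕ),
      ((snapBody d).sem s).reg 15 = m₂' ∧ ((snapBody d).sem s).reg 17 = (i + 1 : ℕ) ∧
      Grid s₀ ((snapBody d).sem s) G S (i + 1) m₂' δ τ z' f' := by
  have hpt : pt d s G i = pt d s₀ G i := h.agree.pt_eq hGS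
  set c := cell δ τ (pt d s G i) with hc
  by_cases hex : ∃ u < m₂, z u = c
  · obtain ⟨u, hu, hzu⟩ := hex
    obtain ⟨e15, e17, e4, e3, er⟩ := sem_snapBody_old (d := d) (u := u) h3 h7 h17 h11 h12
      (by rw [← hc, ← hzu]; exact h.hash u hu)
    set s' := (snapBody d).sem s
    have er1 := er 1 (by norm_num) (by norm_num)
    have er2 := er 2 (by norm_num) (by norm_num)
    have hfu : ∀ l < i, Function.update f i u l = f l := fun l hl =>
      Function.update_of_ne hl.ne _ _
    refine ⟨m₂, z, Function.update f i u, by rw [e15, h15], e17, ?_⟩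
    refine ⟨h.inj, ?_, ?_, ?_, ?_, ?_, ?_, ?_, ?_, ?_, ?_, ?_⟩
    · intro l hl
      rcases Nat.lt_succ_iff_lt_or_eq.1 hl with hl | rfl
      · rw [hfu l hl]; exact h.lt l hl
      · simpa using hu
    · intro l hl
      rcases Nat.lt_succ_iff_lt_or_eq.1 hl with hl | rfl
      · rw [hfu l hl]; exact h.cell_eq l hl
      · simp [hzu, hc, hpt]
    · intro a ha
      obtain ⟨l, hl, rfl⟩ := h.surj a ha
      exact ⟨l, by omega, hfu l hl⟩
    · rw [er1]; exact h.points
    · rw [er2]; exact h.hash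
    · rw [er2]; exact h.hash_zero
    · intro l hl
      rw [e3]
      rcases Nat.lt_succ_iff_lt_or_eq.1 hl with hl | rfl
      · rw [hfu l hl, if_neg (by simp [hl.ne])]; exact h.id l hl
      · simp
    · intro a ha
      rw [e4]
      by_cases hau : a = u
      · subst hau
        simp only [if_true, ne_eq, one_ne_zero, not_false_iff, true_iff]
        obtain ⟨l, hl, hfl⟩ := h.surj a ha
        exact ⟨l, by omega, i, by omega, hl.ne, by rw [hfu l hl, hfl], by simp⟩
      · rw [if_neg (by simpa using hau), h.flag a ha]
        constructor
        · rintro ⟨l, hl, l', hl', hne, h1, h2⟩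
          exact ⟨l, by omega, l', by omega, hne, by rw [hfu l hl, h1], by rw [hfu l' hl', h2]⟩
        · rintro ⟨l, hl, l', hl', hne, h1, h2⟩
          have hli : l ≠ i := by rintro rfl; simp at h1; exact hau h1.symm
          have hli' : l' ≠ i := by rintro rfl; simp at h2; exact hau h2.symm
          rw [Function.update_of_ne hli] at h1
          rw [Function.update_of_ne hli'] at h2
          exact ⟨l, by omega, l', by omega, hne, h1, h2⟩
    · intro a ha
      rw [e4, if_neg (by simp; omega)]
      exact h.flag_zero a ha
    · intro a ha key
      rw [er a (by omega) (by omega)]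
      exact h.rest a ha key
    · intro a g key hg
      rw [← h.agree a g key hg]
      by_cases ha3 : a = 3
      · subst ha3; rw [e3, if_neg (by simp [hg])]
      · by_cases ha4 : a = 4
        · subst ha4; rw [e4, if_neg (by simp [hg])]
        · rw [er a ha3 ha4]
  · push Not at hex
    obtain ⟨e15, e17, e1, e1', e2, e3, er⟩ := sem_snapBody_new (d := d) h3 h7 h17 h15 h11 h12
      (by rw [← hc]; exact h.hash_zero c hex)
    set s' := (snapBody d).sem s
    rw [← hc] at e1 e2
    have er4 := er 4 (by norm_num) (by norm_num) (by norm_num)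
    have hfu : ∀ l < i, Function.update f i m₂ l = f l := fun l hl =>
      Function.update_of_ne hl.ne _ _
    have hzu : ∀ l < m₂, Function.update z m₂ c l = z l := fun l hl =>
      Function.update_of_ne hl.ne _ _
    refine ⟨m₂ + 1, Function.update z m₂ c, Function.update f i m₂, e15, e17, ?_⟩
    refine ⟨?_, ?_, ?_, ?_, ?_, ?_, ?_, ?_, ?_, ?_, ?_, ?_⟩
    · intro a ha b hb
      rcases Nat.lt_succ_iff_lt_or_eq.1 ha with ha | rfl <;>
        rcases Nat.lt_succ_iff_lt_or_eq.1 hb with hb | rfl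
      · rw [hzu a ha, hzu b hb]; exact h.inj a ha b hb
      · rw [hzu a ha]; simp only [Function.update_self]
        exact fun hh => absurd hh (hex a ha)
      · rw [hzu b hb]; simp only [Function.update_self]
        exact fun hh => absurd hh.symm (hex b hb)
      · simp
    · intro l hl
      rcases Nat.lt_succ_iff_lt_or_eq.1 hl with hl | rfl
      · rw [hfu l hl]; have := h.lt l hl; omega
      · simp
    · intro l hl
      rcases Nat.lt_succ_iff_lt_or_eq.1 hl with hl | rfl
      · rw [hfu l hl, hzu _ (h.lt l hl)]; exact h.cell_eq l hl
      · simp [hc, hpt]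
    · intro a ha
      rcases Nat.lt_succ_iff_lt_or_eq.1 ha with ha | rfl
      · obtain ⟨l, hl, rfl⟩ := h.surj a ha
        exact ⟨l, by omega, hfu l hl⟩
      · exact ⟨i, by omega, by simp⟩
    · intro a ha j
      rcases Nat.lt_succ_iff_lt_or_eq.1 ha with ha | rfl
      · rw [hzu a ha, e1' _ (by simp [ha.ne])]; exact h.points a ha j
      · simp [e1]
    · intro a ha
      rcases Nat.lt_succ_iff_lt_or_eq.1 ha with ha | rfl
      · rw [hzu a ha, e2, if_neg (by simpa using hex a ha)]; exact h.hash a ha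
      · simp [e2]
    · intro c' hc'
      have h1 := hc' m₂ (by omega)
      rw [Function.update_self] at h1
      rw [e2, if_neg (by simpa using h1.symm)]
      refine h.hash_zero c' fun a ha => ?_
      have := hc' a (by omega)
      rwa [hzu a ha] at this
    · intro l hl
      rw [e3]
      rcases Nat.lt_succ_iff_lt_or_eq.1 hl with hl | rfl
      · rw [hfu l hl, if_neg (by simp [hl.ne])]; exact h.id l hl
      · simp
    · intro a ha
      rw [er4]
      rcases Nat.lt_succ_iff_lt_or_eq.1 ha with ha | rfl
      · rw [h.flag a ha]
        constructor
        · rintro ⟨l, hl, l', hl', hne, h1, h2⟩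
          exact ⟨l, by omega, l', by omega, hne, by rw [hfu l hl, h1], by rw [hfu l' hl', h2]⟩
        · rintro ⟨l, hl, l', hl', hne, h1, h2⟩
          have hli : l ≠ i := by rintro rfl; simp at h1; omega
          have hli' : l' ≠ i := by rintro rfl; simp at h2; omega
          rw [Function.update_of_ne hli] at h1
          rw [Function.update_of_ne hli'] at h2
          exact ⟨l, by omega, l', by omega, hne, h1, h2⟩
      · simp only [h.flag_zero a le_rfl, ne_eq, not_true_eq_false, false_iff]
        rintro ⟨l, hl, l', hl', hne, h1, h2⟩
        have key : ∀ l, l < i + 1 → Function.update f i a l = a → l = i := by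
          intro l hl h1
          by_contra hne
          rw [Function.update_of_ne hne] at h1
          have := h.lt l (by omega)
          omega
        exact hne ((key l hl h1).trans (key l' hl' h2).symm)
    · intro a ha
      rw [er4]
      exact h.flag_zero a (by omega)
    · intro a ha key
      rw [er a (by omega) (by omega) (by omega)]
      exact h.rest a ha key
    · intro a g key hg
      rw [← h.agree a g key hg]
      by_cases ha1 : a = 1
      · subst ha1; rw [e1' _ (by simp [hg])]
      · by_cases ha2 : a = 2
        · subst ha2; rw [e2, if_neg (by simp [cellKey, hg])]
        · by_cases ha3 : a = 3
          · subst ha3; rw [e3, if_neg (by simp [hg])]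
          · rw [er a ha1 ha2 ha3]

/-- The body is straight-line code of a length that depends on `d` only, hence constant time per
point; the potential is proportional to the number of points still to be inserted. -/
theorem snap_spec (d : ℕ) : ∃ C : ℝ, 0 ≤ C ∧ ∀ (s : State) (G S m : ℕ), G ≠ S → s.reg 3 = G →
    s.reg 4 = m → s.reg 7 = S → Fresh s S →
    Tri (snap d) s (C * (m + 1)) fun s' => ∃ (m₂ : ℕ) (z : ℕ → Fin d → ℤ) (f : ℕ → ℕ),
      s'.reg 15 = m₂ ∧ Grid s s' G S m m₂ (s.reg 11) (s.reg 12) z f := by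
  set t : Test := .lt (.reg 17) (.reg 4) with ht
  set b : ℝ := t.cost + 1 + (snapBody d).bound with hb
  have hb0 : 0 ≤ b := by positivity
  refine ⟨b + (t.cost + 10), by positivity, ?_⟩
  intro s G S m hGS h3 h4 h7 hfresh
  have hw : ∀ x ∈ [3, 4, 7, 11, 12], ¬ (snapBody d).Writes x := by
    intro x hx
    simp only [List.mem_cons, List.not_mem_nil, or_false] at hx
    rcases hx with rfl | rfl | rfl | rfl | rfl <;>
    simp [snapBody, writes_block, writes_unroll, Program.Writes, cellCode, storeCode]
  have hloop : ∀ s₁ : State, (∀ x ∈ [3, 4, 7, 11, 12], s₁.reg x = s.reg x) → s₁.mem = s.mem →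
      s₁.reg 15 = 0 → s₁.reg 17 = 0 →
      Tri (.loop t (snapBody d)) s₁ (t.cost + 1 + b * m) fun s' =>
        ∃ (m₂ : ℕ) (z : ℕ → Fin d → ℤ) (f : ℕ → ℕ),
          s'.reg 15 = m₂ ∧ Grid s s' G S m m₂ (s.reg 11) (s.reg 12) z f := by
    intro s₁ hr hmem h15 h17
    have := Tri.loop (t := t) (P := snapBody d)
      (fun s' => (∀ x ∈ [3, 4, 7, 11, 12], s'.reg x = s.reg x) ∧
        ∃ (i m₂ : ℕ) (z : ℕ → Fin d → ℤ) (f : ℕ → ℕ), i ≤ m ∧ s'.reg 17 = i ∧ s'.reg 15 = m₂ ∧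
          Grid s s' G S i m₂ (s.reg 11) (s.reg 12) z f)
      (fun s' => b * (m - s'.reg 17)) ?_ ?_ (s := s₁) ?_
    · refine this.mono (by simp [h17]) ?_
      rintro s' - ⟨⟨hr', i, m₂, z, f, hi, h17', h15', hg⟩, hn⟩
      rw [ht, Test.holds_lt] at hn
      simp only [Expr.eval, h17', hr' 4 (by simp), h4, Nat.cast_lt, not_lt] at hn
      obtain rfl := le_antisymm hi hn
      exact ⟨m₂, z, f, h15', hg⟩
    · rintro s' ⟨hr', i, m₂, z, f, hi, h17', -⟩
      rw [h17']
      have : (i : ℝ) ≤ m := by exact_mod_cast hi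
      exact mul_nonneg hb0 (by linarith)
    · rintro s' ⟨hr', i, m₂, z, f, hi, h17', h15', hg⟩ hh
      rw [ht, Test.holds_lt] at hh
      simp only [Expr.eval, h17', hr' 4 (by simp), h4, Nat.cast_lt] at hh
      refine ⟨_, Tri.of_flat (flat_snapBody d) ?_⟩
      obtain ⟨m₂', z', f', e15, e17, hg'⟩ := hg.step hGS ((hr' 3 (by simp)).trans h3)
        ((hr' 7 (by simp)).trans h7) h17' h15' (hr' 11 (by simp)) (hr' 12 (by simp))
      refine ⟨⟨fun x hx => ?_, i + 1, m₂', z', f', hh, e17, e15, hg'⟩, ?_⟩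
      · rw [(flat_snapBody d).reg_eq s' (hw x hx), hr' x hx]
      · rw [e17, h17']
        push_cast
        rw [hb]
        linarith
    · refine ⟨hr, 0, 0, fun _ _ => 0, fun _ => 0, Nat.zero_le _, by simpa using h17,
        by simpa using h15, Grid.init hmem hfresh⟩
  refine (Tri.seq (Tri.of_flat (P := .assign 15 (lit 0)) trivial (Q := fun s' =>
      s' = s.setReg 15 0) (by simp [Program.sem, Expr.eval])) fun s₁ _ hs₁ =>
    Tri.seq (Tri.of_flat (P := .assign 17 (lit 0)) trivial (Q := fun s' =>
      s' = s₁.setReg 17 0) (by simp [Program.sem, Expr.eval])) fun s₂ _ hs₂ =>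
    Tri.seq (hloop s₂ ?_ ?_ ?_ ?_) fun s₃ _ hs₃ =>
      Tri.of_flat (P := .skip) trivial (by simpa [Program.sem] using hs₃)).mono ?_ fun _ _ h => h
  · subst hs₂ hs₁; simp
  · subst hs₂ hs₁; simp
  · subst hs₂ hs₁; simp
  · subst hs₂ hs₁; simp
  · simp only [Program.bound, Expr.cost]
    push_cast
    have : (0 : ℝ) ≤ m := Nat.cast_nonneg m
    have : (0 : ℝ) ≤ t.cost := Nat.cast_nonneg _
    nlinarith

end RealRAM

namespace RealRAM

open EuclideanMST

/-! ### Counting clusters by breadth-first search -/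

/-- The `j`-th coordinate of the `w`-th vector of `{-M, …, M} ^ d`. -/
def offset (M w j : ℕ) : ℤ := ((w / (2 * M + 1) ^ j % (2 * M + 1) : ℕ) : ℤ) - M

/-- The vectors of the box correspond to the numbers below `(2 * M + 1) ^ d` through their digits in
base `2 * M + 1`, lowered by `M`. -/
theorem exists_offset_eq {d M : ℕ} {o : Fin d → ℤ} (ho : ∀ j, |o j| ≤ M) :
    ∃ w < (2 * M + 1) ^ d, ∀ j : Fin d, offset M w j = o j := by
  have hb : ∀ j, (o j + M).toNat < 2 * M + 1 := fun j => by
    have := abs_le.1 (ho j)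
    omega
  set w := finFunctionFinEquiv (fun j : Fin d => (⟨(o j + M).toNat, hb j⟩ : Fin (2 * M + 1))) with hw
  refine ⟨w, w.2, fun j => ?_⟩
  have h1 : finFunctionFinEquiv.symm w j = ⟨(o j + M).toNat, hb j⟩ := by
    rw [hw, Equiv.symm_apply_apply]
  have h2 : (w : ℕ) / (2 * M + 1) ^ (j : ℕ) % (2 * M + 1) = (o j + M).toNat := by
    rw [← finFunctionFinEquiv_symm_apply_val, h1]
  have := abs_le.1 (ho j)
  rw [offset, h2]
  omega

theorem floor_natCast_div (a b : ℕ) : ⌊(a : ℝ) / (b : ℝ)⌋ = ((a / b : ℕ) : ℤ) := by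
  rw [← Nat.floor_div_eq_div (K := ℝ), Int.natCast_floor_eq_floor (by positivity)]

/-- Decode the offset number `reg 25` and add it to the point `reg 28`. -/
def decode (d : ℕ) : Program :=
  unroll d fun j => block [.assign 26 (.floor (.div (.reg 25) (.reg 20))),
    .assign (Y j) (.sub (.sub (.reg 25) (.mul (.reg 20) (.reg 26))) (.reg 19)),
    .assign 25 (.reg 26), .assign 27 (.add (.reg 27) (.mul (.reg (Y j)) (.reg (Y j)))),
    .assign 29 (lit j), .load (X j) 1 [7, 28, 29],
    .assign (X j) (.add (.reg (X j)) (.reg (Y j)))]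

theorem flat_decode (d : ℕ) : (decode d).Flat :=
  flat_unroll fun j => by simp [flat_block, Program.Flat]

theorem sem_decode {d : ℕ} {s : State} {S u M w : ℕ} {z : Fin d → ℤ} (h7 : s.reg 7 = S)
    (h28 : s.reg 28 = u) (h19 : s.reg 19 = M) (h20 : s.reg 20 = (2 * M + 1 : ℕ))
    (h25 : s.reg 25 = w) (h27 : s.reg 27 = 0)
    (hz : ∀ j : Fin d, s.mem 1 [(S : ℤ), (u : ℤ), ((j : ℕ) : ℤ)] = z j) :
    (∀ j : Fin d, ((decode d).sem s).reg (X j) = (z j + offset M w j : ℤ)) ∧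
    ((decode d).sem s).reg 27 = ∑ j : Fin d, (offset M w j : ℝ) ^ 2 ∧
    ((decode d).sem s).mem = s.mem ∧
    (∀ x < 100, x ≠ 25 → x ≠ 26 → x ≠ 27 → x ≠ 29 → ((decode d).sem s).reg x = s.reg x) := by
  suffices H : ∀ n, ((decode n).sem s).reg 25 = (w / (2 * M + 1) ^ n : ℕ) ∧
      (∀ j < n, ((decode n).sem s).reg (X j) =
        s.mem 1 [(S : ℤ), (u : ℤ), (j : ℤ)] + offset M w j) ∧
      ((decode n).sem s).reg 27 = ∑ j ∈ Finset.range n, (offset M w j : ℝ) ^ 2 ∧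
      ((decode n).sem s).mem = s.mem ∧
      (∀ x < 100, x ≠ 25 → x ≠ 26 → x ≠ 27 → x ≠ 29 → ((decode n).sem s).reg x = s.reg x) by
    obtain ⟨-, h1, h2, h3, h4⟩ := H d
    refine ⟨fun j => ?_, ?_, h3, h4⟩
    · rw [h1 j j.2, hz]; push_cast; rfl
    · rw [h2, Fin.sum_univ_eq_sum_range (fun j : ℕ => (offset M w j : ℝ) ^ 2)]
  intro n
  induction n with
  | zero => simp [decode, sem_unroll_zero, h25, h27]
  | succ n ih =>
    obtain ⟨i25, iX, i27, imem, ir⟩ := ih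
    have e7 := (ir 7 (by norm_num) (by norm_num) (by norm_num) (by norm_num) (by norm_num)).trans h7
    have e28 := (ir 28 (by norm_num) (by norm_num) (by norm_num) (by norm_num)
      (by norm_num)).trans h28
    have e19 := (ir 19 (by norm_num) (by norm_num) (by norm_num) (by norm_num)
      (by norm_num)).trans h19
    have e20 := (ir 20 (by norm_num) (by norm_num) (by norm_num) (by norm_num)
      (by norm_num)).trans h20
    simp only [decode, sem_unroll_succ] at *
    generalize Program.sem (unroll n _) s = s1 at *
    have hdiv : ⌊s1.reg 25 / s1.reg 20⌋ = ((w / (2 * M + 1) ^ (n + 1) : ℕ) : ℤ) := by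
      rw [i25, e20, floor_natCast_div, Nat.div_div_eq_div_mul, pow_succ]
    -- Quotient minus base times next quotient is the current digit.
    have hoff : s1.reg 25 - s1.reg 20 * ((w / (2 * M + 1) ^ (n + 1) : ℕ) : ℝ) - s1.reg 19 =
        (offset M w n : ℝ) := by
      rw [i25, e20, e19, offset]
      have h1 := Nat.div_add_mod (w / (2 * M + 1) ^ n) (2 * M + 1)
      rw [Nat.div_div_eq_div_mul, ← pow_succ] at h1
      have h2 : ((w / (2 * M + 1) ^ n : ℕ) : ℝ) = ((2 * M + 1 : ℕ) : ℝ) *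
          ((w / (2 * M + 1) ^ (n + 1) : ℕ) : ℝ) +
          ((w / (2 * M + 1) ^ n % (2 * M + 1) : ℕ) : ℝ) := by exact_mod_cast h1.symm
      rw [h2]
      generalize w / (2 * M + 1) ^ n % (2 * M + 1) = r
      push_cast
      ring
    generalize w / (2 * M + 1) ^ (n + 1) = Q at *
    simp only [sem_block_cons, sem_block_nil, Program.sem, Expr.eval]
    refine ⟨?_, ?_, ?_, ?_, ?_⟩
    · simp only [State.reg_setReg]
      simp [hdiv]
    · intro j hj
      rcases Nat.lt_succ_iff_lt_or_eq.1 hj with hj | rfl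
      · simp [hj.ne, iX j hj]
      · simp only [State.reg_setReg, State.mem_setReg]
        simp only [hdiv, imem, Int.cast_natCast]
        simp [e7, e28]
        exact hoff
    · simp only [State.reg_setReg]
      simp only [hdiv, Int.cast_natCast, Finset.sum_range_succ]
      simp [i27, hoff, sq]
    · simp [imem]
    · intro x hx h1 h2 h3 h4
      simp [hx, h1, h2, h3, h4, ir x hx h1 h2 h3 h4]

/-- The test `a ≠ b`. -/
def Test.ne (a b : Expr) : Test := .not (.and (.le a b) (.le b a))

theorem Test.holds_ne (s : State) (a b : Expr) : (Test.ne a b).Holds s ↔ a.eval s ≠ b.eval s := by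
  simp only [Test.ne, Test.Holds, ← le_antisymm_iff, ne_eq]

theorem Test.holds_and (s : State) (t u : Test) :
    (Test.and t u).Holds s ↔ t.Holds s ∧ u.Holds s := Iff.rfl

theorem Test.holds_le (s : State) (a b : Expr) :
    (Test.le a b).Holds s ↔ a.eval s ≤ b.eval s := Iff.rfl

/-- Look at the neighbour with offset number `reg 24` of the cell `reg 28`. -/
def visit (d : ℕ) : Program :=
  block [.assign 25 (.reg 24), .assign 27 (lit 0), decode d, .load 18 2 (7 :: Xs d),
    .ite (.le (.reg 18) (lit 0)) .skip (block [
      .assign 30 (.sub (.reg 18) (lit 1)),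
      -- Offset zero leads back to the current cell, which must not count as its own neighbour.
      -- Squared lengths are compared to avoid roots.
      .ite (.and (.le (.reg 27) (.mul (.reg 14) (.reg 14))) (.ne (.reg 30) (.reg 28)))
        (block [.assign 29 (lit 1), .store 4 [7, 28] 29]) .skip,
      .ite (.le (.reg 27) (.mul (.reg 13) (.reg 13)))
        (block [.load 18 5 [7, 30], .ite (.le (.reg 18) (lit 0))
          (block [.store 6 [7, 22] 30, .assign 22 (.add (.reg 22) (lit 1)), .assign 29 (lit 1),
            .store 5 [7, 30] 29]) .skip]) .skip]),
    .assign 24 (.add (.reg 24) (lit 1))]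

theorem flat_visit (d : ℕ) : (visit d).Flat := by
  simp [visit, flat_block, Program.Flat, flat_decode]

open Classical in
theorem sem_visit {d : ℕ} {s : State} {S u M w t : ℕ} {a b : ℝ} {z : Fin d → ℤ}
    (h7 : s.reg 7 = S) (h28 : s.reg 28 = u) (h19 : s.reg 19 = M)
    (h20 : s.reg 20 = (2 * M + 1 : ℕ)) (h24 : s.reg 24 = w) (h22 : s.reg 22 = t)
    (h13 : s.reg 13 = a) (h14 : s.reg 14 = b)
    (hz : ∀ j : Fin d, s.mem 1 [(S : ℤ), (u : ℤ), ((j : ℕ) : ℤ)] = z j) :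
    ((visit d).sem s).reg 24 = (w + 1 : ℕ) ∧
    (s.mem 2 (cellKey S fun j : Fin d => z j + offset M w j) = 0 →
      ((visit d).sem s).reg 22 = t ∧ ((visit d).sem s).mem = s.mem) ∧
    ∀ v : ℕ, s.mem 2 (cellKey S fun j : Fin d => z j + offset M w j) = v + 1 →
      ∀ p : Prop, (p ↔ ∑ j : Fin d, (offset M w j : ℝ) ^ 2 ≤ a * a ∧
        s.mem 5 [(S : ℤ), (v : ℤ)] ≤ 0) →
      ((visit d).sem s).reg 22 = (if p then t + 1 else t : ℕ) ∧
      (∀ key, ((visit d).sem s).mem 6 key =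
        if p ∧ key = [(S : ℤ), (t : ℤ)] then (v : ℝ) else s.mem 6 key) ∧
      (∀ key, ((visit d).sem s).mem 5 key =
        if p ∧ key = [(S : ℤ), (v : ℤ)] then 1 else s.mem 5 key) ∧
      (∀ key, ((visit d).sem s).mem 4 key =
        if (∑ j : Fin d, (offset M w j : ℝ) ^ 2 ≤ b * b ∧ v ≠ u) ∧ key = [(S : ℤ), (u : ℤ)]
        then 1 else s.mem 4 key) ∧
      ∀ c, c ≠ 4 → c ≠ 5 → c ≠ 6 → ∀ key, ((visit d).sem s).mem c key = s.mem c key := by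
  obtain ⟨d1, d2, d3, d4⟩ := sem_decode (d := d) (s := (s.setReg 25 w).setReg 27 0) (S := S)
    (u := u) (M := M) (w := w) (z := z) (by simp [h7]) (by simp [h28]) (by simp [h19])
    (by simp [h20]) (by simp) (by simp) (by simpa using hz)
  have hs : (visit d).sem s = (block [.load 18 2 (7 :: Xs d),
    .ite (.le (.reg 18) (lit 0)) .skip (block [
      .assign 30 (.sub (.reg 18) (lit 1)),
      .ite (.and (.le (.reg 27) (.mul (.reg 14) (.reg 14))) (.ne (.reg 30) (.reg 28)))
        (block [.assign 29 (lit 1), .store 4 [7, 28] 29]) .skip,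
      .ite (.le (.reg 27) (.mul (.reg 13) (.reg 13)))
        (block [.load 18 5 [7, 30], .ite (.le (.reg 18) (lit 0))
          (block [.store 6 [7, 22] 30, .assign 22 (.add (.reg 22) (lit 1)), .assign 29 (lit 1),
            .store 5 [7, 30] 29]) .skip]) .skip]),
    .assign 24 (.add (.reg 24) (lit 1))]).sem
      ((decode d).sem ((s.setReg 25 w).setReg 27 0)) := by
    simp [visit, sem_block_cons, Program.sem, Expr.eval, h24]
  rw [hs]
  clear hs
  have e := fun x hx h1 h2 h3 h4 => d4 x hx h1 h2 h3 h4
  generalize (decode d).sem ((s.setReg 25 w).setReg 27 0) = s1 at *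
  have e7 : s1.reg 7 = S := by rw [d4 7] <;> simp [h7]
  have e28 : s1.reg 28 = u := by rw [d4 28] <;> simp [h28]
  have e24 : s1.reg 24 = w := by rw [d4 24] <;> simp [h24]
  have e22 : s1.reg 22 = t := by rw [d4 22] <;> simp [h22]
  have e13 : s1.reg 13 = a := by rw [d4 13] <;> simp [h13]
  have e14 : s1.reg 14 = b := by rw [d4 14] <;> simp [h14]
  have hmem : s1.mem = s.mem := by rw [d3]; simp
  have hkey : s1.key (7 :: Xs d) = cellKey S fun j : Fin d => z j + offset M w j :=
    key_Xs e7 d1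
  generalize hnr : ∑ j : Fin d, (offset M w j : ℝ) ^ 2 = nr at *
  clear d1 d3 d4 e
  refine ⟨?_, ?_, ?_⟩
  · obtain h := flat_visit d
    simp only [sem_block_cons, sem_block_nil, Program.sem, hkey]
    generalize hs2 : State.setReg s1 18 _ = s2
    have e2 : s2.reg 24 = w := by rw [← hs2]; simp [e24]
    simp only [Expr.eval, State.reg_setReg, if_true]
    split_ifs <;> simp [e2]
  · intro h0
    simp only [sem_block_cons, sem_block_nil, Program.sem, hkey, hmem, h0]
    simp [Test.Holds, Expr.eval, e22, hmem]
  · intro v hv p hp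
    have hpos : ¬ ((v : ℝ) + 1 ≤ 0) := by have : (0 : ℝ) ≤ v := Nat.cast_nonneg v; linarith
    simp only [sem_block_cons, sem_block_nil, Program.sem, hkey, hmem, hv]
    by_cases h1 : nr ≤ b * b ∧ v ≠ u <;> by_cases h2 : nr ≤ a * a <;>
      by_cases h3 : s.mem 5 [(S : ℤ), (v : ℤ)] ≤ 0
    all_goals
      simp only [h2, h3, and_true, and_false, iff_true, iff_false] at hp
      simp only [Test.holds_and, Test.holds_ne, Test.holds_le, Expr.eval]
      simp +contextual [hpos, hp, h1, h2, h3, d2, e7, e28, e22, e13, e14, hmem]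
end RealRAM

/-! ### The queue while the neighbours of one cell are visited -/

namespace RealRAM

open EuclideanMST

variable {d m₂ : ℕ}

/-- Integer points as points of the Euclidean space. -/
noncomputable def toPts (z : Fin m₂ → Fin d → ℤ) (v : Fin m₂) : EuclideanSpace ℝ (Fin d) :=
  WithLp.toLp 2 fun j => (z v j : ℝ)

/-- The cells `u` and `v` are at distance at most `a`. -/
def CellNear (z : Fin m₂ → Fin d → ℤ) (a : ℝ) (u v : Fin m₂) : Prop :=
  ∑ j, ((z v j - z u j : ℤ) : ℝ) ^ 2 ≤ a * a

theorem cellNear_iff {z : Fin m₂ → Fin d → ℤ} {a : ℝ} (ha : 0 ≤ a) {u v : Fin m₂} :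
    CellNear z a u v ↔ dist (toPts z u) (toPts z v) ≤ a := by
  rw [dist_comm, EuclideanSpace.dist_eq, Real.sqrt_le_left ha, CellNear, sq a]
  simp [toPts, Real.dist_eq, sq_abs]

/-- The cells of a grid, as they are stored. -/
structure Cells (s : State) (S : ℕ) (z : Fin m₂ → Fin d → ℤ) : Prop where
  inj : Function.Injective z
  points : ∀ (v : Fin m₂) (j : Fin d),
    s.mem 1 [(S : ℤ), ((v : ℕ) : ℤ), ((j : ℕ) : ℤ)] = z v j
  hash : ∀ v : Fin m₂, s.mem 2 (cellKey S (z v)) = (v : ℕ) + 1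
  hash_zero : ∀ c, (∀ v, z v ≠ c) → s.mem 2 (cellKey S c) = 0

/-- The queue of the search contains the cells `L`. -/
structure Queue (s₁ s : State) (S : ℕ) (L : List (Fin m₂)) : Prop where
  nodup : L.Nodup
  queue : ∀ (pos : ℕ) (h : pos < L.length), s.mem 6 [(S : ℤ), (pos : ℤ)] = ((L[pos] : ℕ) : ℝ)
  mem_iff : ∀ v : Fin m₂, s.mem 5 [(S : ℤ), ((v : ℕ) : ℤ)] = if v ∈ L then 1 else 0
  other : ∀ c, c ≠ 4 → c ≠ 5 → c ≠ 6 → ∀ key, s.mem c key = s₁.mem c key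
  agree : AgreeOff S s₁ s
  len : s.reg 22 = L.length

/-- Registers that stay fixed during the search. -/
structure SearchRegs (s : State) (d S m₂ M : ℕ) (a b : ℝ) : Prop where
  r7 : s.reg 7 = S
  r13 : s.reg 13 = a
  r14 : s.reg 14 = b
  r15 : s.reg 15 = m₂
  r19 : s.reg 19 = M
  r20 : s.reg 20 = (2 * M + 1 : ℕ)
  r21 : s.reg 21 = ((2 * M + 1) ^ d : ℕ)

theorem SearchRegs.of_eq {s s' : State} {S M : ℕ} {a b : ℝ} (h : SearchRegs s d S m₂ M a b)
    (he : ∀ x ∈ [7, 13, 14, 15, 19, 20, 21], s'.reg x = s.reg x) : SearchRegs s' d S m₂ M a b where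
  r7 := (he 7 (by simp)).trans h.r7
  r13 := (he 13 (by simp)).trans h.r13
  r14 := (he 14 (by simp)).trans h.r14
  r15 := (he 15 (by simp)).trans h.r15
  r19 := (he 19 (by simp)).trans h.r19
  r20 := (he 20 (by simp)).trans h.r20
  r21 := (he 21 (by simp)).trans h.r21

theorem Queue.cells {s₁ s : State} {S : ℕ} {L : List (Fin m₂)} {z : Fin m₂ → Fin d → ℤ}
    (h : Queue s₁ s S L) (hc : Cells s₁ S z) : Cells s S z where
  inj := hc.inj
  points := fun v j => by rw [h.other 1 (by simp) (by simp) (by simp), hc.points]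
  hash := fun v => by rw [h.other 2 (by simp) (by simp) (by simp), hc.hash]
  hash_zero := fun c hv => by rw [h.other 2 (by simp) (by simp) (by simp), hc.hash_zero c hv]

theorem Queue.push {s₁ s s' : State} {S : ℕ} {L : List (Fin m₂)} (h : Queue s₁ s S L)
    {v : Fin m₂} (hv : v ∉ L)
    (h6 : ∀ key, s'.mem 6 key = if key = [(S : ℤ), (L.length : ℤ)] then ((v : ℕ) : ℝ)
      else s.mem 6 key)
    (h5 : ∀ key, s'.mem 5 key = if key = [(S : ℤ), ((v : ℕ) : ℤ)] then 1 else s.mem 5 key)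
    (h4 : ∀ g : ℕ, g ≠ S → ∀ key, s'.mem 4 ((g : ℤ) :: key) = s.mem 4 ((g : ℤ) :: key))
    (ho : ∀ c, c ≠ 4 → c ≠ 5 → c ≠ 6 → ∀ key, s'.mem c key = s.mem c key)
    (hl : s'.reg 22 = (L.length + 1 : ℕ)) : Queue s₁ s' S (L ++ [v]) where
  nodup := by
    rw [List.nodup_append]
    refine ⟨h.nodup, List.nodup_singleton v, fun a ha b hb hab => ?_⟩
    rw [List.mem_singleton] at hb
    exact hv (hb ▸ hab ▸ ha)
  queue := by
    intro pos hp
    rw [h6]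
    simp only [List.length_append, List.length_singleton] at hp
    rcases Nat.lt_succ_iff_lt_or_eq.1 hp with hp' | rfl
    · rw [if_neg (by simp [hp'.ne]), List.getElem_append_left hp', h.queue pos hp']
    · simp
  mem_iff := by
    intro w
    rw [h5]
    by_cases hw : w = v
    · subst hw; simp
    · rw [if_neg (by simpa [Fin.ext_iff] using hw), h.mem_iff]
      simp [hw]
  other := fun c h4 h5 h6 key => by rw [ho c h4 h5 h6, h.other c h4 h5 h6]
  agree := by
    intro c g key hg
    rw [← h.agree c g key hg]
    by_cases c4 : c = 4
    · subst c4; exact h4 g hg key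
    by_cases c5 : c = 5
    · subst c5; rw [h5, if_neg (by simp [hg])]
    by_cases c6 : c = 6
    · subst c6; rw [h6, if_neg (by simp [hg])]
    exact ho c c4 c5 c6 _
  len := by rw [hl]; simp

theorem Queue.same {s₁ s s' : State} {S : ℕ} {L : List (Fin m₂)} (h : Queue s₁ s S L)
    (h4 : ∀ g : ℕ, g ≠ S → ∀ key, s'.mem 4 ((g : ℤ) :: key) = s.mem 4 ((g : ℤ) :: key))
    (ho : ∀ c, c ≠ 4 → ∀ key, s'.mem c key = s.mem c key)
    (hl : s'.reg 22 = s.reg 22) : Queue s₁ s' S L where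
  nodup := h.nodup
  queue := fun pos hp => by rw [ho 6 (by simp), h.queue pos hp]
  mem_iff := fun w => by rw [ho 5 (by simp), h.mem_iff]
  other := fun c h4 h5 h6 key => by rw [ho c h4, h.other c h4 h5 h6]
  agree := by
    intro c g key hg
    rw [← h.agree c g key hg]
    by_cases c4 : c = 4
    · subst c4; exact h4 g hg key
    exact ho c c4 _
  len := by rw [hl, h.len]

/-- An offset leads to at most one stored cell, because distinct cells have distinct coordinates. So
a visit changes at most one flag and appends at most one cell. -/
theorem visit_step {s₁ s : State} {S M w : ℕ} {a b : ℝ} {L : List (Fin m₂)}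
    {z : Fin m₂ → Fin d → ℤ} (hc : Cells s₁ S z) (h : Queue s₁ s S L)
    (hr : SearchRegs s d S m₂ M a b) {u : Fin m₂} (h28 : s.reg 28 = (u : ℕ)) (h24 : s.reg 24 = w) :
    ((visit d).sem s).reg 24 = (w + 1 : ℕ) ∧
    (∀ key, key ≠ [(S : ℤ), ((u : ℕ) : ℤ)] → ((visit d).sem s).mem 4 key = s.mem 4 key) ∧
    (((visit d).sem s).mem 4 [(S : ℤ), ((u : ℕ) : ℤ)] ≠ 0 ↔
      s.mem 4 [(S : ℤ), ((u : ℕ) : ℤ)] ≠ 0 ∨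
        ∃ v, v ≠ u ∧ CellNear z b u v ∧ ∀ j : Fin d, z v j = z u j + offset M w j) ∧
    ∃ L', Queue s₁ ((visit d).sem s) S L' ∧
      (L' = L ∨ ∃ v, CellNear z a u v ∧ L' = L ++ [v]) ∧
      ∀ v, CellNear z a u v → (∀ j : Fin d, z v j = z u j + offset M w j) → v ∈ L' := by
  classical
  have hcs := h.cells hc
  obtain ⟨e24, e0, e1⟩ := sem_visit (d := d) (t := L.length) hr.r7 h28 hr.r19 hr.r20 h24 h.len
    hr.r13 hr.r14 (fun j => hcs.points u j)
  by_cases hex : ∃ v, ∀ j : Fin d, z v j = z u j + offset M w j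
  · obtain ⟨v, hv⟩ := hex
    have hzv : z v = fun j : Fin d => z u j + offset M w j := funext hv
    have huniq : ∀ v', (∀ j : Fin d, z v' j = z u j + offset M w j) → v' = v := fun v' hv' =>
      hcs.inj ((funext hv').trans hzv.symm)
    have hnear : ∀ c, CellNear z c u v ↔ ∑ j : Fin d, (offset M w j : ℝ) ^ 2 ≤ c * c := by
      intro c
      simp only [CellNear, hv, add_sub_cancel_left]
    obtain ⟨f22, f6, f5, f4, fo⟩ := e1 v (by rw [← hzv]; exact hcs.hash v) _ Iff.rfl
    generalize (visit d).sem s = s' at *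
    have g4 : ∀ key, key ≠ [(S : ℤ), ((u : ℕ) : ℤ)] → s'.mem 4 key = s.mem 4 key := by
      intro key hk
      rw [f4, if_neg (by simp [hk])]
    have g4' : ∀ g : ℕ, g ≠ S → ∀ key, s'.mem 4 ((g : ℤ) :: key) = s.mem 4 ((g : ℤ) :: key) :=
      fun g hg key => g4 _ (by simp [hg])
    refine ⟨e24, g4, ?_, ?_⟩
    · rw [f4]
      have hvu : ((v : ℕ) ≠ u) ↔ v ≠ u := by simp [Fin.ext_iff]
      by_cases hb : ∑ j : Fin d, (offset M w j : ℝ) ^ 2 ≤ b * b ∧ (v : ℕ) ≠ u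
      · simp only [hb.1, hb.2, ne_eq, not_false_eq_true, and_self, if_true, one_ne_zero, true_iff]
        exact .inr ⟨v, hvu.1 hb.2, (hnear b).2 hb.1, hv⟩
      · rw [if_neg (fun hh => hb hh.1)]
        refine ⟨.inl, fun hh => hh.resolve_right ?_⟩
        rintro ⟨v', hne, hn, hv'⟩
        rw [huniq v' hv'] at hne hn
        exact hb ⟨(hnear b).1 hn, hvu.2 hne⟩
    · have hmem := h.mem_iff v
      by_cases hp : ∑ j : Fin d, (offset M w j : ℝ) ^ 2 ≤ a * a ∧ s.mem 5 [(S : ℤ), ((v : ℕ) : ℤ)] ≤ 0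
      · simp only [hp, true_and, if_true] at f22 f6 f5
        have hvL : v ∉ L := by
          intro hvL
          rw [hmem, if_pos hvL] at hp
          linarith [hp.2]
        refine ⟨L ++ [v], h.push hvL (by simpa [hp] using f6) (by simpa [hp] using f5) g4' fo
          (by simpa [hp] using f22), .inr ⟨v, (hnear a).2 hp.1, rfl⟩, ?_⟩
        intro v' _ hv'
        simp [huniq v' hv']
      · simp only [hp, false_and, if_false] at f22 f6 f5
        refine ⟨L, h.same g4' (fun c c4 key => ?_) (by rw [f22, h.len]), .inl rfl, ?_⟩
        · by_cases c5 : c = 5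
          · subst c5; exact f5 key
          by_cases c6 : c = 6
          · subst c6; exact f6 key
          exact fo c c4 c5 c6 key
        · intro v' hn hv'
          obtain rfl := huniq v' hv'
          by_contra hL
          rw [hmem, if_neg hL] at hp
          exact hp ⟨(hnear a).1 hn, le_rfl⟩
  · push Not at hex
    obtain ⟨f22, fm⟩ := e0 (hcs.hash_zero _ fun v hv => by
      obtain ⟨j, hj⟩ := hex v
      exact hj (congrFun hv j))
    generalize (visit d).sem s = s' at *
    refine ⟨e24, fun key _ => by rw [fm], ?_, L, h.same (fun _ _ _ => by rw [fm])
      (fun _ _ _ => by rw [fm]) (by rw [f22, h.len]), .inl rfl, ?_⟩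
    · rw [fm]
      refine ⟨.inl, fun hh => hh.resolve_right ?_⟩
      rintro ⟨v', -, -, hv'⟩
      obtain ⟨j, hj⟩ := hex v'
      exact hj (hv' j)
    · intro v' _ hv'
      obtain ⟨j, hj⟩ := hex v'
      exact (hj (hv' j)).elim

/-- Visit all neighbours of the cell at the head of the queue. -/
def process (d : ℕ) : Program :=
  block [.load 28 6 [7, 23], .assign 24 (lit 0), .loop (.lt (.reg 24) (.reg 21)) (visit d),
    .assign 23 (.add (.reg 23) (lit 1))]

theorem not_writes_visit {x : ℕ} (hx : x ∈ [7, 13, 14, 15, 16, 17, 19, 20, 21, 23, 28]) :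
    ¬ (visit d).Writes x := by
  simp only [List.mem_cons, List.not_mem_nil, or_false] at hx
  rcases hx with rfl | rfl | rfl | rfl | rfl | rfl | rfl | rfl | rfl | rfl | rfl <;>
  simp [visit, writes_block, writes_unroll, Program.Writes, decode]

-- A cell within distance `b < M + 1` differs by at most `M` in each integral coordinate, so the `(2
-- * M + 1) ^ d` offsets reach all relevant neighbours, each at constant cost.
set_option maxHeartbeats 1000000 in
theorem process_spec (d : ℕ) : ∃ C : ℝ, 0 ≤ C ∧ ∀ {m₂ : ℕ} {s₁ s : State} {S M h : ℕ} {a b : ℝ}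
    {L : List (Fin m₂)} {z : Fin m₂ → Fin d → ℤ}, Cells s₁ S z → Queue s₁ s S L →
    SearchRegs s d S m₂ M a b → b < M + 1 → 0 ≤ a → a ≤ b →
    s.reg 23 = h → ∀ hh : h < L.length,
    Tri (process d) s (C * (2 * M + 1) ^ d) fun s' => s'.reg 23 = (h + 1 : ℕ) ∧
      (∀ key, key ≠ [(S : ℤ), ((L[h] : ℕ) : ℤ)] → s'.mem 4 key = s.mem 4 key) ∧
      (s'.mem 4 [(S : ℤ), ((L[h] : ℕ) : ℤ)] ≠ 0 ↔
        s.mem 4 [(S : ℤ), ((L[h] : ℕ) : ℤ)] ≠ 0 ∨ ∃ v, v ≠ L[h] ∧ CellNear z b L[h] v) ∧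
      ∃ R, Queue s₁ s' S (L ++ R) ∧ (∀ v ∈ R, CellNear z a L[h] v) ∧
        ∀ v, CellNear z a L[h] v → v ∈ L ++ R := by
  set t : Test := .lt (.reg 24) (.reg 21) with ht
  set c : ℝ := t.cost + 1 + (visit d).bound with hcdef
  have hc0 : 0 ≤ c := by positivity
  refine ⟨c + (t.cost + 20), by positivity, ?_⟩
  intro m₂ s₁ s S M h a b L z hc hq hr hbM ha hab h23 hh
  set u := L[h] with hu
  set W : ℕ := (2 * M + 1) ^ d with hW
  have hW1 : (1 : ℝ) ≤ (2 * (M : ℝ) + 1) ^ d := one_le_pow₀ (by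
    have : (0 : ℝ) ≤ M := Nat.cast_nonneg M
    linarith)
  have hWc : (W : ℝ) = (2 * (M : ℝ) + 1) ^ d := by rw [hW]; push_cast; rfl
  have hoff : ∀ v c', 0 ≤ c' → c' ≤ b → CellNear z c' u v →
      ∃ w < W, ∀ j : Fin d, z v j = z u j + offset M w j := by
    intro v c' h0 hcb hv
    obtain ⟨w, hw, ho⟩ := exists_offset_eq (d := d) (M := M) (o := fun j => z v j - z u j) (by
      intro j
      have h1 : ((z v j - z u j : ℤ) : ℝ) ^ 2 ≤ c' * c' :=
        (Finset.single_le_sum (f := fun j => ((z v j - z u j : ℤ) : ℝ) ^ 2)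
          (fun _ _ => sq_nonneg _) (Finset.mem_univ j)).trans hv
      have h2 : |((z v j - z u j : ℤ) : ℝ)| ≤ c' := abs_le_of_sq_le_sq (by rwa [sq c']) h0
      have h3 : ((|z v j - z u j| : ℤ) : ℝ) < ((M + 1 : ℤ) : ℝ) := by
        rw [Int.cast_abs]; push_cast at h2 ⊢; linarith
      have := Int.cast_lt.1 h3
      omega)
    exact ⟨w, hw, fun j => by rw [ho]; ring⟩
  have hloop : ∀ s₂ : State, (∀ x, x ≠ 24 → x ≠ 28 → s₂.reg x = s.reg x) → s₂.mem = s.mem →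
      s₂.reg 24 = 0 → s₂.reg 28 = (u : ℕ) →
      Tri (.loop t (visit d)) s₂ (t.cost + 1 + c * W) fun s' => s'.reg 23 = h ∧
      (∀ key, key ≠ [(S : ℤ), ((u : ℕ) : ℤ)] → s'.mem 4 key = s.mem 4 key) ∧
      (s'.mem 4 [(S : ℤ), ((u : ℕ) : ℤ)] ≠ 0 ↔
        s.mem 4 [(S : ℤ), ((u : ℕ) : ℤ)] ≠ 0 ∨ ∃ v, v ≠ u ∧ CellNear z b u v) ∧
      ∃ R, Queue s₁ s' S (L ++ R) ∧ (∀ v ∈ R, CellNear z a u v) ∧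
        ∀ v, CellNear z a u v → v ∈ L ++ R := by
    intro s₂ hreg hmem h24 h28
    have := Tri.loop (t := t) (P := visit d)
      (fun s' => (∀ x ∈ [7, 13, 14, 15, 19, 20, 21, 23], s'.reg x = s.reg x) ∧
        s'.reg 28 = (u : ℕ) ∧
        (∀ key, key ≠ [(S : ℤ), ((u : ℕ) : ℤ)] → s'.mem 4 key = s.mem 4 key) ∧
        ∃ w ≤ W, s'.reg 24 = w ∧
        (s'.mem 4 [(S : ℤ), ((u : ℕ) : ℤ)] ≠ 0 ↔
          s.mem 4 [(S : ℤ), ((u : ℕ) : ℤ)] ≠ 0 ∨ ∃ w' < w, ∃ v, v ≠ u ∧ CellNear z b u v ∧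
            ∀ j : Fin d, z v j = z u j + offset M w' j) ∧
        ∃ R, Queue s₁ s' S (L ++ R) ∧ (∀ v ∈ R, CellNear z a u v) ∧
          ∀ v, CellNear z a u v → (∃ w' < w, ∀ j : Fin d, z v j = z u j + offset M w' j) →
            v ∈ L ++ R)
      (fun s' => c * (W - s'.reg 24)) ?_ ?_ (s := s₂) ?_
    · refine this.mono (by simp [h24]) ?_
      rintro s' - ⟨⟨hr', h28', h4, w, hw, h24', hf, R, hQ, hR, hcov⟩, hn⟩
      rw [ht, Test.holds_lt] at hn
      simp only [Expr.eval, h24', hr' 21 (by simp), hr.r21, Nat.cast_lt, not_lt] at hn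
      obtain rfl := le_antisymm hw hn
      refine ⟨(hr' 23 (by simp)).trans h23, h4, hf.trans (or_congr_right ?_), R, hQ, hR,
        fun v hv => hcov v hv (hoff v a ha hab hv)⟩
      constructor
      · rintro ⟨w', _, v, hne, hn, _⟩
        exact ⟨v, hne, hn⟩
      · rintro ⟨v, hne, hn⟩
        obtain ⟨w', hw', ho⟩ := hoff v b (ha.trans hab) le_rfl hn
        exact ⟨w', hw', v, hne, hn, ho⟩
    · rintro s' ⟨-, -, -, w, hw, h24', -⟩
      rw [h24']
      have : (w : ℝ) ≤ W := by exact_mod_cast hw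
      exact mul_nonneg hc0 (by linarith)
    · rintro s' ⟨hr', h28', h4, w, hw, h24', hf, R, hQ, hR, hcov⟩ hlt
      rw [ht, Test.holds_lt] at hlt
      simp only [Expr.eval, h24', hr' 21 (by simp), hr.r21, Nat.cast_lt] at hlt
      refine ⟨_, Tri.of_flat (flat_visit d) ?_⟩
      obtain ⟨g24, g4, gf, L', gQ, gL, gcov⟩ := visit_step hc hQ
        (hr.of_eq fun x hx => hr' x ((by decide : [7, 13, 14, 15, 19, 20, 21] ⊆
          [7, 13, 14, 15, 19, 20, 21, 23]) hx)) h28' h24'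
      refine ⟨⟨fun x hx => ?_, ?_, fun key hk => by rw [g4 key hk, h4 key hk], w + 1, hlt, g24,
        ?_, ?_⟩, ?_⟩
      · rw [(flat_visit d).reg_eq s' (not_writes_visit
          ((by decide : [7, 13, 14, 15, 19, 20, 21, 23] ⊆
            [7, 13, 14, 15, 16, 17, 19, 20, 21, 23, 28]) hx)), hr' x hx]
      · rw [(flat_visit d).reg_eq s' (not_writes_visit (by simp)), h28']
      · rw [gf, hf, or_assoc]
        refine or_congr_right ?_
        constructor
        · rintro (⟨w', hw', hv⟩ | hv)
          · exact ⟨w', by omega, hv⟩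
          · exact ⟨w, by omega, hv⟩
        · rintro ⟨w', hw', hv⟩
          rcases Nat.lt_succ_iff_lt_or_eq.1 hw' with hw' | rfl
          · exact .inl ⟨w', hw', hv⟩
          · exact .inr hv
      · obtain ⟨R', rfl, hR', hsub⟩ : ∃ R', L' = L ++ R' ∧ (∀ v ∈ R', CellNear z a u v) ∧
            ∀ v ∈ L ++ R, v ∈ L ++ R' := by
          rcases gL with rfl | ⟨v, hv, rfl⟩
          · exact ⟨R, rfl, hR, fun v hv => hv⟩
          · refine ⟨R ++ [v], by simp, ?_, ?_⟩
            · intro v' hv'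
              rw [List.mem_append, List.mem_singleton] at hv'
              rcases hv' with hv' | rfl
              · exact hR v' hv'
              · exact hv
            · intro v' hv'
              rw [← List.append_assoc]
              exact List.mem_append_left _ hv'
        refine ⟨R', gQ, hR', ?_⟩
        rintro v hv ⟨w', hw', ho⟩
        rcases Nat.lt_succ_iff_lt_or_eq.1 hw' with hw' | rfl
        · exact hsub v (hcov v hv ⟨w', hw', ho⟩)
        · exact gcov v hv ho
      · rw [g24, h24']
        push_cast
        rw [hcdef]
        linarith
    · refine ⟨fun x hx => hreg x (by rintro rfl; simp at hx) (by rintro rfl; simp at hx), h28,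
        fun key _ => by rw [hmem], 0, Nat.zero_le _, by simpa using h24, by simp [hmem], [], ?_, by simp,
        by simp⟩
      rw [List.append_nil]
      exact hq.same (fun _ _ _ => by rw [hmem]) (fun _ _ _ => by rw [hmem])
        (hreg 22 (by simp) (by simp))
  refine (Tri.seq (Tri.of_flat (P := .load 28 6 [7, 23]) trivial (Q := fun s' =>
      s' = s.setReg 28 (u : ℕ)) ?_) fun s₂ _ hs₂ =>
    Tri.seq (Tri.of_flat (P := .assign 24 (lit 0)) trivial (Q := fun s' =>
      s' = s₂.setReg 24 0) (by simp [Program.sem, Expr.eval])) fun s₃ _ hs₃ =>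
    Tri.seq (hloop s₃ ?_ ?_ ?_ ?_) fun s₄ _ hs₄ =>
    Tri.seq (Tri.of_flat (P := .assign 23 (.add (.reg 23) (lit 1))) trivial (Q := fun s' =>
      s' = s₄.setReg 23 (h + 1 : ℕ)) ?_) fun s₅ _ hs₅ =>
      Tri.of_flat (P := .skip) trivial ?_).mono ?_ fun _ _ h => h
  · simp [Program.sem, hr.r7, h23, hq.queue h hh, hu]
  · subst hs₃ hs₂; intro x h1 h2; simp [h1, h2]
  · subst hs₃ hs₂; simp
  · subst hs₃ hs₂; simp
  · subst hs₃ hs₂; simp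
  · simp [Program.sem, Expr.eval, hs₄.1]
  · obtain ⟨h1, h2, h3, R, h4, h5, h6⟩ := hs₄
    subst hs₅
    simp only [Program.sem]
    exact ⟨by simp, h2, h3, R, h4.same (fun _ _ _ => rfl) (fun _ _ _ => rfl) (by simp), h5, h6⟩
  · simp only [Program.bound, Expr.cost, List.length_cons, List.length_nil]
    push_cast
    rw [hWc]
    have : (0 : ℝ) ≤ t.cost := Nat.cast_nonneg _
    nlinarith

end RealRAM

/-! ### Counting clusters: the whole search -/

namespace RealRAM

open EuclideanMST

variable {d m₂ : ℕ}

/-- If the cell `reg 17` has not been visited, then append it to the queue. -/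
def advance : Program :=
  block [.load 18 5 [7, 17], .ite (.le (.reg 18) (lit 0))
    (block [.assign 16 (.add (.reg 16) (lit 1)), .store 6 [7, 22] 17,
      .assign 22 (.add (.reg 22) (lit 1)), .assign 30 (lit 1), .store 5 [7, 17] 30]) .skip,
    .assign 17 (.add (.reg 17) (lit 1))]

/-- Count the clusters of the cells at distance `reg 13`, and flag the cells that have a neighbour
at distance `reg 14`. -/
def bfs (d : ℕ) : Program :=
  block [.assign 19 (.floor (.reg 14)), .assign 20 (.add (.mul (lit 2) (.reg 19)) (lit 1)),
    .assign 21 (lit 1), unroll d fun _ => .assign 21 (.mul (.reg 21) (.reg 20)),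
    .assign 22 (lit 0), .assign 23 (lit 0), .assign 17 (lit 0), .assign 16 (lit 0),
    -- The loop runs until every cell has been processed. When the head has caught up with the tail,
    -- `advance` moves on by one index and, if that cell is unvisited, starts a new cluster there.
    .loop (.lt (.reg 23) (.reg 15)) (.ite (.lt (.reg 23) (.reg 22)) (process d) advance)]

theorem flat_advance : advance.Flat := by
  simp [advance, flat_block, Program.Flat]

theorem sem_advance {s : State} {S i t cnt : ℕ} (h7 : s.reg 7 = S) (h17 : s.reg 17 = i)
    (h22 : s.reg 22 = t) (h16 : s.reg 16 = cnt) :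
    (advance.sem s).reg 17 = (i + 1 : ℕ) ∧ (advance.sem s).reg 23 = s.reg 23 ∧
    (s.mem 5 [(S : ℤ), (i : ℤ)] = 1 → (advance.sem s).mem = s.mem ∧
      (advance.sem s).reg 22 = t ∧ (advance.sem s).reg 16 = cnt) ∧
    (s.mem 5 [(S : ℤ), (i : ℤ)] = 0 → (advance.sem s).reg 22 = (t + 1 : ℕ) ∧
      (advance.sem s).reg 16 = (cnt + 1 : ℕ) ∧
      (∀ key, (advance.sem s).mem 6 key = if key = [(S : ℤ), (t : ℤ)] then (i : ℝ)
        else s.mem 6 key) ∧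
      (∀ key, (advance.sem s).mem 5 key = if key = [(S : ℤ), (i : ℤ)] then 1
        else s.mem 5 key) ∧
      ∀ c, c ≠ 5 → c ≠ 6 → ∀ key, (advance.sem s).mem c key = s.mem c key) := by
  have hgen : (advance.sem s).reg 17 = (i + 1 : ℕ) := by
    simp only [advance, sem_block_cons, sem_block_nil, Program.sem]
    split_ifs <;> simp [Expr.eval, h17]
  refine ⟨hgen, flat_advance.reg_eq s ?_, ?_, ?_⟩
  · simp [advance, writes_block, Program.Writes]
  · intro h5
    simp only [advance, sem_block_cons, sem_block_nil, Program.sem, key_cons, key_nil, h7, h17,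
      Int.floor_natCast, h5]
    simp [Test.holds_le, Expr.eval, h22, h16, not_le.2 (one_pos : (0 : ℝ) < 1)]
  · intro h5
    simp only [advance, sem_block_cons, sem_block_nil, Program.sem, key_cons, key_nil, h7, h17,
      Int.floor_natCast, h5]
    simp +contextual [Test.holds_le, Expr.eval, h22, h16, h7, h17]

theorem sem_power {d : ℕ} {s : State} {B : ℕ} (h20 : s.reg 20 = B) (h21 : s.reg 21 = 1) :
    (unroll d fun _ => .assign 21 (.mul (.reg 21) (.reg 20))).sem s = s.setReg 21 (B ^ d : ℕ) := by
  induction d with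
  | zero =>
    simp only [sem_unroll_zero, pow_zero, Nat.cast_one, ← h21, State.setReg]
    simp
  | succ d ih =>
    rw [sem_unroll_succ, ih]
    simp only [Program.sem, Expr.eval, State.setReg, Function.update_self,
      Function.update_idem]
    congr 2
    rw [Function.update_of_ne (by norm_num), h20]
    push_cast
    ring

/-- The invariant of the search. -/
structure Search (s₁ s : State) (S h i cnt : ℕ) (a b : ℝ) (z : Fin m₂ → Fin d → ℤ)
    (L : List (Fin m₂)) : Prop where
  queue : Queue s₁ s S L
  h23 : s.reg 23 = h
  h17 : s.reg 17 = i
  h16 : s.reg 16 = cnt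
  head_le : h ≤ L.length
  -- Once the head reaches the end of the queue, this makes `L` a union of components.
  closed : ∀ (pos : ℕ) (hp : pos < L.length), pos < h → ∀ v, CellNear z a L[pos] v → v ∈ L
  seen : ∀ v : Fin m₂, (v : ℕ) < i → v ∈ L
  le : i ≤ m₂
  count : cnt = ((nearGraph (toPts z) a).connectedComponentMk '' {v | v ∈ L}).ncard
  flag : ∀ v : Fin m₂, s.mem 4 [(S : ℤ), ((v : ℕ) : ℤ)] ≠ 0 ↔
    s₁.mem 4 [(S : ℤ), ((v : ℕ) : ℤ)] ≠ 0 ∨ (v ∈ L.take h ∧ ∃ v', v' ≠ v ∧ CellNear z b v v')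

theorem Search.process {s₁ s s' : State} {S h i cnt : ℕ} {a b : ℝ} {z : Fin m₂ → Fin d → ℤ}
    {L : List (Fin m₂)} (H : Search s₁ s S h i cnt a b z L) (ha : 0 ≤ a) (hh : h < L.length)
    (h23 : s'.reg 23 = (h + 1 : ℕ)) (h17 : s'.reg 17 = s.reg 17) (h16 : s'.reg 16 = s.reg 16)
    (h4 : ∀ key, key ≠ [(S : ℤ), ((L[h] : ℕ) : ℤ)] → s'.mem 4 key = s.mem 4 key)
    (h4' : s'.mem 4 [(S : ℤ), ((L[h] : ℕ) : ℤ)] ≠ 0 ↔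
        s.mem 4 [(S : ℤ), ((L[h] : ℕ) : ℤ)] ≠ 0 ∨ ∃ v, v ≠ L[h] ∧ CellNear z b L[h] v)
    {R : List (Fin m₂)} (hQ : Queue s₁ s' S (L ++ R)) (hR : ∀ v ∈ R, CellNear z a L[h] v)
    (hcov : ∀ v, CellNear z a L[h] v → v ∈ L ++ R) :
    Search s₁ s' S (h + 1) i cnt a b z (L ++ R) where
  queue := hQ
  h23 := h23
  h17 := h17.trans H.h17
  h16 := h16.trans H.h16
  head_le := by rw [List.length_append]; omega
  closed := by
    intro pos hp hph v hv
    rw [List.getElem_append_left (by omega)] at hv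
    rcases Nat.lt_succ_iff_lt_or_eq.1 hph with hph | rfl
    · exact List.mem_append_left _ (H.closed pos (by omega) hph v hv)
    · exact hcov v hv
  seen := fun v hv => List.mem_append_left _ (H.seen v hv)
  le := H.le
  count := by
    rw [H.count]
    congr 1
    refine Set.Subset.antisymm (Set.image_mono fun v hv => List.mem_append_left _ hv) ?_
    rintro _ ⟨v, hv, rfl⟩
    rcases List.mem_append.1 hv with hv | hv
    · exact ⟨v, hv, rfl⟩
    · exact ⟨L[h], List.getElem_mem hh, SimpleGraph.ConnectedComponent.sound
        (nearGraph_reachable _ ((cellNear_iff ha).1 (hR v hv)))⟩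
  flag := by
    intro v
    have htake : (L ++ R).take (h + 1) = L.take h ++ [L[h]] := by
      rw [List.take_append_of_le_length (by omega), List.take_succ_eq_append_getElem hh]
    rw [htake, List.mem_append, List.mem_singleton]
    by_cases hv : v = L[h]
    · subst hv
      rw [h4', H.flag]
      simp only [or_true, true_and, or_assoc]
      exact or_congr_right ⟨fun hh => hh.elim And.right id, .inr⟩
    · rw [h4 _ (by simpa [Fin.ext_iff] using hv), H.flag]
      simp only [hv, or_false]

theorem Search.length_le {s₁ s : State} {S h i cnt : ℕ} {a b : ℝ} {z : Fin m₂ → Fin d → ℤ}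
    {L : List (Fin m₂)} (H : Search s₁ s S h i cnt a b z L) : L.length ≤ m₂ := by
  simpa using H.queue.nodup.length_le_card

theorem Search.lt_of_lt {s₁ s : State} {S h i cnt : ℕ} {a b : ℝ} {z : Fin m₂ → Fin d → ℤ}
    {L : List (Fin m₂)} (H : Search s₁ s S h i cnt a b z L) (hh : L.length < m₂) : i < m₂ := by
  by_contra hi
  have : (Finset.univ : Finset (Fin m₂)) ⊆ L.toFinset := fun v _ =>
    List.mem_toFinset.2 (H.seen v (by omega))
  have h1 := Finset.card_le_card this
  rw [Finset.card_univ, Fintype.card_fin] at h1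
  have h2 := L.toFinset_card_le
  omega

theorem Search.advance {s₁ s : State} {S h i cnt : ℕ} {a b : ℝ} {z : Fin m₂ → Fin d → ℤ}
    {L : List (Fin m₂)} (H : Search s₁ s S h i cnt a b z L) (ha : 0 ≤ a) (h7 : s.reg 7 = S)
    (hh : L.length ≤ h) (hi : i < m₂) :
    ∃ cnt' L', Search s₁ (advance.sem s) S h (i + 1) cnt' a b z L' := by
  classical
  obtain ⟨g17, g23, g1, g0⟩ := sem_advance h7 H.h17 H.queue.len H.h16
  obtain rfl : h = L.length := le_antisymm H.head_le hh
  have hm := H.queue.mem_iff ⟨i, hi⟩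
  by_cases hiL : (⟨i, hi⟩ : Fin m₂) ∈ L
  · rw [if_pos hiL] at hm
    obtain ⟨gm, g22, g16⟩ := g1 hm
    generalize RealRAM.advance.sem s = s' at *
    refine ⟨cnt, L, ⟨H.queue.same (fun _ _ _ => by rw [gm]) (fun _ _ _ => by rw [gm])
      (by rw [g22, H.queue.len]), g23.trans H.h23, g17, g16, H.head_le, H.closed, ?_, hi, H.count,
      by rw [gm]; exact H.flag⟩⟩
    intro v hv
    rcases Nat.lt_succ_iff_lt_or_eq.1 hv with hv | hv
    · exact H.seen v hv
    · obtain rfl : v = ⟨i, hi⟩ := Fin.ext hv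
      exact hiL
  · rw [if_neg hiL] at hm
    obtain ⟨g22, g16, g6, g5, go⟩ := g0 hm
    generalize RealRAM.advance.sem s = s' at *
    refine ⟨cnt + 1, L ++ [⟨i, hi⟩], ⟨H.queue.push hiL g6 g5 (fun _ _ _ => go 4 (by simp) (by simp) _)
      (fun c _ h5 h6 => go c h5 h6) g22, g23.trans H.h23, g17, g16, by simp, ?_, ?_, hi, ?_, ?_⟩⟩
    · intro pos hp hph v hv
      rw [List.getElem_append_left hph] at hv
      exact List.mem_append_left _ (H.closed pos hph hph v hv)
    · intro v hv
      rw [List.mem_append, List.mem_singleton]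
      rcases Nat.lt_succ_iff_lt_or_eq.1 hv with hv | hv
      · exact .inl (H.seen v hv)
      · exact .inr (Fin.ext hv)
    -- The queue is exhausted, so its cells are closed under adjacency and the unvisited cell lies
    -- in a component not counted before.
    · have hclosed : ∀ u v, (nearGraph (toPts z) a).Reachable u v → u ∈ L → v ∈ L := by
        rintro u v ⟨p⟩
        induction p with
        | nil => exact id
        | cons hadj _ ih =>
          intro hu
          apply ih
          obtain ⟨pos, hp, rfl⟩ := List.mem_iff_getElem.1 hu
          exact H.closed pos hp hp _ ((cellNear_iff ha).2 hadj.2)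
      have himg : {v | v ∈ L ++ [⟨i, hi⟩]} = insert ⟨i, hi⟩ {v | v ∈ L} := by
        ext v
        simp [or_comm]
      rw [himg, Set.image_insert_eq, Set.ncard_insert_of_notMem, H.count]
      rintro ⟨v, hv, hvi⟩
      exact hiL (hclosed v _ (SimpleGraph.ConnectedComponent.exact hvi) hv)
    · intro v
      rw [go 4 (by simp) (by simp), H.flag v, List.take_append_of_le_length le_rfl]

theorem not_writes_searchBody {x : ℕ} (hx : x ∈ [7, 13, 14, 15, 19, 20, 21]) :
    ¬ (Program.ite (.lt (.reg 23) (.reg 22)) (process d) advance).Writes x := by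
  have h1 : ¬ (visit d).Writes x := not_writes_visit
    ((by decide : [7, 13, 14, 15, 19, 20, 21] ⊆ [7, 13, 14, 15, 16, 17, 19, 20, 21, 23, 28]) hx)
  simp only [List.mem_cons, List.not_mem_nil, or_false] at hx
  rcases hx with rfl | rfl | rfl | rfl | rfl | rfl | rfl <;>
  simp [process, writes_block, Program.Writes, advance, h1]

theorem Tri.frame {P : Program} {s : State} {B : ℝ} {Q : State → Prop} (h : Tri P s B Q) :
    Tri P s B fun s' => (∀ x, ¬ P.Writes x → s'.reg x = s.reg x) ∧ Q s' :=
  h.mono le_rfl fun _ h1 h2 => ⟨h1, h2⟩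

-- Every iteration either processes one queued cell or passes one index, and each happens at most
-- `m₂` times; the potential has one term for either kind. At the end the queue contains all cells,
-- so the components met are all components.
set_option maxHeartbeats 1000000 in
theorem bfs_spec (d : ℕ) : ∃ C : ℝ, 0 ≤ C ∧ ∀ {m₂ : ℕ} {s : State} {S : ℕ} {a b : ℝ}
    {z : Fin m₂ → Fin d → ℤ}, Cells s S z → s.reg 7 = S → s.reg 13 = a → s.reg 14 = b →
    s.reg 15 = m₂ → 0 ≤ a → a ≤ b → (∀ c, 5 ≤ c → ∀ key, s.mem c ((S : ℤ) :: key) = 0) →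
    Tri (bfs d) s (C * (m₂ + 1) * (2 * b + 1) ^ d) fun s' =>
      s'.reg 16 = clusters (toPts z) a ∧
      (∀ v : Fin m₂, s'.mem 4 [(S : ℤ), ((v : ℕ) : ℤ)] ≠ 0 ↔
        s.mem 4 [(S : ℤ), ((v : ℕ) : ℤ)] ≠ 0 ∨ ∃ v', v' ≠ v ∧ CellNear z b v v') ∧
      (∀ c, c ≠ 4 → c ≠ 5 → c ≠ 6 → ∀ key, s'.mem c key = s.mem c key) ∧ AgreeOff S s s' := by
  classical
  obtain ⟨Cp, hCp, hproc⟩ := process_spec d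
  set body : Program := .ite (.lt (.reg 23) (.reg 22)) (process d) advance with hbody
  set t : Test := .lt (.reg 23) (.reg 15) with ht
  set t' : Test := .lt (.reg 23) (.reg 22) with ht'
  set ca : ℝ := t.cost + 1 + (t'.cost + 1 + advance.bound) with hca
  have hca0 : 0 ≤ ca := by positivity
  set k₀ : ℝ := t.cost + 1 + (t'.cost + 1) with hk₀
  have hk₀0 : 0 ≤ k₀ := by positivity
  set pw : Program := unroll d fun _ => .assign 21 (.mul (.reg 21) (.reg 20)) with hpw
  refine ⟨k₀ + Cp + ca + (t.cost + pw.bound + 60), by positivity, ?_⟩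
  intro m₂ s S a b z hc h7 h13 h14 h15 ha hab h5
  set M := ⌊b⌋₊ with hM
  have hb0 : 0 ≤ b := ha.trans hab
  have hMb : (M : ℝ) ≤ b := Nat.floor_le hb0
  have hbM : b < M + 1 := Nat.lt_floor_add_one b
  set cp : ℝ := k₀ + Cp * (2 * M + 1) ^ d with hcp
  have hcp0 : 0 ≤ cp := by positivity
  have hloop : ∀ s₁ : State, SearchRegs s₁ d S m₂ M a b → s₁.mem = s.mem →
      s₁.reg 22 = 0 → s₁.reg 23 = 0 → s₁.reg 17 = 0 → s₁.reg 16 = 0 →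
      Tri (.loop t body) s₁ (t.cost + 1 + (cp * m₂ + ca * m₂)) fun s' =>
      s'.reg 16 = clusters (toPts z) a ∧
      (∀ v : Fin m₂, s'.mem 4 [(S : ℤ), ((v : ℕ) : ℤ)] ≠ 0 ↔
        s.mem 4 [(S : ℤ), ((v : ℕ) : ℤ)] ≠ 0 ∨ ∃ v', v' ≠ v ∧ CellNear z b v v') ∧
      (∀ c, c ≠ 4 → c ≠ 5 → c ≠ 6 → ∀ key, s'.mem c key = s.mem c key) ∧ AgreeOff S s s' := by
    intro s₁ hr₁ hmem g22 g23 g17 g16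
    have := Tri.loop (t := t) (P := body)
      (fun s' => SearchRegs s' d S m₂ M a b ∧
        ∃ h i cnt L, Search s s' S h i cnt a b z L)
      (fun s' => cp * (m₂ - s'.reg 23) + ca * (m₂ - s'.reg 17)) ?_ ?_ (s := s₁) ?_
    · refine this.mono (by simp [g23, g17]) ?_
      rintro s' - ⟨⟨hr, h, i, cnt, L, H⟩, hn⟩
      rw [ht, Test.holds_lt] at hn
      simp only [Expr.eval, H.h23, hr.r15, Nat.cast_lt, not_lt] at hn
      have hl := H.length_le
      have hhl := H.head_le
      have hL : ∀ v, v ∈ L := by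
        have h1 : L.toFinset.card = m₂ := by
          rw [List.toFinset_card_of_nodup H.queue.nodup]; omega
        have h2 : L.toFinset = Finset.univ :=
          Finset.eq_univ_of_card _ (by rw [h1, Fintype.card_fin])
        intro v
        rw [← List.mem_toFinset, h2]
        exact Finset.mem_univ v
      refine ⟨?_, ?_, H.queue.other, H.queue.agree⟩
      · have himg : (nearGraph (toPts z) a).connectedComponentMk '' {v | v ∈ L} = Set.univ := by
          rw [Set.eq_univ_iff_forall]
          intro c
          induction c using SimpleGraph.ConnectedComponent.ind with
          | h v => exact ⟨v, hL v, rfl⟩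
        rw [H.h16, H.count, himg, Set.ncard_univ]
        rfl
      · intro v
        rw [H.flag v, List.take_of_length_le (by omega)]
        simp [hL]
    · rintro s' ⟨hr, h, i, cnt, L, H⟩
      have h1 : (h : ℝ) ≤ m₂ := by exact_mod_cast H.head_le.trans H.length_le
      have h2 : (i : ℝ) ≤ m₂ := by exact_mod_cast H.le
      rw [H.h23, H.h17]
      exact add_nonneg (mul_nonneg hcp0 (by linarith)) (mul_nonneg hca0 (by linarith))
    · rintro s' ⟨hr, h, i, cnt, L, H⟩ hlt
      rw [ht, Test.holds_lt] at hlt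
      simp only [Expr.eval, H.h23, hr.r15, Nat.cast_lt] at hlt
      have hframe : ∀ s'' : State, (∀ x, ¬ body.Writes x → s''.reg x = s'.reg x) →
          SearchRegs s'' d S m₂ M a b := fun s'' hs'' =>
        hr.of_eq fun x hx => hs'' x (not_writes_searchBody hx)
      by_cases hhL : h < L.length
      · have hT : t'.Holds s' := by
          rw [ht', Test.holds_lt]
          simp only [Expr.eval, H.h23, H.queue.len, Nat.cast_lt]
          exact hhL
        have hp := (hproc hc H.queue hr hbM ha hab H.h23 hhL).frame
        refine ⟨_, (Tri.ite (t := t') (P' := advance) (fun _ => hp)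
          (fun hn => absurd hT hn)).mono le_rfl ?_⟩
        rintro s'' hw ⟨hw', e23, e4, e4', R, hQ, hR, hcov⟩
        have e17 : s''.reg 17 = s'.reg 17 := hw' 17 (by
          simp [process, writes_block, Program.Writes, not_writes_visit])
        have e16 : s''.reg 16 = s'.reg 16 := hw' 16 (by
          simp [process, writes_block, Program.Writes, not_writes_visit])
        refine ⟨⟨hframe s'' hw, h + 1, i, cnt, L ++ R,
          H.process ha hhL e23 e17 e16 e4 e4' hQ hR hcov⟩, ?_⟩
        rw [e23, e17, H.h23]
        push_cast
        rw [hcp, hk₀]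
        linarith
      · have hT : ¬ t'.Holds s' := by
          rw [ht', Test.holds_lt]
          simp only [Expr.eval, H.h23, H.queue.len, Nat.cast_lt]
          exact hhL
        have hi := H.lt_of_lt (by omega)
        refine ⟨_, (Tri.ite (t := t') (P := process d) (fun h => absurd h hT)
          (fun _ => Tri.of_flat flat_advance (Q := fun s'' => s'' = advance.sem s') rfl)).mono
          le_rfl ?_⟩
        rintro s'' hw rfl
        obtain ⟨cnt', L', H'⟩ := H.advance ha hr.r7 (by omega) hi
        refine ⟨⟨hframe _ hw, h, i + 1, cnt', L', H'⟩, ?_⟩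
        rw [H'.h23, H'.h17, H.h23, H.h17]
        push_cast
        rw [hca]
        linarith
    · refine ⟨hr₁, 0, 0, 0, [], ⟨⟨List.nodup_nil, by simp, ?_, fun _ _ _ _ _ => by rw [hmem],
        fun _ _ _ _ => by rw [hmem], by simpa using g22⟩, by simpa using g23, by simpa using g17,
        by simpa using g16, by simp, by simp, by simp, by simp, by simp, by simp [hmem]⟩⟩
      intro v
      rw [hmem, h5 5 (by simp)]
      simp
  have hfloor : ⌊b⌋ = (M : ℤ) := (Int.natCast_floor_eq_floor hb0).symm
  refine (Tri.seq (Tri.of_flat (P := .assign 19 (.floor (.reg 14))) trivial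
      (Q := fun s' => s' = s.setReg 19 M) ?_) fun s₁ _ hs₁ =>
    Tri.seq (Tri.of_flat (P := .assign 20 (.add (.mul (lit 2) (.reg 19)) (lit 1))) trivial
      (Q := fun s' => s' = s₁.setReg 20 (2 * M + 1 : ℕ)) ?_) fun s₂ _ hs₂ =>
    Tri.seq (Tri.of_flat (P := .assign 21 (lit 1)) trivial
      (Q := fun s' => s' = s₂.setReg 21 1) (by simp [Program.sem, Expr.eval])) fun s₃ _ hs₃ =>
    Tri.seq (Tri.of_flat (P := pw) (flat_unroll fun _ => trivial)
      (Q := fun s' => s' = s₃.setReg 21 ((2 * M + 1) ^ d : ℕ)) ?_) fun s₄ _ hs₄ =>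
    Tri.seq (Tri.of_flat (P := .assign 22 (lit 0)) trivial
      (Q := fun s' => s' = s₄.setReg 22 0) (by simp [Program.sem, Expr.eval])) fun s₅ _ hs₅ =>
    Tri.seq (Tri.of_flat (P := .assign 23 (lit 0)) trivial
      (Q := fun s' => s' = s₅.setReg 23 0) (by simp [Program.sem, Expr.eval])) fun s₆ _ hs₆ =>
    Tri.seq (Tri.of_flat (P := .assign 17 (lit 0)) trivial
      (Q := fun s' => s' = s₆.setReg 17 0) (by simp [Program.sem, Expr.eval])) fun s₇ _ hs₇ =>
    Tri.seq (Tri.of_flat (P := .assign 16 (lit 0)) trivial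
      (Q := fun s' => s' = s₇.setReg 16 0) (by simp [Program.sem, Expr.eval])) fun s₈ _ hs₈ =>
    Tri.seq (hloop s₈ ?_ ?_ ?_ ?_ ?_ ?_) fun s₉ _ hs₉ =>
      Tri.of_flat (P := .skip) trivial hs₉).mono ?_ fun _ _ h => h
  · simp [Program.sem, Expr.eval, h14, hfloor]
  · subst hs₁
    simp [Program.sem, Expr.eval]
  · rw [hpw, sem_power (B := 2 * M + 1)]
    · subst hs₃ hs₂; simp
    · subst hs₃; simp
  · subst hs₈ hs₇ hs₆ hs₅ hs₄ hs₃ hs₂ hs₁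
    exact ⟨by simp [h7], by simp [h13], by simp [h14], by simp [h15], by simp, by simp, by simp⟩
  · subst hs₈ hs₇ hs₆ hs₅ hs₄ hs₃ hs₂ hs₁; rfl
  · subst hs₈ hs₇ hs₆ hs₅ hs₄ hs₃ hs₂ hs₁; simp
  · subst hs₈ hs₇ hs₆ hs₅ hs₄ hs₃ hs₂ hs₁; simp
  · subst hs₈ hs₇ hs₆ hs₅ hs₄ hs₃ hs₂ hs₁; simp
  · subst hs₈ hs₇ hs₆ hs₅ hs₄ hs₃ hs₂ hs₁; simp
  · simp only [Program.bound, Expr.cost]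
    push_cast
    have hpow : (2 * (M : ℝ) + 1) ^ d ≤ (2 * b + 1) ^ d := by gcongr
    have hone : (1 : ℝ) ≤ (2 * b + 1) ^ d := one_le_pow₀ (by linarith)
    have e0 : (0 : ℝ) ≤ t.cost := Nat.cast_nonneg _
    have e1 : (0 : ℝ) ≤ pw.bound := Nat.cast_nonneg _
    have e2 : (0 : ℝ) ≤ m₂ := Nat.cast_nonneg _
    set Z := (2 * b + 1) ^ d with hZ
    have h1 : cp * m₂ ≤ (k₀ + Cp) * m₂ * Z := by
      have : cp ≤ (k₀ + Cp) * Z := by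
        rw [hcp]
        have := mul_le_mul_of_nonneg_left hpow hCp
        nlinarith
      calc cp * m₂ ≤ (k₀ + Cp) * Z * m₂ := by gcongr
        _ = _ := by ring
    have h2 : ca * m₂ ≤ ca * m₂ * Z := le_mul_of_one_le_right (by positivity) hone
    have h3 : t.cost + pw.bound + 60 ≤ (t.cost + pw.bound + 60) * Z :=
      le_mul_of_one_le_right (by positivity) hone
    have h4 : (0 : ℝ) ≤ (k₀ + Cp + ca) * Z := by positivity
    have h5 : (0 : ℝ) ≤ (t.cost + pw.bound + 60) * m₂ * Z := by positivity
    have h6 : (k₀ + Cp + ca + (t.cost + pw.bound + 60)) * (m₂ + 1) * Z =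
      (k₀ + Cp) * m₂ * Z + ca * m₂ * Z + (t.cost + pw.bound + 60) * Z + (k₀ + Cp + ca) * Z +
      (t.cost + pw.bound + 60) * m₂ * Z := by ring
    rw [h6]
    linarith

end RealRAM

/-! ### Rounding followed by search -/

namespace RealRAM

open EuclideanMST

/-- Round the points of generation `reg 3` to the grid of mesh `reg 11` and search the grid. -/
def comp (d : ℕ) : Program := .seq (snap d) (bfs d)

theorem not_writes_comp {d x : ℕ} (hx : x < 15 ∨ 30 < x ∧ x < 100) : ¬ (comp d).Writes x := by
  simp only [comp, snap, snapBody, cellCode, storeCode, bfs, process, visit, decode, advance,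
    writes_block, writes_unroll, Program.Writes, List.mem_cons, List.not_mem_nil, or_false,
    exists_eq_or_imp, exists_eq_left, X, Y, false_or]
  simp only [not_or, not_exists, not_and]
  repeat' (first | omega | refine And.intro ?_ ?_)

/-- The result of `comp`. -/
structure Rounded {d m m₂ : ℕ} (s s' : State) (G S : ℕ) (δ τ a b : ℝ) (z : Fin m₂ → Fin d → ℤ)
    (f : Fin m → Fin m₂) : Prop where
  inj : Function.Injective z
  surj : Function.Surjective f
  points : ∀ v : Fin m₂, pt d s' S v = toPts z v
  cell_eq : ∀ i : Fin m, z (f i) = cell δ τ (pt d s G i)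
  r15 : s'.reg 15 = m₂
  r16 : s'.reg 16 = clusters (toPts z) a
  id : ∀ i : Fin m, s'.mem 3 [(S : ℤ), ((i : ℕ) : ℤ)] = (f i : ℕ)
  flag : ∀ v : Fin m₂, s'.mem 4 [(S : ℤ), ((v : ℕ) : ℤ)] ≠ 0 ↔
    (∃ i i', i ≠ i' ∧ f i = v ∧ f i' = v) ∨ ∃ v', v' ≠ v ∧ CellNear z b v v'
  agree : AgreeOff S s s'

/-- The error is a difference of two fractional parts, and the shift `τ` cancels. -/
theorem Rounded.snapped {d m m₂ : ℕ} {s s' : State} {G S : ℕ} {δ τ a b : ℝ}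
    {z : Fin m₂ → Fin d → ℤ} {f : Fin m → Fin m₂} (h : Rounded s s' G S δ τ a b z f) (hδ : 0 < δ) :
    Snapped (fun i : Fin m => pt d s G i) (toPts z) f δ where
  pos := hδ
  surj := h.surj
  close := by
    intro i i' j
    simp only [toPts, h.cell_eq, cell, sub_div]
    set u := pt d s G i j / δ + τ with hu
    set u' := pt d s G i' j / δ + τ with hu'
    have h1 := Int.floor_le u
    have h2 := Int.lt_floor_add_one u
    have h3 := Int.floor_le u'
    have h4 := Int.lt_floor_add_one u'
    rw [abs_le]
    constructor <;> linarith

theorem AgreeOff.trans {S : ℕ} {s s' s'' : State} (h : AgreeOff S s s') (h' : AgreeOff S s' s'') :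
    AgreeOff S s s'' := fun a g key hg => (h' a g key hg).trans (h a g key hg)

theorem comp_spec (d : ℕ) : ∃ C : ℝ, 0 ≤ C ∧ ∀ {s : State} {G S m : ℕ} {δ τ a b : ℝ},
    G ≠ S → s.reg 3 = G → s.reg 4 = m → s.reg 7 = S → s.reg 11 = δ → s.reg 12 = τ →
    s.reg 13 = a → s.reg 14 = b → 0 ≤ a → a ≤ b → Fresh s S →
    Tri (comp d) s (C * (m + 1) * (2 * b + 1) ^ d) fun s' =>
      (∀ x, x < 15 ∨ 30 < x ∧ x < 100 → s'.reg x = s.reg x) ∧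
      ∃ (m₂ : ℕ) (z : Fin m₂ → Fin d → ℤ) (f : Fin m → Fin m₂), Rounded s s' G S δ τ a b z f := by
  obtain ⟨C₁, hC₁, h₁⟩ := snap_spec d
  obtain ⟨C₂, hC₂, h₂⟩ := bfs_spec d
  refine ⟨1 + C₁ + C₂, by positivity, ?_⟩
  intro s G S m δ τ a b hGS h3 h4 h7 h11 h12 h13 h14 ha hab hf
  have hone : (1 : ℝ) ≤ (2 * b + 1) ^ d := one_le_pow₀ (by linarith)
  refine (Tri.seq (h₁ s G S m hGS h3 h4 h7 hf) (B' := C₂ * (m + 1) * (2 * b + 1) ^ d)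
    (Q' := fun s' => ∃ (m₂ : ℕ) (z : Fin m₂ → Fin d → ℤ) (f : Fin m → Fin m₂),
      Rounded s s' G S δ τ a b z f) ?_).mono ?_ ?_
  · rintro s₁ hw ⟨m₂, z, f, h15, hg⟩
    have hfr : ∀ x ∈ [7, 13, 14], s₁.reg x = s.reg x := by
      intro x hx
      apply hw
      simp only [List.mem_cons, List.not_mem_nil, or_false] at hx
      rcases hx with rfl | rfl | rfl <;>
      simp [snap, snapBody, writes_block, writes_unroll, Program.Writes, cellCode, storeCode]
    set z' : Fin m₂ → Fin d → ℤ := fun v => z v with hz'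
    set f' : Fin m → Fin m₂ := fun i => ⟨f i, hg.lt i i.2⟩ with hf'
    have hsurj : Function.Surjective f' := by
      intro v
      obtain ⟨l, hl, hlv⟩ := hg.surj v v.2
      exact ⟨⟨l, hl⟩, Fin.ext hlv⟩
    have hm : m₂ ≤ m := by simpa using Fintype.card_le_of_surjective f' hsurj
    have hc : Cells s₁ S z' := by
      refine ⟨fun u v huv => Fin.ext (hg.inj u u.2 v v.2 huv), fun v j => hg.points v v.2 j,
        fun v => hg.hash v v.2, fun c hcv => hg.hash_zero c fun a ha => hcv ⟨a, ha⟩⟩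
    refine (h₂ hc ((hfr 7 (by simp)).trans h7) ((hfr 13 (by simp)).trans h13)
      ((hfr 14 (by simp)).trans h14) h15 ha hab hg.rest).mono ?_ ?_
    · gcongr
    · rintro s₂ hw₂ ⟨g16, g4, go, gag⟩
      refine ⟨m₂, z', f', hc.inj, hsurj, ?_, ?_, ?_, g16, ?_, ?_, hg.agree.trans gag⟩
      · intro v
        simp only [pt, toPts]
        congr 1
        funext j
        rw [go 1 (by simp) (by simp) (by simp), hc.points]
      · intro i
        rw [hz', ← h11, ← h12]
        exact hg.cell_eq i i.2
      · rw [hw₂ 15, h15]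
        simp [bfs, process, visit, decode, advance, writes_block, writes_unroll, Program.Writes]
      · intro i
        rw [go 3 (by simp) (by simp) (by simp)]
        exact hg.id i i.2
      · intro v
        rw [g4, hg.flag v v.2]
        refine or_congr_left ?_
        constructor
        · rintro ⟨l, hl, l', hl', hne, h1, h2⟩
          exact ⟨⟨l, hl⟩, ⟨l', hl'⟩, by simpa [Fin.ext_iff] using hne, Fin.ext h1, Fin.ext h2⟩
        · rintro ⟨l, l', hne, h1, h2⟩
          exact ⟨l, l.2, l', l'.2, by simpa [Fin.ext_iff] using hne, congrArg Fin.val h1,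
            congrArg Fin.val h2⟩
  · have hm0 : (0 : ℝ) ≤ m := Nat.cast_nonneg m
    have h1 : 1 + C₁ * (m + 1) ≤ (1 + C₁) * (m + 1) * (2 * b + 1) ^ d := by
      have : 1 + C₁ * (m + 1) ≤ (1 + C₁) * (m + 1) := by nlinarith
      exact this.trans (le_mul_of_one_le_right (by positivity) hone)
    linarith
  · exact fun s' hw hs' => ⟨fun x hx => hw x (not_writes_comp hx), hs'⟩

end RealRAM

/-! ### Copying the points in flagged cells -/

namespace RealRAM

open EuclideanMST

/-- Copy the point at the address `ks` of the array `src` to the point `reg y` of generation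
`reg x`. -/
def copyCode (d src : ℕ) (ks : List ℕ) (x y : ℕ) : Program :=
  unroll d fun j => block [.assign 29 (lit j), .load 27 src (ks ++ [29]), .store 1 [x, y, 29] 27]

theorem flat_copyCode (d src : ℕ) (ks : List ℕ) (x y : ℕ) : (copyCode d src ks x y).Flat :=
  flat_unroll fun j => by simp [flat_block, Program.Flat]

theorem key_append (s : State) (js ks : List ℕ) : s.key (js ++ ks) = s.key js ++ s.key ks := by
  simp [State.key]

theorem key_congr {s s' : State} {js : List ℕ} (h : ∀ j ∈ js, s'.reg j = s.reg j) :
    s'.key js = s.key js := by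
  simp only [State.key]
  exact List.map_congr_left fun j hj => by rw [h j hj]

/-- Source and target may lie in the same array; `hsrc` ensures that no coordinate is overwritten
before it is read. -/
theorem sem_copyCode {d src : ℕ} {ks : List ℕ} {s : State} {x y g i : ℕ} (hx : s.reg x = g)
    (hy : s.reg y = i) (hx' : x ≠ 27 ∧ x ≠ 29) (hy' : y ≠ 27 ∧ y ≠ 29)
    (hks : ∀ k ∈ ks, k ≠ 27 ∧ k ≠ 29) (hsrc : src = 1 → s.key ks ≠ [(g : ℤ), (i : ℤ)]) :
    (∀ j : Fin d, ((copyCode d src ks x y).sem s).mem 1 [(g : ℤ), (i : ℤ), ((j : ℕ) : ℤ)] =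
      s.mem src (s.key ks ++ [((j : ℕ) : ℤ)])) ∧
    (∀ a key, (a = 1 → ∀ j : ℤ, key ≠ [(g : ℤ), (i : ℤ), j]) →
      ((copyCode d src ks x y).sem s).mem a key = s.mem a key) ∧
    (∀ x', x' ≠ 27 → x' ≠ 29 → ((copyCode d src ks x y).sem s).reg x' = s.reg x') := by
  suffices H : ∀ n, (∀ j < n, ((copyCode n src ks x y).sem s).mem 1 [(g : ℤ), (i : ℤ), (j : ℤ)] =
      s.mem src (s.key ks ++ [(j : ℤ)])) ∧
      (∀ a key, (a = 1 → ∀ j : ℤ, key ≠ [(g : ℤ), (i : ℤ), j]) →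
      ((copyCode n src ks x y).sem s).mem a key = s.mem a key) ∧
    (∀ x', x' ≠ 27 → x' ≠ 29 → ((copyCode n src ks x y).sem s).reg x' = s.reg x') by
    exact ⟨fun j => (H d).1 j j.2, (H d).2⟩
  intro n
  induction n with
  | zero => simp [copyCode, sem_unroll_zero]
  | succ n ih =>
    obtain ⟨ih1, ih2, ih3⟩ := ih
    simp only [copyCode, sem_unroll_succ] at *
    set s1 := Program.sem (unroll n _) s
    have hk : ∀ v, (s1.setReg 29 v).key ks = s.key ks := fun v => key_congr fun k hk => by
      simp [hks k hk, ih3 k (hks k hk).1 (hks k hk).2]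
    have hread : s1.mem src (s.key ks ++ [(n : ℤ)]) = s.mem src (s.key ks ++ [(n : ℤ)]) := by
      refine ih2 _ _ fun h j hj => hsrc h ?_
      have : s.key ks ++ [(n : ℤ)] = [(g : ℤ), (i : ℤ)] ++ [j] := hj
      exact (List.append_inj' this rfl).1
    simp only [sem_block_cons, sem_block_nil, Program.sem, Expr.eval, key_append, hk]
    refine ⟨?_, ?_, ?_⟩
    · intro j hj
      rcases Nat.lt_succ_iff_lt_or_eq.1 hj with hj | rfl
      · simp [hj.ne, ih1 j hj, ih3 _ hx'.1 hx'.2, ih3 _ hy'.1 hy'.2, hx, hy, hx', hy']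
      · simp [ih3 _ hx'.1 hx'.2, ih3 _ hy'.1 hy'.2, hx, hy, hx', hy', hread]
    · intro a key hk'
      rw [← ih2 a key hk']
      simp only [State.mem_setMem, State.mem_setReg]
      rw [if_neg]
      rintro ⟨ha, hkey⟩
      refine hk' ha n ?_
      rw [hkey]
      simp [ih3 _ hx'.1 hx'.2, ih3 _ hy'.1 hy'.2, hx, hy, hx', hy']
    · intro x' h1 h2
      simp [h1, h2, ih3 x' h1 h2]

/-- Copy the point `reg 17` of generation `reg 3` if its cell is flagged. -/
def pruneBody (d : ℕ) : Program :=
  block [.load 18 3 [7, 17], .load 18 4 [7, 18], .ite (.ne (.reg 18) (lit 0))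
    (block [copyCode d 1 [3, 17] 37 38, .assign 38 (.add (.reg 38) (lit 1))]) .skip,
    .assign 17 (.add (.reg 17) (lit 1))]

theorem flat_pruneBody (d : ℕ) : (pruneBody d).Flat := by
  simp [pruneBody, flat_block, Program.Flat, flat_copyCode]

theorem sem_pruneBody {d : ℕ} {s : State} {G S G' i u m' : ℕ} (h3 : s.reg 3 = G)
    (h7 : s.reg 7 = S) (h17 : s.reg 17 = i) (h37 : s.reg 37 = G') (h38 : s.reg 38 = m')
    (hG : G ≠ G') (hid : s.mem 3 [(S : ℤ), (i : ℤ)] = u) :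
    ((pruneBody d).sem s).reg 17 = (i + 1 : ℕ) ∧
    (s.mem 4 [(S : ℤ), (u : ℤ)] = 0 → ((pruneBody d).sem s).mem = s.mem ∧
      ((pruneBody d).sem s).reg 38 = m') ∧
    (s.mem 4 [(S : ℤ), (u : ℤ)] ≠ 0 → ((pruneBody d).sem s).reg 38 = (m' + 1 : ℕ) ∧
      pt d ((pruneBody d).sem s) G' m' = pt d s G i ∧
      ∀ a key, (a = 1 → ∀ j : ℤ, key ≠ [(G' : ℤ), (m' : ℤ), j]) →
        ((pruneBody d).sem s).mem a key = s.mem a key) := by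
  set s1 := (s.setReg 18 u).setReg 18 (s.mem 4 [(S : ℤ), (u : ℤ)]) with hs1
  obtain ⟨c1, c2, c3⟩ := sem_copyCode (d := d) (src := 1) (ks := [3, 17]) (s := s1) (x := 37)
    (y := 38) (g := G') (i := m') (by simp [hs1, h37]) (by simp [hs1, h38]) (by simp) (by simp)
    (by simp) (by simp [hs1, h3, h17, hG])
  by_cases h0 : s.mem 4 [(S : ℤ), (u : ℤ)] = 0
  · have hb : (pruneBody d).sem s = s1.setReg 17 (i + 1) := by
      simp only [pruneBody, sem_block_cons, sem_block_nil, Program.sem]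
      simp [h7, h17, hid, Test.holds_ne, Expr.eval, h0, hs1]
    rw [hb]
    simp [h0, hs1, h38]
  · have hb : (pruneBody d).sem s = (((copyCode d 1 [3, 17] 37 38).sem s1).setReg 38
        (m' + 1)).setReg 17 (i + 1) := by
      simp only [pruneBody, sem_block_cons, sem_block_nil, Program.sem]
      simp only [key_cons, key_nil, State.reg_setReg, h7, h17, hid, Int.floor_natCast,
        Test.holds_ne, Expr.eval, State.mem_setReg, if_true, if_neg (show ¬ (7 = 18) by norm_num)]
      rw [← hs1, if_pos (by simpa using h0)]
      generalize (copyCode d 1 [3, 17] 37 38).sem s1 = s2 at c3 ⊢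
      simp [c3, hs1, h38, h17]
    rw [hb]
    generalize (copyCode d 1 [3, 17] 37 38).sem s1 = s2 at c1 c2 c3 ⊢
    refine ⟨by simp, fun h => absurd h h0, fun _ => ⟨by simp, ?_, ?_⟩⟩
    · simp only [pt]
      congr 1
      funext j
      simp [c1, hs1, h3, h17]
    · intro a key hk
      simp [c2 a key hk, hs1]

/-- Keep only the points in flagged cells. -/
def prune (d : ℕ) : Program :=
  block [.assign 37 (.add (.reg 7) (lit 1)), .assign 38 (lit 0), .assign 17 (lit 0),
    .loop (.lt (.reg 17) (.reg 4)) (pruneBody d),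
    -- The number of clusters is lowered by the number of removed points. The new generation
    -- occupies stamp `reg 7 + 1`, so the next free one is one further.
    .assign 5 (.sub (.reg 5) (.sub (.reg 4) (.reg 38))), .assign 4 (.reg 38), .assign 3 (.reg 37),
    .assign 7 (.add (.reg 37) (lit 1))]

/-- The first `m'` points of generation `G'` are the flagged ones among the first `i` points of
generation `G`. -/
structure Pruned {d m : ℕ} (s s' : State) (G G' i m' : ℕ) (keep : Fin m → Prop)
    (e : Fin m' → Fin m) : Prop where
  inj : Function.Injective e
  mem : ∀ l, l ∈ Set.range e ↔ (l : ℕ) < i ∧ keep l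
  points : ∀ v : Fin m', pt d s' G' v = pt d s G (e v)
  agree : AgreeOff G' s s'

theorem prune_spec (d : ℕ) : ∃ C : ℝ, 0 ≤ C ∧ ∀ {s : State} {G S m kk : ℕ} {id : Fin m → ℕ},
    G ≠ S + 1 → s.reg 3 = G → s.reg 4 = m → s.reg 5 = kk → s.reg 7 = S →
    (∀ l : Fin m, s.mem 3 [(S : ℤ), ((l : ℕ) : ℤ)] = id l) →
    Tri (prune d) s (C * (m + 1)) fun s' =>
      ∃ (m' : ℕ) (e : Fin m' → Fin m), s'.reg 3 = (S + 1 : ℕ) ∧ s'.reg 4 = m' ∧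
        s'.reg 5 = kk - (m - m') ∧ s'.reg 7 = (S + 2 : ℕ) ∧
        Pruned (d := d) s s' G (S + 1) m m' (fun l => s.mem 4 [(S : ℤ), (id l : ℤ)] ≠ 0) e := by
  set t : Test := .lt (.reg 17) (.reg 4) with ht
  set b : ℝ := t.cost + 1 + (pruneBody d).bound with hb
  have hb0 : 0 ≤ b := by positivity
  refine ⟨b + (t.cost + 40), by positivity, ?_⟩
  intro s G S m kk id hG h3 h4 h5 h7 hid
  have hw : ∀ x ∈ [3, 4, 5, 7, 37], ¬ (pruneBody d).Writes x := by
    intro x hx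
    simp only [List.mem_cons, List.not_mem_nil, or_false] at hx
    rcases hx with rfl | rfl | rfl | rfl | rfl <;>
    simp [pruneBody, writes_block, writes_unroll, Program.Writes, copyCode]
  set keep : Fin m → Prop := fun l => s.mem 4 [(S : ℤ), (id l : ℤ)] ≠ 0 with hkeep
  have hloop : ∀ s₁ : State, (∀ x ∈ [3, 4, 5, 7], s₁.reg x = s.reg x) → s₁.mem = s.mem →
      s₁.reg 37 = (S + 1 : ℕ) → s₁.reg 38 = 0 → s₁.reg 17 = 0 →
      Tri (.loop t (pruneBody d)) s₁ (t.cost + 1 + b * m) fun s' =>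
        (∀ x ∈ [3, 4, 5, 7, 37], s'.reg x = s₁.reg x) ∧ ∃ (m' : ℕ) (e : Fin m' → Fin m),
          s'.reg 38 = m' ∧ Pruned (d := d) s s' G (S + 1) m m' keep e := by
    intro s₁ hr hmem h37 h38 h17
    have := Tri.loop (t := t) (P := pruneBody d)
      (fun s' => (∀ x ∈ [3, 4, 5, 7, 37], s'.reg x = s₁.reg x) ∧
        ∃ (i m' : ℕ) (e : Fin m' → Fin m), i ≤ m ∧ s'.reg 17 = i ∧ s'.reg 38 = m' ∧
          Pruned (d := d) s s' G (S + 1) i m' keep e)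
      (fun s' => b * (m - s'.reg 17)) ?_ ?_ (s := s₁) ?_
    · refine this.mono (by simp [h17]) ?_
      rintro s' - ⟨⟨hr', i, m', e, hi, h17', h38', hp⟩, hn⟩
      rw [ht, Test.holds_lt] at hn
      simp only [Expr.eval, h17', hr' 4 (by simp), hr 4 (by simp), h4, Nat.cast_lt, not_lt] at hn
      obtain rfl := le_antisymm hi hn
      exact ⟨hr', m', e, h38', hp⟩
    · rintro s' ⟨hr', i, m', e, hi, h17', -⟩
      rw [h17']
      have : (i : ℝ) ≤ m := by exact_mod_cast hi
      exact mul_nonneg hb0 (by linarith)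
    · rintro s' ⟨hr', i, m', e, hi, h17', h38', hp⟩ hh
      rw [ht, Test.holds_lt] at hh
      simp only [Expr.eval, h17', hr' 4 (by simp), hr 4 (by simp), h4, Nat.cast_lt] at hh
      refine ⟨_, Tri.of_flat (flat_pruneBody d) ?_⟩
      obtain ⟨e17, e0, e1⟩ := sem_pruneBody (d := d) (u := id ⟨i, hh⟩)
        ((hr' 3 (by simp)).trans ((hr 3 (by simp)).trans h3))
        ((hr' 7 (by simp)).trans ((hr 7 (by simp)).trans h7)) h17'
        ((hr' 37 (by simp)).trans h37) h38' hG
        ((hp.agree _ _ _ (by omega)).trans (hid ⟨i, hh⟩))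
      have hfr : ∀ x ∈ [3, 4, 5, 7, 37], ((pruneBody d).sem s').reg x = s₁.reg x := fun x hx => by
        rw [(flat_pruneBody d).reg_eq s' (hw x hx), hr' x hx]
      have h4S : s'.mem 4 [(S : ℤ), (id ⟨i, hh⟩ : ℤ)] = s.mem 4 [(S : ℤ), (id ⟨i, hh⟩ : ℤ)] :=
        hp.agree _ _ _ (by omega)
      rw [h4S] at e0 e1
      have hcost : t.cost + 1 + ((pruneBody d).bound : ℝ) +
          b * (m - ((pruneBody d).sem s').reg 17) ≤ b * (m - s'.reg 17) := by
        rw [e17, h17']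
        push_cast
        rw [hb]
        linarith
      by_cases hk : keep ⟨i, hh⟩
      · obtain ⟨e38, ept, eo⟩ := e1 hk
        have hag : AgreeOff (S + 1) s' ((pruneBody d).sem s') := fun a g key hg =>
          eo a _ fun _ j hj => hg (by exact_mod_cast (List.cons.inj hj).1)
        refine ⟨⟨hfr, i + 1, m' + 1, Fin.snoc (α := fun _ => Fin m) e ⟨i, hh⟩, hh, e17, e38,
          ?_, ?_, ?_, hp.agree.trans hag⟩, hcost⟩
        · rw [Fin.snoc_injective_iff]
          refine ⟨hp.inj, fun hi => ?_⟩
          have := ((hp.mem _).1 hi).1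
          simp at this
        · intro l
          rw [Fin.range_snoc, Set.mem_insert_iff, hp.mem, Nat.lt_succ_iff_lt_or_eq, Fin.ext_iff]
          constructor
          · rintro (h | h)
            · exact ⟨.inr h, by rwa [show l = ⟨i, hh⟩ from Fin.ext h]⟩
            · exact ⟨.inl h.1, h.2⟩
          · rintro ⟨h | h, h'⟩
            · exact .inr ⟨h, h'⟩
            · exact .inl h
        · intro v
          induction v using Fin.lastCases with
          | last =>
            simp only [Fin.val_last, Fin.snoc_last, ept]
            exact hp.agree.pt_eq hG
          | cast v =>
            rw [Fin.snoc_castSucc, ← hp.points]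
            simp only [pt]
            congr 1
            funext j
            exact eo 1 _ fun _ j' hj' => by
              simp only [Fin.val_castSucc, List.cons.injEq, Nat.cast_inj] at hj'
              omega
      · obtain ⟨em, e38⟩ := e0 (not_not.1 hk)
        refine ⟨⟨hfr, i + 1, m', e, hh, e17, e38, hp.inj, ?_, ?_, ?_⟩, hcost⟩
        · intro l
          rw [hp.mem, Nat.lt_succ_iff_lt_or_eq]
          refine and_congr_left fun hl => ⟨.inl, fun h => h.resolve_right fun h => hk ?_⟩
          rwa [← show l = ⟨i, hh⟩ from Fin.ext h]
        · intro v
          rw [← hp.points]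
          simp only [pt, em]
        · intro a g key hg
          rw [em]
          exact hp.agree a g key hg
    · refine ⟨fun _ _ => rfl, 0, 0, Fin.elim0, Nat.zero_le _, by simpa using h17,
        by simpa using h38, fun v => v.elim0, by simp, fun v => v.elim0,
        fun a g key _ => by rw [hmem]⟩
  refine (Tri.seq (Tri.of_flat (P := .assign 37 (.add (.reg 7) (lit 1))) trivial (Q := fun s' =>
      s' = s.setReg 37 (S + 1 : ℕ)) (by simp [Program.sem, Expr.eval, h7])) fun s₁ _ hs₁ =>
    Tri.seq (Tri.of_flat (P := .assign 38 (lit 0)) trivial (Q := fun s' =>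
      s' = s₁.setReg 38 0) (by simp [Program.sem, Expr.eval])) fun s₂ _ hs₂ =>
    Tri.seq (Tri.of_flat (P := .assign 17 (lit 0)) trivial (Q := fun s' =>
      s' = s₂.setReg 17 0) (by simp [Program.sem, Expr.eval])) fun s₃ _ hs₃ =>
    Tri.seq (hloop s₃ ?_ ?_ ?_ ?_ ?_) fun s₄ _ hs₄ =>
      Tri.of_flat (P := block [_, _, _, _]) ?_ ?_).mono ?_ fun _ _ h => h
  · subst hs₃ hs₂ hs₁; simp
  · subst hs₃ hs₂ hs₁; simp
  · subst hs₃ hs₂ hs₁; simp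
  · subst hs₃ hs₂ hs₁; simp
  · subst hs₃ hs₂ hs₁; simp
  · simp [flat_block, Program.Flat]
  · obtain ⟨hr, m', e, h38, hp⟩ := hs₄
    have f5 : s₄.reg 5 = kk := by rw [hr 5 (by simp)]; subst hs₃ hs₂ hs₁; simp [h5]
    have f4 : s₄.reg 4 = m := by rw [hr 4 (by simp)]; subst hs₃ hs₂ hs₁; simp [h4]
    have f37 : s₄.reg 37 = (S + 1 : ℕ) := by
      rw [hr 37 (by simp)]; subst hs₃ hs₂ hs₁; simp
    refine ⟨m', e, ?_, ?_, ?_, ?_, hp.inj, hp.mem, hp.points, hp.agree⟩ <;>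
    simp [sem_block_cons, sem_block_nil, Program.sem, Expr.eval, f5, f4, f37, h38]
    ring
  · simp only [Program.bound, block, Expr.cost]
    push_cast
    have : (0 : ℝ) ≤ m := Nat.cast_nonneg m
    have : (0 : ℝ) ≤ t.cost := Nat.cast_nonneg _
    nlinarith

end RealRAM

/-! ### Distance to the nearest neighbour -/

namespace RealRAM

open EuclideanMST

/-- Squared distance of the points `reg 31` and `reg 17` of generation `reg 3`. -/
def sqDistCode (d : ℕ) : Program :=
  .seq (.assign 26 (lit 0)) (unroll d fun j => block [.assign 29 (lit j), .load 25 1 [3, 31, 29],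
    .load 27 1 [3, 17, 29], .assign 26 (.add (.reg 26)
      (.mul (.sub (.reg 25) (.reg 27)) (.sub (.reg 25) (.reg 27))))])

theorem flat_sqDistCode (d : ℕ) : (sqDistCode d).Flat :=
  ⟨trivial, flat_unroll fun j => by simp [flat_block, Program.Flat]⟩

theorem sem_sqDistCode {d : ℕ} {s : State} {G i j : ℕ} (h3 : s.reg 3 = G) (h31 : s.reg 31 = i)
    (h17 : s.reg 17 = j) :
    ((sqDistCode d).sem s).reg 26 = dist (pt d s G i) (pt d s G j) ^ 2 ∧
    ((sqDistCode d).sem s).mem = s.mem ∧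
    (∀ x, x < 25 ∨ 29 < x → ((sqDistCode d).sem s).reg x = s.reg x) := by
  rw [EuclideanSpace.dist_sq_eq]
  simp only [pt, Real.dist_eq, sq_abs]
  rw [Fin.sum_univ_eq_sum_range (fun l : ℕ => (s.mem 1 [(G : ℤ), (i : ℤ), (l : ℤ)] -
    s.mem 1 [(G : ℤ), (j : ℤ), (l : ℤ)]) ^ 2) d]
  induction d with
  | zero =>
    simp only [sqDistCode, Program.sem, sem_unroll_zero, Expr.eval]
    refine ⟨by simp, rfl, fun x hx => ?_⟩
    rw [State.reg_setReg, if_neg (by omega)]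
  | succ n ih =>
    obtain ⟨ih1, ih2, ih3⟩ := ih
    have e3 := (ih3 3 (by simp)).trans h3
    have e31 := (ih3 31 (by simp)).trans h31
    have e17 := (ih3 17 (by simp)).trans h17
    simp only [sqDistCode, Program.sem, sem_unroll_succ] at *
    generalize Program.sem (unroll n _) _ = s1 at *
    simp only [sem_block_cons, sem_block_nil, Program.sem, Expr.eval, Finset.sum_range_succ]
    refine ⟨?_, ?_, ?_⟩
    · simp [e3, e31, e17, ih1, ih2, sq]
    · simp [ih2]
    · intro x hx
      rw [← ih3 x hx]
      simp only [State.reg_setReg]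
      rw [if_neg (by omega), if_neg (by omega), if_neg (by omega), if_neg (by omega)]

/-- Update the smallest squared distance found so far. -/
def nnBody (d : ℕ) : Program :=
  block [.ite (.ne (.reg 17) (.reg 31)) (block [sqDistCode d,
    -- Content `0` means that no distance has been seen yet; for distinct points it cannot be
    -- confused with a distance.
    .ite (.and (.lt (lit 0) (.reg 33)) (.le (.reg 33) (.reg 26))) .skip (.assign 33 (.reg 26))])
    .skip, .assign 17 (.add (.reg 17) (lit 1))]

/-- Distance of the point `reg 31` of generation `reg 3` to its nearest neighbour. -/
def nn (d : ℕ) : Program :=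
  block [.assign 33 (lit 0), .assign 17 (lit 0), .loop (.lt (.reg 17) (.reg 4)) (nnBody d),
    .assign 33 (.sqrt (.reg 33))]

theorem flat_nnBody (d : ℕ) : (nnBody d).Flat := by
  simp [nnBody, flat_block, Program.Flat, flat_sqDistCode]

theorem sem_nnBody {d : ℕ} {s : State} {G i j : ℕ} (h3 : s.reg 3 = G) (h31 : s.reg 31 = i)
    (h17 : s.reg 17 = j) :
    ((nnBody d).sem s).reg 17 = (j + 1 : ℕ) ∧ ((nnBody d).sem s).mem = s.mem ∧
    (j = i → ((nnBody d).sem s).reg 33 = s.reg 33) ∧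
    (j ≠ i → ((nnBody d).sem s).reg 33 =
      if 0 < s.reg 33 ∧ s.reg 33 ≤ dist (pt d s G i) (pt d s G j) ^ 2 then s.reg 33
      else dist (pt d s G i) (pt d s G j) ^ 2) := by
  obtain ⟨c1, c2, c3⟩ := sem_sqDistCode (d := d) h3 h31 h17
  by_cases hij : j = i
  · have hb : (nnBody d).sem s = s.setReg 17 (j + 1) := by
      simp only [nnBody, sem_block_cons, sem_block_nil, Program.sem, Test.holds_ne, Expr.eval, h17,
        h31, hij]
      simp [h17, hij]
    rw [hb]
    simp [hij]
  · simp only [nnBody, sem_block_cons, sem_block_nil, Program.sem, Test.holds_ne, Expr.eval, h17,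
      h31, ne_eq, Nat.cast_inj, hij, not_false_eq_true, if_true, Test.holds_and, Test.holds_lt,
      Test.holds_le]
    generalize (sqDistCode d).sem s = s1 at c1 c2 c3 ⊢
    have e33 := c3 33 (by simp)
    have e17 := (c3 17 (by simp)).trans h17
    simp only [e33, c1, Rat.cast_zero, Rat.cast_one]
    split_ifs <;> simp_all

theorem nn_spec (d : ℕ) : ∃ C : ℝ, 0 ≤ C ∧ ∀ {s : State} {G m : ℕ} {i : Fin m},
    s.reg 3 = G → s.reg 4 = m → s.reg 31 = (i : ℕ) → 1 < m →
    Function.Injective (fun j : Fin m => pt d s G j) →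
    Tri (nn d) s (C * (m + 1)) fun s' =>
      s'.mem = s.mem ∧ IsNearest (fun j : Fin m => pt d s G j) i (s'.reg 33) := by
  set t : Test := .lt (.reg 17) (.reg 4) with ht
  set b : ℝ := t.cost + 1 + (nnBody d).bound with hb
  have hb0 : 0 ≤ b := by positivity
  refine ⟨b + (t.cost + 20), by positivity, ?_⟩
  intro s G m i h3 h4 h31 hm hinj
  have hpos : ∀ j : Fin m, j ≠ i → 0 < dist (pt d s G i) (pt d s G j) := fun j hj =>
    dist_pos.2 fun h => hj (hinj h).symm
  have hw : ∀ x ∈ [3, 4, 31], ¬ (nnBody d).Writes x := by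
    intro x hx
    simp only [List.mem_cons, List.not_mem_nil, or_false] at hx
    rcases hx with rfl | rfl | rfl <;>
    simp [nnBody, writes_block, writes_unroll, Program.Writes, sqDistCode]
  have hloop : ∀ s₁ : State, (∀ x ∈ [3, 4, 31], s₁.reg x = s.reg x) → s₁.mem = s.mem →
      s₁.reg 33 = 0 → s₁.reg 17 = 0 →
      Tri (.loop t (nnBody d)) s₁ (t.cost + 1 + b * m) fun s' => s'.mem = s.mem ∧ 0 < s'.reg 33 ∧
        (∃ j : Fin m, j ≠ i ∧ dist (pt d s G i) (pt d s G j) ^ 2 = s'.reg 33) ∧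
        ∀ j : Fin m, j ≠ i → s'.reg 33 ≤ dist (pt d s G i) (pt d s G j) ^ 2 := by
    intro s₁ hr hmem h33 h17
    have := Tri.loop (t := t) (P := nnBody d)
      (fun s' => (∀ x ∈ [3, 4, 31], s'.reg x = s.reg x) ∧ s'.mem = s.mem ∧
        ∃ l : ℕ, l ≤ m ∧ s'.reg 17 = l ∧
          (s'.reg 33 = 0 ∧ (∀ j : Fin m, (j : ℕ) < l → j = i) ∨ 0 < s'.reg 33 ∧
          (∃ j : Fin m, j ≠ i ∧ dist (pt d s G i) (pt d s G j) ^ 2 = s'.reg 33) ∧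
          ∀ j : Fin m, (j : ℕ) < l → j ≠ i → s'.reg 33 ≤ dist (pt d s G i) (pt d s G j) ^ 2))
      (fun s' => b * (m - s'.reg 17)) ?_ ?_ (s := s₁) ?_
    · refine this.mono (by simp [h17]) ?_
      rintro s' - ⟨⟨hr', hm', l, hl, h17', hI⟩, hn⟩
      rw [ht, Test.holds_lt] at hn
      simp only [Expr.eval, h17', hr' 4 (by simp), h4, Nat.cast_lt, not_lt] at hn
      refine ⟨hm', ?_⟩
      rcases hI with ⟨-, h⟩ | ⟨h1, h2, h3⟩
      · have h0 := h ⟨0, by omega⟩ (by simp only; omega)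
        have h1 := h ⟨1, by omega⟩ (by simp only; omega)
        have := h0.trans h1.symm
        simp at this
      · exact ⟨h1, h2, fun j => h3 j (lt_of_lt_of_le j.2 hn)⟩
    · rintro s' ⟨-, -, l, hl, h17', -⟩
      rw [h17']
      have : (l : ℝ) ≤ m := by exact_mod_cast hl
      exact mul_nonneg hb0 (by linarith)
    · rintro s' ⟨hr', hm', l, hl, h17', hI⟩ hh
      rw [ht, Test.holds_lt] at hh
      simp only [Expr.eval, h17', hr' 4 (by simp), h4, Nat.cast_lt] at hh
      refine ⟨_, Tri.of_flat (flat_nnBody d) ?_⟩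
      obtain ⟨e17, em, e0, e1⟩ := sem_nnBody (d := d) ((hr' 3 (by simp)).trans h3)
        ((hr' 31 (by simp)).trans h31) h17'
      have hpt : ∀ j, pt d s' G j = pt d s G j := fun j => by simp only [pt, hm']
      rw [hpt, hpt] at e1
      refine ⟨⟨fun x hx => ?_, em.trans hm', l + 1, hh, e17, ?_⟩, ?_⟩
      · rw [(flat_nnBody d).reg_eq s' (hw x hx), hr' x hx]
      · have hcase : ∀ j : Fin m, (j : ℕ) < l + 1 → (j : ℕ) < l ∨ j = ⟨l, hh⟩ := fun j hj =>
          (Nat.lt_succ_iff_lt_or_eq.1 hj).imp id fun h => Fin.ext h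
        by_cases hli : l = i
        · rw [e0 hli]
          have hcase' : ∀ j : Fin m, (j : ℕ) < l + 1 → j ≠ i → (j : ℕ) < l := fun j hj hne =>
            (hcase j hj).resolve_right fun h => hne (h.trans (Fin.ext hli))
          rcases hI with ⟨h1, h2⟩ | ⟨h1, h2, h3⟩
          · exact .inl ⟨h1, fun j hj => by_contra fun hne => hne (h2 j (hcase' j hj hne))⟩
          · exact .inr ⟨h1, h2, fun j hj hne => h3 j (hcase' j hj hne) hne⟩
        · rw [e1 hli]
          have hne : (⟨l, hh⟩ : Fin m) ≠ i := fun h => hli (congrArg Fin.val h)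
          have hp := hpos _ hne
          right
          split_ifs with hc
          · rcases hI with ⟨h1, -⟩ | ⟨h1, h2, h3⟩
            · exact absurd h1 hc.1.ne'
            · refine ⟨h1, h2, fun j hj hji => ?_⟩
              rcases hcase j hj with hj | rfl
              · exact h3 j hj hji
              · exact hc.2
          · refine ⟨pow_pos hp 2, ⟨⟨l, hh⟩, hne, rfl⟩, fun j hj hji => ?_⟩
            rcases hcase j hj with hj | rfl
            · rcases hI with ⟨h1, h2⟩ | ⟨h1, h2, h3⟩
              · exact absurd (h2 j hj) hji
              · exact (not_le.1 fun h => hc ⟨h1, h⟩).le.trans (h3 j hj hji)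
            · exact le_rfl
      · rw [e17, h17']
        push_cast
        rw [hb]
        linarith
    · exact ⟨hr, hmem, 0, Nat.zero_le _, by simpa using h17, .inl ⟨h33, by simp⟩⟩
  refine (Tri.seq (Tri.of_flat (P := .assign 33 (lit 0)) trivial (Q := fun s' =>
      s' = s.setReg 33 0) (by simp [Program.sem, Expr.eval])) fun s₁ _ hs₁ =>
    Tri.seq (Tri.of_flat (P := .assign 17 (lit 0)) trivial (Q := fun s' =>
      s' = s₁.setReg 17 0) (by simp [Program.sem, Expr.eval])) fun s₂ _ hs₂ =>
    Tri.seq (hloop s₂ ?_ ?_ ?_ ?_) fun s₃ _ hs₃ =>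
      Tri.of_flat (P := block [_]) ?_ ?_).mono ?_ fun _ _ h => h
  · subst hs₂ hs₁; simp
  · subst hs₂ hs₁; simp
  · subst hs₂ hs₁; simp
  · subst hs₂ hs₁; simp
  · simp [flat_block, Program.Flat]
  · obtain ⟨hm', h33, ⟨j, hji, hj⟩, hle⟩ := hs₃
    refine ⟨by simpa [sem_block_cons, sem_block_nil, Program.sem] using hm', ?_⟩
    simp only [sem_block_cons, sem_block_nil, Program.sem, State.reg_setReg, if_true, Expr.eval]
    refine ⟨⟨j, hji, ?_⟩, fun j' hj' => ?_⟩
    · rw [← hj, Real.sqrt_sq dist_nonneg]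
    · exact (Real.sqrt_le_left dist_nonneg).2 (hle j' hj')
  · simp only [Program.bound, block, Expr.cost]
    push_cast
    have : (0 : ℝ) ≤ m := Nat.cast_nonneg m
    have : (0 : ℝ) ≤ t.cost := Nat.cast_nonneg _
    nlinarith

end RealRAM

/-! ### The threshold through the generations -/

namespace EuclideanMST

variable {d m m₂ : ℕ}

/-- The value `L` is determined by the points `q` at scale `σ`, up to the error `e`: it is the
threshold for `kk` clusters. -/
structure Approx (q : Fin m → EuclideanSpace ℝ (Fin d)) (kk : ℕ) (L σ e : ℝ) : Prop where
  kk_pos : 0 < kk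
  kk_lt : kk < m
  σ_pos : 0 < σ
  inj : Function.Injective q
  e_nonneg : 0 ≤ e
  -- Keeps every comparison of `L` with cluster counts valid up to the factors `2/3` and `2`.
  e_le : e ≤ L / 2
  -- The error is bounded by the least distance in true scale. When the next mesh is chosen as `2 *
  -- d` times a nearest-neighbour distance, the old error is therefore at most one new mesh.
  sep : ∀ i j, i ≠ j → e ≤ 2 * d * (σ * dist (q i) (q j))
  brk : Brackets q kk ((L - e) / σ) ((L + e) / σ)

namespace Approx

variable {q : Fin m → EuclideanSpace ℝ (Fin d)} {kk : ℕ} {L σ e : ℝ}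

/-- Pruning adds no error, since the threshold is unchanged. -/
theorem comp (h : Approx q kk L σ e) {m' : ℕ} {f : Fin m' → Fin m} (hf : Function.Injective f)
    {y : ℝ} (hy : clusters q y ≤ kk)
    (hi : ∀ i ∉ Set.range f, ∀ i', i' ≠ i → y < dist (q i) (q i')) :
    ∃ kk', kk + m' = kk' + m ∧ Approx (q ∘ f) kk' L σ e := by
  have h1 := clusters_comp hf hi le_rfl
  simp only [Nat.card_eq_fintype_card, Fintype.card_fin] at h1
  have h2 := h.kk_lt
  -- If no point were kept, there would be `m > kk` clusters at distance `y`. Hence a cluster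
  -- survives, and `kk'` stays positive.
  have hpos : 0 < clusters (q ∘ f) y := by
    rcases Nat.eq_zero_or_pos m' with rfl | hm'
    · omega
    · have : Nonempty (nearGraph (q ∘ f) y).ConnectedComponent :=
        ⟨(nearGraph (q ∘ f) y).connectedComponentMk ⟨0, hm'⟩⟩
      exact Nat.card_pos
  refine ⟨kk + m' - m, by omega, by omega, by omega, h.σ_pos, h.inj.comp hf, h.e_nonneg, h.e_le,
    fun i j hij => h.sep _ _ (hf.ne hij), ?_⟩
  exact h.brk.comp hf hi (by simp only [Nat.card_eq_fintype_card, Fintype.card_fin]; omega) hy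

/-- The threshold in true scale is at most `L + e ≤ 3 / 2 * L`, whence the factor `2 / 3`. -/
theorem lt_of_lt_clusters (h : Approx q kk L σ e) {x : ℝ} (hx : kk < clusters q x) :
    2 / 3 * (σ * x) < L := by
  have h1 : x < (L + e) / σ := by
    by_contra hn
    have := (clusters_antitone q (not_lt.1 hn)).trans h.brk.2
    omega
  rw [lt_div_iff₀' h.σ_pos] at h1
  have := h.e_le
  linarith

theorem le_of_clusters_le (h : Approx q kk L σ e) {x : ℝ} (hx : clusters q x ≤ kk) :
    L ≤ 2 * (σ * x) := by
  have h1 := h.brk.1 x hx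
  rw [div_le_iff₀' h.σ_pos] at h1
  have := h.e_le
  linarith

/-- Rounding adds the error `d * (σ * δ)`. By `sep` for the `i`-th point and its neighbour, `e ≤ 2 *
d * (σ * r) = σ * δ`, so the new error is at most `2 * d * (σ * δ)`. More than `kk` clusters at
distance `7 * d` give `4 * d * (σ * δ) < L`, so the new error is below `L / 2`. As cells are at
distance at least `1`, `sep` holds again: the accumulated error is always dominated by the latest
mesh. -/
theorem coarsen (h : Approx q kk L σ e) (hd : 0 < d) {z : Fin m₂ → EuclideanSpace ℝ (Fin d)}
    {f : Fin m → Fin m₂} {r δ : ℝ} {i : Fin m} (hr : IsNearest q i r) (hδ : δ = 2 * d * r)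
    (hz : Snapped q z f δ) (hsep : ∀ u v, u ≠ v → 1 ≤ dist (z u) (z v))
    (hc : kk < clusters z (7 * d)) : Approx z kk L (σ * δ) (e + d * (σ * δ)) := by
  have hδ0 := hz.pos
  have hσ := h.σ_pos
  have hd1 : (1 : ℝ) ≤ d := by exact_mod_cast hd
  have hm₂ := clusters_le_card z (7 * d)
  rw [Nat.card_eq_fintype_card, Fintype.card_fin] at hm₂
  have hL := h.lt_of_lt_clusters (x := 6 * d * δ) (hc.trans_le (hz.clusters_le (by
    rw [mul_div_assoc, div_self hδ0.ne']
    linarith)))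
  obtain ⟨⟨j, hji, hj⟩, -⟩ := hr
  have he : e ≤ d * (σ * δ) := by
    have h1 := h.sep i j hji.symm
    rw [hj] at h1
    have h2 : 2 * d * (σ * r) = σ * δ := by rw [hδ]; ring
    rw [h2] at h1
    exact h1.trans (le_mul_of_one_le_left (by positivity) hd1)
  have h0 := h.e_nonneg
  refine ⟨h.kk_pos, by omega, by positivity, ?_, by positivity, by linarith, ?_, ?_⟩
  · intro u v huv
    by_contra hne
    have := hsep u v hne
    rw [huv, dist_self] at this
    linarith
  · intro u v huv
    have h1 := hsep u v huv
    have h2 : 2 * d * (σ * δ) * 1 ≤ 2 * d * (σ * δ) * dist (z u) (z v) := by gcongr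
    linarith
  · have h1 := hz.brackets h.brk (by
      rw [Nat.card_eq_fintype_card, Fintype.card_fin]; omega)
    convert h1 using 1
    · field_simp
      ring
    · field_simp
      ring

end Approx

end EuclideanMST

/-! ### Isolated points and occupied cells -/

namespace RealRAM

open EuclideanMST

theorem one_le_dist_toPts {d m₂ : ℕ} {z : Fin m₂ → Fin d → ℤ} (hz : Function.Injective z)
    {u v : Fin m₂} (huv : u ≠ v) : 1 ≤ dist (toPts z u) (toPts z v) := by
  obtain ⟨j, hj⟩ := Function.ne_iff.1 (hz.ne huv)
  have h1 := PiLp.norm_apply_le (toPts z u - toPts z v) j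
  rw [← dist_eq_norm] at h1
  refine le_trans ?_ h1
  simp only [toPts, PiLp.sub_apply, Real.norm_eq_abs]
  have : 1 ≤ |z u j - z v j| := Int.one_le_abs (sub_ne_zero.2 hj)
  exact_mod_cast this

section

variable {d m m₂ : ℕ} {s s' : State} {G S : ℕ} {δ τ a b : ℝ} {z : Fin m₂ → Fin d → ℤ}
  {f : Fin m → Fin m₂}

theorem Rounded.of_mem_eq {s₁ : State} (h : Rounded s₁ s' G S δ τ a b z f) (hs : s₁.mem = s.mem) :
    Rounded s s' G S δ τ a b z f :=
  ⟨h.inj, h.surj, h.points, fun i => by rw [h.cell_eq]; simp only [pt, hs], h.r15, h.r16, h.id,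
    h.flag, fun a g key hg => by rw [h.agree a g key hg, hs]⟩

/-- A point in an unflagged cell is isolated. -/
theorem Rounded.lt_dist (h : Rounded s s' G S δ τ a b z f) (hδ : 0 < δ) (hb : 0 ≤ b) {i : Fin m}
    (hi : s'.mem 4 [(S : ℤ), ((f i : ℕ) : ℤ)] = 0) {i' : Fin m} (hne : i' ≠ i) :
    δ * (b - d) < dist (pt d s G i) (pt d s G i') := by
  have h0 := (h.flag (f i)).not.1 (by rw [hi]; simp)
  rw [not_or] at h0
  have hf : f i' ≠ f i := fun hf => h0.1 ⟨i', i, hne, hf, rfl⟩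
  have h1 : b < dist (toPts z (f i)) (toPts z (f i')) :=
    not_le.1 fun hle => h0.2 ⟨f i', hf, (cellNear_iff hb).2 hle⟩
  have h2 := h1.trans_le ((h.snapped hδ).dist_le i i')
  rw [← sub_lt_iff_lt_add, lt_div_iff₀' hδ] at h2
  exact h2

/-- The cell of an isolated point is unflagged. -/
theorem Rounded.flag_eq_zero (h : Rounded s s' G S δ τ a b z f) (hδ : 0 < δ) (hb : 0 ≤ b)
    {i : Fin m} (hi : ∀ i' : Fin m, i' ≠ i → δ * (b + d) < dist (pt d s G i) (pt d s G i')) :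
    s'.mem 4 [(S : ℤ), ((f i : ℕ) : ℤ)] = 0 := by
  have key : ∀ i', i' ≠ i → b < dist (toPts z (f i)) (toPts z (f i')) := by
    intro i' hne
    have h1 := (hi i' hne).trans_le ((h.snapped hδ).dist_le' i i')
    have := lt_of_mul_lt_mul_left h1 hδ.le
    linarith
  by_contra hn
  rcases (h.flag _).1 hn with ⟨l, l', hne, hl, hl'⟩ | ⟨v, hv, hnear⟩
  · obtain ⟨i', hi', hfi'⟩ : ∃ i', i' ≠ i ∧ f i' = f i := by
      by_cases hli : l = i
      · exact ⟨l', fun h => hne (hli.trans h.symm), hl'⟩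
      · exact ⟨l, hli, hl⟩
    have := key i' hi'
    rw [hfi', dist_self] at this
    linarith
  · obtain ⟨i', rfl⟩ := h.surj v
    have := key i' fun h => hv (by rw [h])
    rw [cellNear_iff hb] at hnear
    linarith

theorem Rounded.card_add_le (h : Rounded s s' G S δ τ a b z f) :
    (m₂ : ℝ) + (shared fun i : Fin m => cell δ τ (pt d s G i)).card / 2 ≤ m := by
  have h1 := two_mul_card_add_card_shared_le h.surj
  have h2 : shared f = shared fun i : Fin m => cell δ τ (pt d s G i) := by
    ext i
    simp only [shared, Finset.mem_filter_univ, ← h.cell_eq, h.inj.eq_iff]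
  rw [h2] at h1
  simp only [Fintype.card_fin] at h1
  have : (2 * m₂ + (shared fun i : Fin m => cell δ τ (pt d s G i)).card : ℝ) ≤ 2 * m := by
    exact_mod_cast h1
  linarith

end

/-- Set the mesh, the shift and the search radii, then round and search. -/
def compWith (d : ℕ) (e₁ e₂ e₃ e₄ : Expr) : Program :=
  .seq (.assign 11 e₁) (.seq (.assign 12 e₂) (.seq (.assign 13 e₃) (.seq (.assign 14 e₄) (comp d))))

theorem compWith_spec (d : ℕ) (e₁ e₂ e₃ e₄ : Expr) : ∃ C : ℝ, 0 ≤ C ∧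
    ∀ {s : State} {G S m : ℕ} {δ τ a b : ℝ},
    G ≠ S → s.reg 3 = G → s.reg 4 = m → s.reg 7 = S → e₁.eval s = δ →
    e₂.eval (s.setReg 11 δ) = τ → e₃.eval ((s.setReg 11 δ).setReg 12 τ) = a →
    e₄.eval (((s.setReg 11 δ).setReg 12 τ).setReg 13 a) = b → 0 ≤ a → a ≤ b → Fresh s S →
    Tri (compWith d e₁ e₂ e₃ e₄) s (C * (m + 1) * (2 * b + 1) ^ d) fun s' =>
      (∀ x, x < 11 ∨ 30 < x ∧ x < 100 → s'.reg x = s.reg x) ∧ s'.reg 11 = δ ∧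
      ∃ (m₂ : ℕ) (z : Fin m₂ → Fin d → ℤ) (f : Fin m → Fin m₂), Rounded s s' G S δ τ a b z f := by
  obtain ⟨C, hC, h⟩ := comp_spec d
  refine ⟨C + (e₁.cost + e₂.cost + e₃.cost + e₄.cost + 10), by positivity, ?_⟩
  intro s G S m δ τ a b hGS h3 h4 h7 g1 g2 g3 g4 ha hab hf
  refine (Tri.seq (Tri.of_flat (P := .assign 11 e₁) trivial (Q := fun s' =>
      s' = s.setReg 11 δ) (by simp [Program.sem, g1])) fun s₁ _ hs₁ =>
    Tri.seq (Tri.of_flat (P := .assign 12 e₂) trivial (Q := fun s' =>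
      s' = (s.setReg 11 δ).setReg 12 τ) (by rw [hs₁]; simp [Program.sem, g2])) fun s₂ _ hs₂ =>
    Tri.seq (Tri.of_flat (P := .assign 13 e₃) trivial (Q := fun s' =>
      s' = ((s.setReg 11 δ).setReg 12 τ).setReg 13 a)
      (by rw [hs₂]; simp [Program.sem, g3])) fun s₃ _ hs₃ =>
    Tri.seq (Tri.of_flat (P := .assign 14 e₄) trivial (Q := fun s' =>
      s' = (((s.setReg 11 δ).setReg 12 τ).setReg 13 a).setReg 14 b)
      (by rw [hs₃]; simp [Program.sem, g4])) fun s₄ _ hs₄ =>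
    (h (s := s₄) (G := G) (S := S) (m := m) (δ := δ) (τ := τ) (a := a) (b := b) hGS ?_ ?_ ?_ ?_ ?_
      ?_ ?_ ha hab ?_).mono le_rfl (Q' := fun s' =>
      (∀ x, x < 11 ∨ 30 < x ∧ x < 100 → s'.reg x = s.reg x) ∧ s'.reg 11 = δ ∧
      ∃ (m₂ : ℕ) (z : Fin m₂ → Fin d → ℤ) (f : Fin m → Fin m₂), Rounded s s' G S δ τ a b z f)
      ?_).mono ?_ fun _ _ h => h
  any_goals solve | (rw [hs₄]; simp [h3, h4, h7])
  · rw [hs₄]; exact hf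
  · rintro s' - ⟨hr, m₂, z, f, hR⟩
    refine ⟨fun x hx => ?_, ?_, m₂, z, f, hR.of_mem_eq (by rw [hs₄]; rfl)⟩
    · rw [hr x (by omega), hs₄]
      simp only [State.reg_setReg]
      rw [if_neg (by omega), if_neg (by omega), if_neg (by omega), if_neg (by omega)]
    · rw [hr 11 (by omega), hs₄]
      simp
  · simp only [Program.bound]
    push_cast
    have h1 : (1 : ℝ) ≤ (m + 1) * (2 * b + 1) ^ d :=
      one_le_mul_of_one_le_of_one_le (by linarith [(Nat.cast_nonneg m : (0 : ℝ) ≤ m)])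
        (one_le_pow₀ (by linarith))
    have h2 : (e₁.cost + e₂.cost + e₃.cost + e₄.cost + 10 : ℝ) ≤
        (e₁.cost + e₂.cost + e₃.cost + e₄.cost + 10) * ((m + 1) * (2 * b + 1) ^ d) :=
      le_mul_of_one_le_right (by positivity) h1
    linarith

end RealRAM

/-! ### One round of the pruning phase -/

namespace RealRAM

open EuclideanMST

variable {d n : ℕ}

/-- The parameters and the input points are available, and nothing has been written with the stamps
from `S = reg 7` on. -/
structure Base (p : Fin n → EuclideanSpace ℝ (Fin d)) (k : ℕ) (ε : ℝ) (s : State) (S : ℕ) :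
    Prop where
  r0 : s.reg 0 = n
  r1 : s.reg 1 = k
  r2 : s.reg 2 = ε
  r7 : s.reg 7 = S
  pos : 0 < S
  fresh : Fresh s S
  -- The input stays available as generation `0`; the final refinement returns to it.
  pts : ∀ i : Fin n, pt d s 0 i = p i

theorem Base.next {p : Fin n → EuclideanSpace ℝ (Fin d)} {k : ℕ} {ε : ℝ} {s s' : State} {S : ℕ}
    (h : Base p k ε s S) (hr : ∀ x < 3, s'.reg x = s.reg x) (h7 : s'.reg 7 = (S + 1 : ℕ))
    (hag : AgreeOff S s s') : Base p k ε s' (S + 1) where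
  r0 := (hr 0 (by simp)).trans h.r0
  r1 := (hr 1 (by simp)).trans h.r1
  r2 := (hr 2 (by simp)).trans h.r2
  r7 := h7
  pos := Nat.succ_pos S
  fresh := hag.fresh h.fresh
  pts := fun i => (hag.pt_eq h.pos.ne).trans (h.pts i)

/-- The invariant of the pruning phase: generation `G` consists of `m` points. -/
structure Outer (p : Fin n → EuclideanSpace ℝ (Fin d)) (k : ℕ) (ε L : ℝ) (s : State)
    (m G S kk : ℕ) (σ e : ℝ) : Prop where
  base : Base p k ε s S
  r3 : s.reg 3 = G
  r4 : s.reg 4 = m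
  r5 : s.reg 5 = kk
  r6 : s.reg 6 = σ
  r8 : s.reg 8 = 0
  lt : G < S
  approx : Approx (fun i : Fin m => pt d s G i) kk L σ e

/-- `L` lies between the registers `9` and `10`, which differ by a constant factor. -/
structure Located (p : Fin n → EuclideanSpace ℝ (Fin d)) (k : ℕ) (ε L : ℝ) (s : State) (S : ℕ) :
    Prop where
  base : Base p k ε s S
  r8 : s.reg 8 = 1
  pos : 0 < s.reg 9
  lo : s.reg 9 ≤ L
  hi : L ≤ s.reg 10
  -- The bounds found with nearest distance `r` are `2/3 * σ * r / (4 * d + 2)` and `32 * d ^ 2 * σ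
  -- * r`.
  ratio : s.reg 10 = 48 * d ^ 2 * (4 * d + 2) * s.reg 9

/-- Either the pruning phase goes on with `x` points, or it has ended and `x = 0`. -/
def Outcome (p : Fin n → EuclideanSpace ℝ (Fin d)) (k : ℕ) (ε L : ℝ) (s : State) (x : ℝ) : Prop :=
  (∃ m G S kk σ e, Outer p k ε L s m G S kk σ e ∧ x = (m : ℕ)) ∨
    (∃ S, Located p k ε L s S) ∧ x = 0

theorem Outer.next {p : Fin n → EuclideanSpace ℝ (Fin d)} {k : ℕ} {ε L σ e : ℝ} {s s' : State}
    {m G S kk : ℕ} (h : Outer p k ε L s m G S kk σ e)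
    (hr : ∀ x < 9, x ≠ 7 → s'.reg x = s.reg x) (h7 : s'.reg 7 = (S + 1 : ℕ))
    (hag : AgreeOff S s s') : Outer p k ε L s' m G (S + 1) kk σ e where
  base := h.base.next (fun x hx => hr x (by omega) (by omega)) h7 hag
  r3 := (hr 3 (by simp) (by simp)).trans h.r3
  r4 := (hr 4 (by simp) (by simp)).trans h.r4
  r5 := (hr 5 (by simp) (by simp)).trans h.r5
  r6 := (hr 6 (by simp) (by simp)).trans h.r6
  r8 := (hr 8 (by simp) (by simp)).trans h.r8
  lt := h.lt.trans (Nat.lt_succ_self S)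
  approx := by
    have := h.approx
    simp only [hag.pt_eq h.lt.ne]
    exact this

/-- Round with mesh `2 d r` at a random shift. Either `L` has been located, or the rounded points
form the next generation. -/
def coarseCode (d : ℕ) : Program :=
  .seq (compWith d (.mul (lit (2 * d)) (.reg 33)) (.div (.reg 32) (lit (2 * d))) (lit (7 * d))
    (lit (7 * d))) (.seq (.ite (.le (.reg 16) (.reg 5))
    (block [.assign 8 (lit 1), .assign 9 (.mul (lit (2 / 3)) (.div (.mul (.reg 6) (.reg 33))
      (lit (4 * d + 2)))), .assign 10 (.mul (lit (48 * d ^ 2 * (4 * d + 2))) (.reg 9))])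
    (block [.assign 3 (.reg 7), .assign 4 (.reg 15), .assign 6 (.mul (.reg 6) (.reg 11))]))
    (.assign 7 (.add (.reg 7) (lit 1))))

/-- With at most `kk` clusters at distance `7 * d`, the points have at most `kk` clusters at `8 * d
* δ`, so `L ≤ 16 * d * σ * δ = 32 * d ^ 2 * σ * r`; the last hypothesis is the matching lower bound.
With more clusters, `Approx.coarsen` applies. When `L` has been located the remaining size counts as
`0`, so the inequality on the number of points holds in both cases. -/
theorem coarse_spec (hd : 0 < d) : ∃ C : ℝ, 0 ≤ C ∧ ∀ {n : ℕ}
    {p : Fin n → EuclideanSpace ℝ (Fin d)} {k : ℕ} {ε L σ e r : ℝ} {s : State} {m G S kk t : ℕ}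
    {i : Fin m}, Outer p k ε L s m G S kk σ e → s.reg 33 = r → s.reg 32 = t →
    IsNearest (fun j : Fin m => pt d s G j) i r → 0 < r → 2 / 3 * (σ * (r / (4 * d + 2))) < L →
    Tri (coarseCode d) s (C * (m + 1)) fun s' => ∃ x, Outcome p k ε L s' x ∧
      x + (shared fun j : Fin m => cell (2 * d * r) (t / (2 * d)) (pt d s G j)).card / 2 ≤ m := by
  have hd1 : (1 : ℝ) ≤ d := by exact_mod_cast hd
  obtain ⟨C, hC, hcomp⟩ := compWith_spec d (.mul (lit (2 * d)) (.reg 33))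
    (.div (.reg 32) (lit (2 * d))) (lit (7 * d)) (lit (7 * d))
  refine ⟨C * (2 * (7 * d) + 1) ^ d + 100, by positivity, ?_⟩
  intro n p k ε L σ e r s m G S kk t i h h33 h32 hr hr0 hL
  set δ : ℝ := 2 * d * r with hδ
  have hδ0 : 0 < δ := by positivity
  have hcost : ((Program.assign 7 (.add (.reg 7) (lit 1))).bound : ℝ) = 4 := by
    norm_num [Program.bound, Expr.cost]
  refine (Tri.seq (hcomp (δ := δ) (τ := t / (2 * d)) (a := 7 * d) (b := 7 * d) h.lt.ne h.r3 h.r4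
    h.base.r7 (by simp [Expr.eval, h33, hδ]) (by simp [Expr.eval, h32]) (by simp [Expr.eval])
    (by simp [Expr.eval]) (by positivity) le_rfl h.base.fresh) (B' := 90)
    (Q' := fun s' => ∃ x, Outcome p k ε L s' x ∧
      x + (shared fun j : Fin m => cell (2 * d * r) (t / (2 * d)) (pt d s G j)).card / 2 ≤ m)
      ?_).mono ?_ fun _ _ h => h
  · rintro s₁ - ⟨hw, h11, m₂, z, f, hR⟩
    have hsn := hR.snapped hδ0
    have hcard := hR.card_add_le
    have e5 := (hw 5 (by simp)).trans h.r5
    have e7 := (hw 7 (by simp)).trans h.base.r7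
    have e6 := (hw 6 (by simp)).trans h.r6
    have e8 := (hw 8 (by simp)).trans h.r8
    have e33 := (hw 33 (by simp)).trans h33
    refine (Tri.seq (B := 80) (Q := fun s' => s'.mem = s₁.mem ∧ (∀ x < 3, s'.reg x = s.reg x) ∧
      s'.reg 7 = S ∧ ((s'.reg 8 = 1 ∧ 0 < s'.reg 9 ∧ s'.reg 9 ≤ L ∧ L ≤ s'.reg 10 ∧
        s'.reg 10 = 48 * d ^ 2 * (4 * d + 2) * s'.reg 9) ∨
        (s'.reg 3 = S ∧ s'.reg 4 = m₂ ∧ s'.reg 5 = kk ∧ s'.reg 6 = σ * δ ∧ s'.reg 8 = 0 ∧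
          kk < clusters (toPts z) (7 * d)))) ?_ fun s₂ _ hs₂ =>
      Tri.of_flat (P := .assign 7 (.add (.reg 7) (lit 1))) trivial ?_).mono
      (by rw [hcost]; norm_num) fun _ _ h => h
    · have hbd : ∀ P : Program, P.bound ≤ 70 → (P.bound : ℝ) ≤ 70 := fun P h => by exact_mod_cast h
      refine (Tri.ite (B := 70) (fun ht => (Tri.of_flat (by simp [flat_block, Program.Flat])
        ?_).mono (hbd _ (by simp [block, Program.bound, Expr.cost])) fun _ _ h => h)
        fun ht => (Tri.of_flat (by simp [flat_block, Program.Flat])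
        ?_).mono (hbd _ (by simp [block, Program.bound, Expr.cost])) fun _ _ h => h).mono
        (by norm_num [Test.cost, Expr.cost]) fun _ _ h => h
      · rw [Test.holds_le] at ht
        simp only [Expr.eval, hR.r16, e5, Nat.cast_le] at ht
        have hup := h.approx.le_of_clusters_le ((hsn.le_clusters (x := 8 * d * δ) (by positivity)
          (by linarith)).trans ht)
        simp only [sem_block_cons, sem_block_nil, Program.sem, Expr.eval]
        have hσ := h.approx.σ_pos
        refine ⟨rfl, fun x hx => ?_, ?_, .inl ⟨?_, ?_, ?_, ?_, ?_⟩⟩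
        · simp only [State.reg_setReg]
          rw [if_neg (by omega), if_neg (by omega), if_neg (by omega), hw x (by omega)]
        · simp [e7]
        · simp
        · simp only [State.reg_setReg]
          norm_num [e6, e33]
          positivity
        · simp only [State.reg_setReg]
          norm_num [e6, e33]
          rw [mul_div_assoc]
          exact hL.le
        · simp only [State.reg_setReg]
          norm_num [e6, e33]
          refine hup.trans (le_of_eq ?_)
          rw [hδ]
          field_simp
          ring
        · simp only [State.reg_setReg]
          norm_num
      · rw [Test.holds_le] at ht
        simp only [Expr.eval, hR.r16, e5, Nat.cast_le, not_le] at ht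
        simp only [sem_block_cons, sem_block_nil, Program.sem, Expr.eval]
        refine ⟨rfl, fun x hx => ?_, ?_, .inr ⟨?_, ?_, ?_, ?_, ?_, ht⟩⟩
        · simp only [State.reg_setReg]
          rw [if_neg (by omega), if_neg (by omega), if_neg (by omega), hw x (by omega)]
        all_goals simp [e7, e5, e6, e8, h11, hR.r15]
    · obtain ⟨hmem, hreg, g7, hcases⟩ := hs₂
      set s₃ := (Program.assign 7 (.add (.reg 7) (lit 1))).sem s₂ with hs₃
      have k : ∀ x, x ≠ 7 → s₃.reg x = s₂.reg x := fun x hx => by simp [hs₃, Program.sem, hx]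
      have hag : AgreeOff S s s₃ := fun a g key hg => by
        rw [← hR.agree a g key hg, ← hmem]
        rfl
      have hb : Base p _ ε s₃ (S + 1) := h.base.next
        (fun x hx => (k x (by omega)).trans (hreg x hx))
        (by simp [hs₃, Program.sem, Expr.eval, g7]) hag
      rcases hcases with ⟨g8, g9, g9', g10, g10'⟩ | ⟨g3, g4, g5, g6, g8, hc⟩
      · refine ⟨0, .inr ⟨⟨S + 1, hb, ?_, ?_, ?_, ?_, ?_⟩, rfl⟩, ?_⟩
        · rwa [k 8 (by simp)]
        · rwa [k 9 (by simp)]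
        · rwa [k 9 (by simp)]
        · rwa [k 10 (by simp)]
        · rwa [k 9 (by simp), k 10 (by simp)]
        have : (0 : ℝ) ≤ m₂ := Nat.cast_nonneg _
        linarith
      · refine ⟨m₂, .inl ⟨m₂, S, S + 1, kk, σ * δ, e + d * (σ * δ), ⟨hb, ?_, ?_, ?_, ?_, ?_, Nat.lt_succ_self S,
          ?_⟩, rfl⟩, hcard⟩
        · rw [k 3 (by simp), g3]
        · rw [k 4 (by simp), g4]
        · rw [k 5 (by simp), g5]
        · rw [k 6 (by simp), g6]
        · rw [k 8 (by simp), g8]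
        · have : (fun v : Fin m₂ => pt d s₃ S v) = toPts z := by
            funext v
            rw [← hR.points v]
            simp only [pt, hs₃, Program.sem, State.mem_setReg, hmem]
          rw [this]
          exact h.approx.coarsen hd hr hδ hsn (fun u v huv => one_le_dist_toPts hR.inj huv) hc
  · have hm : (0 : ℝ) ≤ m := Nat.cast_nonneg _
    nlinarith

/-- One round of the pruning phase. -/
def roundCode (d : ℕ) : Program :=
  .seq (nn d) (.seq (compWith d (.div (.reg 33) (lit (4 * d + 2))) (lit 0) (lit (d + 1))
    (lit (3 * d + 1))) (.ite (.le (.reg 16) (.reg 5)) (prune d)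
    (.seq (.assign 7 (.add (.reg 7) (lit 1))) (coarseCode d))))

theorem not_writes_nn {d x : ℕ} (hx : x < 25 ∧ x ≠ 17 ∨ 29 < x ∧ x ≠ 33) : ¬ (nn d).Writes x := by
  simp only [nn, nnBody, sqDistCode, writes_block, writes_unroll, Program.Writes, List.mem_cons,
    List.not_mem_nil, or_false, exists_eq_or_imp, exists_eq_left, not_or, not_exists, not_and]
  repeat' (first | omega | exact not_false | refine And.intro ?_ ?_)

theorem not_writes_prune {d x : ℕ} (hx : x < 3 ∨ x = 6 ∨ x = 8) : ¬ (prune d).Writes x := by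
  simp only [prune, pruneBody, copyCode, writes_block, writes_unroll, Program.Writes, List.mem_cons,
    List.not_mem_nil, or_false, exists_eq_or_imp, exists_eq_left, not_or, not_exists, not_and]
  repeat' (first | omega | refine And.intro ?_ ?_)

/-- The constants are such that `r = δ * (4 * d + 2)`. At most `kk` cells clusters at distance `d +
1` mean at most `kk` clusters of points at `δ * (2 * d + 1)`. With flag radius `3 * d + 1`, an
unflagged point has no neighbour within `δ * (2 * d + 1)`, so it may be removed; and a point without
neighbour within `δ * (4 * d + 1)`, hence any point with nearest distance at least `r`, is
unflagged. With more clusters, `σ * δ` is a lower bound for `L` up to `2 / 3`, and coarse rounding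
follows. The minimum covers both branches. -/
theorem round_spec (hd : 0 < d) : ∃ C : ℝ, 0 ≤ C ∧ ∀ {n : ℕ}
    {p : Fin n → EuclideanSpace ℝ (Fin d)} {k : ℕ} {ε L σ e : ℝ} {s : State} {m G S kk t : ℕ}
    {i : Fin m}, Outer p k ε L s m G S kk σ e → s.reg 31 = (i : ℕ) → s.reg 32 = t →
    Tri (roundCode d) s (C * (m + 1)) fun s' => ∃ x, Outcome p k ε L s' x ∧
      ∀ r : Fin m → ℝ, (∀ j, IsNearest (fun j : Fin m => pt d s G j) j (r j)) →
        x + min ((Finset.univ.filter fun j => r i ≤ r j).card : ℝ)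
          ((shared fun j : Fin m => cell (2 * d * r i) (t / (2 * d)) (pt d s G j)).card / 2) ≤ m := by
  have hd1 : (1 : ℝ) ≤ d := by exact_mod_cast hd
  obtain ⟨C₁, hC₁, hnn⟩ := nn_spec d
  obtain ⟨C₂, hC₂, hcomp⟩ := compWith_spec d (.div (.reg 33) (lit (4 * d + 2))) (lit 0)
    (lit (d + 1)) (lit (3 * d + 1))
  obtain ⟨C₃, hC₃, hprune⟩ := prune_spec d
  obtain ⟨C₄, hC₄, hcoarse⟩ := coarse_spec hd
  refine ⟨C₁ + C₂ * (2 * (3 * d + 1) + 1) ^ d + C₃ + C₄ + 20, by positivity, ?_⟩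
  intro n p k ε L σ e s m G S kk t i h h31 h32
  have hkk := h.approx.kk_pos
  have hkm := h.approx.kk_lt
  set q : Fin m → EuclideanSpace ℝ (Fin d) := fun j => pt d s G j with hq
  have hbound : ((Program.assign 7 (.add (.reg 7) (lit 1))).bound : ℝ) = 4 := by
    norm_num [Program.bound, Expr.cost]
  have hm : (0 : ℝ) ≤ m := Nat.cast_nonneg _
  set Q : State → Prop := fun s' => ∃ x, Outcome p k ε L s' x ∧
      ∀ r : Fin m → ℝ, (∀ j, IsNearest q j (r j)) →
        x + min ((Finset.univ.filter fun j => r i ≤ r j).card : ℝ)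
          ((shared fun j : Fin m => cell (2 * d * r i) (t / (2 * d)) (pt d s G j)).card / 2) ≤ m
    with hQ
  refine (Tri.seq (hnn h.r3 h.r4 h31 (by omega) h.approx.inj).frame
    (B' := C₂ * (m + 1) * (2 * (3 * d + 1) + 1) ^ d + (C₃ + C₄ + 15) * (m + 1)) (Q' := Q)
    ?_).mono ?_ fun _ _ h => h
  · rintro s₁ - ⟨hw₁, hmem₁, hr⟩
    set r := s₁.reg 33 with hr33
    have hr0 : 0 < r := by
      obtain ⟨⟨j, hj, hrj⟩, -⟩ := hr
      rw [← hrj]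
      exact dist_pos.2 fun h' => hj (h.approx.inj h').symm
    set δ : ℝ := r / (4 * d + 2) with hδ
    have hδ0 : 0 < δ := by positivity
    have hrδ : r = δ * (4 * d + 2) := by rw [hδ]; field_simp
    have w₁ : ∀ x, x < 17 ∨ x = 31 ∨ x = 32 → s₁.reg x = s.reg x := fun x hx =>
      hw₁ x (not_writes_nn (by omega))
    have hfresh₁ : Fresh s₁ S := fun a ha g hg key => by rw [hmem₁]; exact h.base.fresh a ha g hg key
    refine (Tri.seq (hcomp (δ := δ) (τ := 0) (a := d + 1) (b := 3 * d + 1) (S := S) h.lt.ne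
      ((w₁ 3 (by simp)).trans h.r3) ((w₁ 4 (by simp)).trans h.r4)
      ((w₁ 7 (by simp)).trans h.base.r7) (by simp [Expr.eval, hδ, hr33]) (by simp [Expr.eval])
      (by simp [Expr.eval]) (by simp [Expr.eval]) (by positivity) (by linarith) hfresh₁)
      (B' := (C₃ + C₄ + 14) * (m + 1)) (Q' := Q) ?_).mono ?_ fun _ _ h => h
    · rintro s₂ - ⟨hw₂, -, m₂, z, f, hR'⟩
      have hR := hR'.of_mem_eq hmem₁
      have hsn := hR.snapped hδ0
      have w₂ : ∀ x, x < 11 ∨ x = 31 ∨ x = 32 → s₂.reg x = s.reg x := fun x hx => by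
        rw [hw₂ x (by omega), w₁ x (by omega)]
      have e5 := (w₂ 5 (by simp)).trans h.r5
      have e7 := (w₂ 7 (by simp)).trans h.base.r7
      refine (Tri.ite (B := (C₃ + C₄ + 6) * (m + 1)) (fun ht => ?_) fun ht => ?_).mono ?_
        fun _ _ h => h
      · rw [Test.holds_le] at ht
        simp only [Expr.eval, hR.r16, e5, Nat.cast_le] at ht
        have hy : clusters q (δ * (2 * d + 1)) ≤ kk :=
          (hsn.le_clusters (x := δ * (2 * d + 1)) (by positivity) (by linarith)).trans ht
        refine (hprune (G := G) (S := S) (kk := kk) (id := fun l : Fin m => (f l : ℕ))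
          (by have := h.lt; omega) ((w₂ 3 (by simp)).trans h.r3) ((w₂ 4 (by simp)).trans h.r4) e5 e7
          hR.id).frame.mono (by nlinarith) ?_
        rintro s₃ - ⟨hw₃, m', g, g3, g4, g5, g7, hp⟩
        have w₃ : ∀ x, x < 3 ∨ x = 6 ∨ x = 8 → s₃.reg x = s.reg x := fun x hx =>
          (hw₃ x (not_writes_prune hx)).trans (w₂ x (by omega))
        have hflag : ∀ l : Fin m, l ∉ Set.range g → s₂.mem 4 [(S : ℤ), ((f l : ℕ) : ℤ)] = 0 := by
          intro l hl
          rw [hp.mem] at hl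
          by_contra hne
          exact hl ⟨l.2, hne⟩
        obtain ⟨kk', hkk', happ⟩ := h.approx.comp hp.inj hy (by
          intro l hl l' hne
          have := hR.lt_dist hδ0 (by positivity) (hflag l hl) hne
          refine lt_of_eq_of_lt ?_ this
          ring)
        refine ⟨m', .inl ⟨m', S + 1, S + 2, kk', σ, e, ⟨⟨?_, ?_, ?_, g7, by omega, ?_, ?_⟩, g3, g4,
          ?_, ?_, ?_, by omega, ?_⟩, rfl⟩, ?_⟩
        · rw [w₃ 0 (by simp), h.base.r0]
        · rw [w₃ 1 (by simp), h.base.r1]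
        · rw [w₃ 2 (by simp), h.base.r2]
        · exact hp.agree.fresh (hR.agree.fresh h.base.fresh)
        · intro l
          rw [hp.agree.pt_eq (by omega), hR.agree.pt_eq h.base.pos.ne, h.base.pts]
        · rw [g5]
          have : (kk : ℝ) + m' = kk' + m := by exact_mod_cast hkk'
          linarith
        · rw [w₃ 6 (by simp), h.r6]
        · rw [w₃ 8 (by simp), h.r8]
        · have : (fun v : Fin m' => pt d s₃ (S + 1) v) = q ∘ g := by
            funext v
            rw [hp.points, hR.agree.pt_eq h.lt.ne]
            rfl
          rw [this]
          exact happ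
        · intro r' hr'
          have hri : r' i = r := (hr' i).unique hr
          -- Every kept point has a nearest neighbour closer than `r`, so kept points and points
          -- with `r' i ≤ r' j` are disjoint.
          have hdisj : Disjoint (Finset.univ.map ⟨g, hp.inj⟩)
              (Finset.univ.filter fun j => r' i ≤ r' j) := by
            rw [Finset.disjoint_left]
            intro j hj hj'
            obtain ⟨v, -, rfl⟩ := Finset.mem_map.1 hj
            rw [Finset.mem_filter_univ, hri] at hj'
            refine ((hp.mem (g v)).1 ⟨v, rfl⟩).2 (hR.flag_eq_zero hδ0 (by positivity) ?_)
            intro l hl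
            refine lt_of_lt_of_le ?_ ((hr' (g v)).2 l hl)
            refine lt_of_lt_of_le ?_ hj'
            rw [hrδ]
            exact mul_lt_mul_of_pos_left (by linarith) hδ0
          have hcard := Finset.card_le_univ ((Finset.univ.map ⟨g, hp.inj⟩) ∪
            (Finset.univ.filter fun j => r' i ≤ r' j))
          rw [Finset.card_union_of_disjoint hdisj, Finset.card_map, Finset.card_univ,
            Fintype.card_fin, Fintype.card_fin] at hcard
          have : (m' : ℝ) + (Finset.univ.filter fun j => r' i ≤ r' j).card ≤ m := by
            exact_mod_cast hcard
          exact (add_le_add_right (min_le_left _ _) _).trans this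
      · rw [Test.holds_le] at ht
        simp only [Expr.eval, hR.r16, e5, Nat.cast_le, not_le] at ht
        have hL := h.approx.lt_of_lt_clusters (x := δ) (ht.trans_le (hsn.clusters_le (by
          rw [div_self hδ0.ne']; linarith)))
        refine (Tri.seq (Tri.of_flat (P := .assign 7 (.add (.reg 7) (lit 1))) trivial
          (Q := fun s₃ => s₃ = s₂.setReg 7 (S + 1 : ℕ)) (by simp [Program.sem, Expr.eval, e7]))
          (B' := C₄ * (m + 1)) (Q' := Q) ?_).mono (by rw [hbound]; nlinarith) fun _ _ h => h
        rintro s₃ - rfl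
        have hout : Outer p k ε L (s₂.setReg 7 (S + 1 : ℕ)) m G (S + 1) kk σ e := by
          refine h.next (fun x hx h7 => ?_) (by simp) fun a g key hg => hR.agree a g key hg
          rw [State.reg_setReg, if_neg h7, w₂ x (by omega)]
        have hpts : (fun j : Fin m => pt d (s₂.setReg 7 (S + 1 : ℕ)) G j) = q := by
          funext j
          exact hR.agree.pt_eq h.lt.ne
        refine (hcoarse (r := r) (t := t) (i := i) hout ?_ ?_ (by rw [hpts]; exact hr) hr0
          hL).mono le_rfl ?_
        · simp [hw₂ 33 (by simp), hr33]
        · simp [w₂ 32 (by simp), h32]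
        · rintro s₄ - ⟨x, hx, hle⟩
          refine ⟨x, hx, fun r' hr' => ?_⟩
          rw [(hr' i).unique hr]
          refine (add_le_add_right (min_le_right _ _) _).trans ?_
          have : ∀ j : Fin m, pt d (s₂.setReg 7 (S + 1 : ℕ)) G j = pt d s G j :=
            fun j => congrFun hpts j
          simpa only [this] using hle
      · norm_num [Test.cost, Expr.cost]
        nlinarith
    · nlinarith
  · nlinarith

end RealRAM

/-! ### Expected cost of the pruning phase -/

namespace RealRAM

open EuclideanMST
open scoped ENNReal

theorem average_le {m : ℕ} (hm : 0 < m) {f : ℕ → ℝ≥0∞} {u : Fin m → ℝ} {R : ℝ≥0∞} {U : ℝ}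
    (hu : ∀ i, 0 ≤ u i) (h : ∀ i : Fin m, f i ≤ ENNReal.ofReal (u i) + R) (hU : ∑ i, u i ≤ m * U) :
    (m : ℝ≥0∞)⁻¹ * ∑ i ∈ Finset.range m, f i ≤ ENNReal.ofReal U + R := by
  have hm0 : (m : ℝ≥0∞) ≠ 0 := by exact_mod_cast hm.ne'
  have hmt : (m : ℝ≥0∞) ≠ ⊤ := ENNReal.natCast_ne_top m
  rw [Finset.sum_range]
  calc (m : ℝ≥0∞)⁻¹ * ∑ i : Fin m, f i
      ≤ (m : ℝ≥0∞)⁻¹ * ∑ i : Fin m, (ENNReal.ofReal (u i) + R) := by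
        gcongr with i
        exact h i
    _ = (m : ℝ≥0∞)⁻¹ * (ENNReal.ofReal (∑ i, u i) + m * R) := by
        rw [Finset.sum_add_distrib, ENNReal.ofReal_sum_of_nonneg fun i _ => hu i]
        simp
    _ ≤ (m : ℝ≥0∞)⁻¹ * (m * ENNReal.ofReal U + m * R) := by
        gcongr
        rw [← ENNReal.ofReal_natCast, ← ENNReal.ofReal_mul (Nat.cast_nonneg m)]
        exact ENNReal.ofReal_le_ofReal hU
    _ = ENNReal.ofReal U + R := by
        rw [← mul_add, ← mul_assoc, ENNReal.inv_mul_cancel hm0 hmt, one_mul]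

theorem natCast_add_ofReal_add {c : ℕ} {U : ℝ} (hU : 0 ≤ U) (R : ℝ≥0∞) :
    (c : ℝ≥0∞) + (ENNReal.ofReal U + R) = ENNReal.ofReal (c + U) + R := by
  rw [ENNReal.ofReal_add (Nat.cast_nonneg c) hU, ENNReal.ofReal_natCast, add_assoc]

/-- The pruning phase. -/
def pruneLoop (d : ℕ) : Program :=
  .loop (.le (.reg 8) (lit 0))
    (.seq (.rand 31 (.reg 4)) (.seq (.rand 32 (lit (2 * d))) (roundCode d)))

theorem Outer.of_eq {d n : ℕ} {p : Fin n → EuclideanSpace ℝ (Fin d)} {k : ℕ} {ε L σ e : ℝ}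
    {s s' : State} {m G S kk : ℕ} (h : Outer p k ε L s m G S kk σ e)
    (hr : ∀ x < 9, s'.reg x = s.reg x) (hm : s'.mem = s.mem) : Outer p k ε L s' m G S kk σ e where
  base := by
    obtain ⟨h0, h1, h2, h7, hpos, hf, hp⟩ := h.base
    refine ⟨?_, ?_, ?_, ?_, hpos, ?_, ?_⟩
    · rwa [hr 0 (by simp)]
    · rwa [hr 1 (by simp)]
    · rwa [hr 2 (by simp)]
    · rwa [hr 7 (by simp)]
    · simpa only [Fresh, hm] using hf
    · simpa only [pt, hm] using hp
  r3 := (hr 3 (by simp)).trans h.r3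
  r4 := (hr 4 (by simp)).trans h.r4
  r5 := (hr 5 (by simp)).trans h.r5
  r6 := (hr 6 (by simp)).trans h.r6
  r8 := (hr 8 (by simp)).trans h.r8
  lt := h.lt
  approx := by simpa only [pt, hm] using h.approx

variable {d : ℕ}

/-- The potential `C * x` drops by `C * m / 64` on average over the two draws, which pays for a
round of cost `C₀ * (m + 1)`. The induction is on the number `N` of steps, so termination need not
be known; the summand `4` pays for the last test. -/
theorem ec_pruneLoop_le (hd : 0 < d) : ∃ C : ℝ, 0 ≤ C ∧ ∀ {n : ℕ}
    {p : Fin n → EuclideanSpace ℝ (Fin d)} {k : ℕ} {ε L : ℝ} {F : State → ℝ≥0∞}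
    {K : List Program} {R : ℝ≥0∞},
    (∀ s S, Located p k ε L s S → ∀ N, ec F N (K, s) ≤ R) →
    ∀ (N : ℕ) (s : State) (x : ℝ), Outcome p k ε L s x →
      ec F N (pruneLoop d :: K, s) ≤ ENNReal.ofReal (C * x + 4) + R := by
  obtain ⟨C₀, hC₀, hround⟩ := round_spec hd
  -- Loop test, sequencing and the two draws cost `4 + 1 + 2 + 1 + 2 = 10`, and `10 + C₀ * (m + 1) ≤
  -- (10 + 2 * C₀) * m` for `m ≥ 1`.
  refine ⟨64 * (10 + 2 * C₀), by positivity, ?_⟩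
  intro n p k ε L F K R hK N
  set C : ℝ := 64 * (10 + 2 * C₀) with hC
  have hC0 : 0 ≤ C := by positivity
  have hcost : (Test.le (.reg 8) (lit 0)).cost + 1 = 4 := rfl
  induction N with
  | zero => intro s x _; simp [ec]
  | succ N ih =>
    rintro s x (⟨m, G, S, kk, σ, e, h, rfl⟩ | ⟨⟨S, h⟩, rfl⟩)
    · have hkk := h.approx.kk_pos
      have hkm := h.approx.kk_lt
      have hm : 0 < m := by omega
      have hm1 : (1 : ℝ) ≤ m := by exact_mod_cast hm
      set q : Fin m → EuclideanSpace ℝ (Fin d) := fun j => pt d s G j with hq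
      have : Nontrivial (Fin m) := Fin.nontrivial_iff_two_le.2 (by omega)
      choose r hr using fun i => exists_isNearest q i
      have hpos : ∀ i, 0 < r i := by
        intro i
        obtain ⟨⟨j, hj, hrj⟩, -⟩ := hr i
        rw [← hrj]
        exact dist_pos.2 fun h' => hj (h.approx.inj h').symm
      have hsum := le_sum_min_card hd hr hpos
      -- A lower bound for the number of points lost when point `i` and shift `t` are drawn.
      set g : Fin m → ℕ → ℝ := fun i t =>
        min ((Finset.univ.filter fun j => r i ≤ r j).card : ℝ)
          ((shared fun j => cell (2 * d * r i) (t / (2 * d)) (q j)).card / 2) with hg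
      have hgm : ∀ i t, g i t ≤ m := by
        intro i t
        refine (min_le_left _ _).trans ?_
        have := Finset.card_le_univ (Finset.univ.filter fun j => r i ≤ r j)
        rw [Fintype.card_fin] at this
        exact_mod_cast this
      set u : Fin m → ℕ → ℝ := fun i t => C₀ * (m + 1) + (C * (m - g i t) + 4) with hu
      have hu0 : ∀ i t, 0 ≤ u i t := fun i t => by
        have := hgm i t
        have : 0 ≤ C * (m - g i t) := mul_nonneg hC0 (by linarith)
        positivity
      have hstep : step (pruneLoop d :: K, s) = PMF.pure ((.seq (.rand 31 (.reg 4))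
          (.seq (.rand 32 (lit (2 * d))) (roundCode d))) :: pruneLoop d :: K, s) := by
        simp only [pruneLoop, step, Test.holds_le, Expr.eval, h.r8]
        simp
      rw [ec_succ_of_pure F N hstep]
      have hd2 : 0 < 2 * d := by omega
      have hd2' : (0 : ℝ) < (2 * d : ℕ) := by exact_mod_cast hd2
      have hinner : ∀ (i : Fin m) (t : Fin (2 * d)), ec F N (roundCode d :: pruneLoop d :: K,
          (s.setReg 31 ((i : ℕ) : ℝ)).setReg 32 ((t : ℕ) : ℝ)) ≤ ENNReal.ofReal (u i t) + R := by
        intro i t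
        obtain ⟨s', ⟨x, hx, hxm⟩, hle⟩ := (hround (i := i) (t := t) (h.of_eq
          (s' := (s.setReg 31 ((i : ℕ) : ℝ)).setReg 32 ((t : ℕ) : ℝ)) (fun x hx => by
            rw [State.reg_setReg, State.reg_setReg, if_neg (by omega), if_neg (by omega)]) rfl)
          (by simp) (by simp)).ec_le F N (pruneLoop d :: K)
        have hxm' : x + g i t ≤ m := hxm r hr
        have hx0 : 0 ≤ x := by
          rcases hx with ⟨m', _, _, _, _, _, -, rfl⟩ | ⟨-, rfl⟩
          · exact Nat.cast_nonneg _
          · exact le_rfl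
        refine hle.trans ?_
        rw [hu, ENNReal.ofReal_add (by positivity) (by
          have : 0 ≤ C * (m - g i t) := mul_nonneg hC0 (by linarith)
          positivity), add_assoc]
        gcongr
        refine (ih s' x hx).trans ?_
        gcongr
        linarith
      have hmid : ∀ i : Fin m, ec F N (.seq (.rand 32 (lit (2 * d))) (roundCode d) ::
          pruneLoop d :: K, s.setReg 31 ((i : ℕ) : ℝ)) ≤
          ENNReal.ofReal ((3 : ℕ) + (∑ t : Fin (2 * d), u i t) / (2 * d : ℕ)) + R := by
        intro i
        refine (ec_le_of_step F (c := (.rand 32 (lit (2 * d)) :: roundCode d :: pruneLoop d :: K,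
          s.setReg 31 ((i : ℕ) : ℝ))) rfl N).trans ?_
        refine (add_le_add_right (ec_rand_le F N 32 (lit (2 * d)) (roundCode d :: pruneLoop d :: K)
          (s.setReg 31 ((i : ℕ) : ℝ)) hd2 (by simp [Expr.eval])) _).trans ?_
        refine (add_le_add_right (add_le_add_right (average_le hd2 (u := fun t : Fin (2 * d) => u i t)
          (U := (∑ t : Fin (2 * d), u i t) / (2 * d : ℕ)) (fun t => hu0 i t) (hinner i) ?_) _)
          _).trans ?_
        · rw [mul_div_cancel₀ _ hd2'.ne']
        · rw [← add_assoc, ← Nat.cast_add, natCast_add_ofReal_add]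
          · exact le_rfl
          · exact div_nonneg (Finset.sum_nonneg fun t _ => hu0 i t) hd2'.le
      refine (add_le_add_right (ec_le_of_step F (c := (.rand 31 (.reg 4) :: .seq
        (.rand 32 (lit (2 * d))) (roundCode d) :: pruneLoop d :: K, s)) rfl N) _).trans ?_
      refine (add_le_add_right (add_le_add_right (ec_rand_le F N 31 (.reg 4) _ s hm
        h.r4) _) _).trans ?_
      have hU0 : 0 ≤ 3 + (C₀ * (m + 1) + (C * (m - m / 64) + 4)) := by
        have : 0 ≤ C * (m - m / 64) := mul_nonneg hC0 (by linarith)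
        positivity
      refine (add_le_add_right (add_le_add_right (add_le_add_right (average_le hm
        (U := 3 + (C₀ * (m + 1) + (C * (m - m / 64) + 4))) (fun i => ?_) hmid ?_) _) _) _).trans ?_
      · exact add_nonneg (Nat.cast_nonneg _)
          (div_nonneg (Finset.sum_nonneg fun t _ => hu0 i t) hd2'.le)
      · have h1 : ∑ i : Fin m, ∑ t : Fin (2 * d), u i t =
            m * (2 * d : ℕ) * (C₀ * (m + 1) + (C * m + 4)) -
            C * ∑ i : Fin m, ∑ t ∈ Finset.range (2 * d), g i t := by
          simp only [hu, Finset.sum_range (fun t => g _ t), Finset.mul_sum, Finset.sum_add_distrib,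
            Finset.sum_sub_distrib, mul_sub, Finset.sum_const, Finset.card_univ, Fintype.card_fin,
            nsmul_eq_mul]
          ring
        have h2 : C * (m * (2 * d) * (m / 64)) ≤
            C * ∑ i : Fin m, ∑ t ∈ Finset.range (2 * d), g i t := by
          rw [Fintype.card_fin] at hsum
          gcongr
        rw [Finset.sum_add_distrib, ← Finset.sum_div, h1, Finset.sum_const, Finset.card_univ,
          Fintype.card_fin, nsmul_eq_mul, ← sub_nonneg]
        have h3 : (m * (2 * d : ℕ) * (C₀ * (m + 1) + (C * m + 4)) -
            C * ∑ i : Fin m, ∑ t ∈ Finset.range (2 * d), g i t) / (2 * d : ℕ) ≤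
            m * (C₀ * (m + 1) + (C * (m - m / 64) + 4)) := by
          rw [div_le_iff₀ hd2']
          push_cast
          linarith
        push_cast at h3 ⊢
        linarith
      · rw [natCast_add_ofReal_add hU0, natCast_add_ofReal_add (by positivity),
          natCast_add_ofReal_add (by positivity)]
        refine add_le_add (ENNReal.ofReal_le_ofReal ?_) le_rfl
        simp only [stepCost, pruneLoop, Expr.cost, Test.cost]
        push_cast
        rw [hC]
        nlinarith
    · have hstep : step (pruneLoop d :: K, s) = PMF.pure (K, s) := by
        simp only [pruneLoop, step, Test.holds_le, Expr.eval, h.r8]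
        simp [not_le.2 (one_pos : (0 : ℝ) < 1)]
      refine (ec_le_of_step F hstep (N + 1)).trans ?_
      rw [mul_zero, zero_add]
      gcongr
      · simp [stepCost, pruneLoop, Expr.cost, Test.cost]
      · exact hK s S h (N + 1)

end RealRAM

namespace RealRAM

open EuclideanMST
open scoped ENNReal

variable {d : ℕ}

/-! ### Refinement -/

/-- Shrink the interval between the registers `9` and `10` by the factor `2 / 3`. -/
def refineBody (d : ℕ) : Program :=
  .seq (.assign 34 (.div (.sub (.reg 10) (.reg 9)) (lit 3)))
    (.seq (.assign 35 (.add (.reg 9) (.reg 34)))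
    (.seq (compWith d (.div (.reg 34) (lit (2 * d))) (lit 0)
      (.add (.div (.reg 35) (.reg 11)) (lit d)) (.add (.div (.reg 35) (.reg 11)) (lit d)))
    (.seq (.ite (.le (.reg 16) (.reg 1)) (.assign 10 (.add (.reg 35) (.reg 34)))
      (.assign 9 (.reg 35))) (.assign 7 (.add (.reg 7) (lit 1))))))

/-- The mesh is `1 / (2 * d)` of a third of the interval, so the blur of `2 * d` meshes is exactly
one third: the cluster count decides between a threshold of at most the upper trisection point and
one above the lower trisection point. -/
theorem refineBody_spec (hd : 0 < d) : ∃ C : ℝ, 0 ≤ C ∧ ∀ {n : ℕ}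
    {p : Fin n → EuclideanSpace ℝ (Fin d)} {k : ℕ} {ε lo hi : ℝ} {s : State} {S : ℕ},
    Base p k ε s S → s.reg 3 = 0 → s.reg 4 = n → s.reg 9 = lo → s.reg 10 = hi → 0 < lo → lo < hi →
    Tri (refineBody d) s
      (C * (n + 1) * (2 * ((lo + (hi - lo) / 3) / ((hi - lo) / 3 / (2 * d)) + d) + 1) ^ d)
      fun s' => Base p k ε s' (S + 1) ∧ s'.reg 3 = 0 ∧ s'.reg 4 = n ∧
        (clusters p (lo + 2 * ((hi - lo) / 3)) ≤ k ∧ s'.reg 9 = lo ∧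
          s'.reg 10 = lo + 2 * ((hi - lo) / 3) ∨
        k < clusters p (lo + (hi - lo) / 3) ∧ s'.reg 9 = lo + (hi - lo) / 3 ∧ s'.reg 10 = hi) := by
  have hd1 : (1 : ℝ) ≤ d := by exact_mod_cast hd
  obtain ⟨C, hC, hcomp⟩ := compWith_spec d (.div (.reg 34) (lit (2 * d))) (lit 0)
      (.add (.div (.reg 35) (.reg 11)) (lit d)) (.add (.div (.reg 35) (.reg 11)) (lit d))
  refine ⟨C + 40, by positivity, ?_⟩
  intro n p k ε lo hi s S hb h3 h4 h9 h10 hlo hlt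
  set g : ℝ := (hi - lo) / 3 with hg
  have hg0 : 0 < g := by rw [hg]; linarith
  set δ : ℝ := g / (2 * d) with hδ
  have hδ0 : 0 < δ := by positivity
  set a : ℝ := (lo + g) / δ + d with ha
  have ha0 : 0 ≤ a := by positivity
  set s₂ : State := (s.setReg 34 g).setReg 35 (lo + g) with hs₂
  have hw₂ : ∀ x < 34, s₂.reg x = s.reg x := fun x hx => by
    rw [hs₂, State.reg_setReg, State.reg_setReg, if_neg (by omega), if_neg (by omega)]
  set Q : State → Prop := fun s' => Base p k ε s' (S + 1) ∧ s'.reg 3 = 0 ∧ s'.reg 4 = n ∧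
        (clusters p (lo + 2 * g) ≤ k ∧ s'.reg 9 = lo ∧ s'.reg 10 = lo + 2 * g ∨
        k < clusters p (lo + g) ∧ s'.reg 9 = lo + g ∧ s'.reg 10 = hi) with hQ
  refine (Tri.seq (Tri.of_flat (P := .assign 34 _) trivial (Q := fun s' => s' = s.setReg 34 g)
      (by simp [Program.sem, Expr.eval, h9, h10, hg])) fun s₁ _ hs₁ =>
    Tri.seq (Tri.of_flat (P := .assign 35 _) trivial (Q := fun s' => s' = s₂)
      (by rw [hs₁]; simp [Program.sem, Expr.eval, h9, hs₂])) fun s₂' _ hs₂' =>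
    (Tri.seq (B' := 25) (Q' := Q) (hcomp (s := s₂') (G := 0) (S := S) (m := n) (δ := δ) (τ := 0)
      (a := a) (b := a) hb.pos.ne ?_ ?_ ?_ ?_ ?_ ?_ ?_ ha0 le_rfl ?_) ?_).mono le_rfl
      fun _ _ h => h).mono ?_ fun _ _ h => h
  any_goals rw [hs₂']
  · simp [hw₂, h3]
  · simp [hw₂, h4]
  · simp [hw₂, hb.r7]
  · simp [Expr.eval, hs₂, hδ]
  · simp [Expr.eval]
  · simp [Expr.eval, hs₂, ha]
  · simp [Expr.eval, hs₂, ha]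
  · exact hb.fresh
  · rintro s₃ - ⟨hw, h11, m₂, z, f, hR'⟩
    have hR := hR'.of_mem_eq (s := s) rfl
    have hsn := hR.snapped hδ0
    have hpts : (fun i : Fin n => pt d s 0 i) = p := funext hb.pts
    rw [hpts] at hsn
    have hw₃ : ∀ x < 11, s₃.reg x = s.reg x := fun x hx => by rw [hw x (by omega), hw₂ x (by omega)]
    have e34 : s₃.reg 34 = g := by rw [hw 34 (by simp), hs₂]; simp
    have e35 : s₃.reg 35 = lo + g := by rw [hw 35 (by simp), hs₂]; simp
    have hone : ∀ P : Program, P.bound ≤ 10 → (P.bound : ℝ) ≤ 10 := fun P h => by exact_mod_cast h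
    refine (Tri.seq (B := 14) (B' := 10) (Q := fun s' => s'.mem = s₃.mem ∧
      (∀ x < 9, s'.reg x = s.reg x) ∧
      (clusters p (lo + 2 * g) ≤ k ∧ s'.reg 9 = lo ∧ s'.reg 10 = lo + 2 * g ∨
        k < clusters p (lo + g) ∧ s'.reg 9 = lo + g ∧ s'.reg 10 = hi)) ?_ fun s₄ _ hs₄ =>
      (Tri.of_flat (P := .assign 7 _) trivial ?_).mono (hone _
        (by simp [Program.bound, Expr.cost])) fun _ _ h => h).mono (by norm_num) fun _ _ h => h
    · refine (Tri.ite (B := 10) (fun ht => (Tri.of_flat (P := .assign 10 _) trivial ?_).mono (hone _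
        (by simp [Program.bound, Expr.cost])) fun _ _ h => h) fun ht =>
        (Tri.of_flat (P := .assign 9 _) trivial ?_).mono (hone _ (by simp [Program.bound, Expr.cost])) fun _ _ h => h).mono
          (by norm_num [Test.cost, Expr.cost]) fun _ _ h => h
      · rw [Test.holds_le] at ht
        simp only [Expr.eval, hR.r16, hw₃ 1 (by simp), hb.r1, Nat.cast_le] at ht
        simp only [Program.sem, Expr.eval]
        refine ⟨rfl, fun x hx => ?_, .inl ⟨(hsn.le_clusters ha0 ?_).trans ht, ?_, ?_⟩⟩
        · rw [State.reg_setReg, if_neg (by omega), hw₃ x (by omega)]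
        · rw [ha, hδ]
          apply le_of_eq
          field_simp
          ring
        · simp [hw₃, h9]
        · simp only [State.reg_setReg, if_true, e34, e35]
          ring
      · rw [Test.holds_le] at ht
        simp only [Expr.eval, hR.r16, hw₃ 1 (by simp), hb.r1, Nat.cast_le, not_le] at ht
        simp only [Program.sem, Expr.eval]
        refine ⟨rfl, fun x hx => ?_, .inr ⟨ht.trans_le (hsn.clusters_le le_rfl), ?_, ?_⟩⟩
        · rw [State.reg_setReg, if_neg (by omega), hw₃ x (by omega)]
        · simp [e35]
        · simp [hw₃, h10]
    · obtain ⟨hmem, hreg, hcases⟩ := hs₄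
      simp only [Program.sem, Expr.eval]
      refine ⟨hb.next (fun x hx => ?_) ?_ ?_, ?_, ?_, ?_⟩
      · rw [State.reg_setReg, if_neg (by omega), hreg x (by omega)]
      · simp [hreg 7 (by simp), hb.r7]
      · intro c g key hg
        rw [← hR.agree c g key hg, ← hmem]
        rfl
      · simp [hreg 3 (by simp), h3]
      · simp [hreg 4 (by simp), h4]
      · simpa using hcases
  · simp only [Program.bound, Expr.cost]
    push_cast
    have h1 : (1 : ℝ) ≤ (n + 1) * (2 * a + 1) ^ d :=
      one_le_mul_of_one_le_of_one_le (by linarith [(Nat.cast_nonneg n : (0 : ℝ) ≤ n)])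
        (one_le_pow₀ (by linarith))
    linarith

/-- Shrink the interval until its ends differ by the factor `1 + ε` at most. -/
def refine (d : ℕ) : Program :=
  .seq (.assign 3 (lit 0)) (.seq (.assign 4 (.reg 0)) (.seq
    (.loop (.lt (.mul (.reg 2) (.reg 9)) (.sub (.reg 10) (.reg 9))) (refineBody d))
    (.assign 0 (.reg 10))))

/-- With gap `γ` an iteration costs `O(n * (l₀ / γ) ^ d)`. The gap shrinks by `2 / 3`, so the costs
grow geometrically and the last one dominates. The body runs only if the gap exceeds `ε` times the
lower end, so the gap never falls below `2 / 3 * (ε * l₀)`. -/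
theorem refine_spec (hd : 0 < d) : ∃ C : ℝ, 0 ≤ C ∧ ∀ {n : ℕ}
    {p : Fin n → EuclideanSpace ℝ (Fin d)} {k : ℕ} {ε L : ℝ} {s : State} {S : ℕ}, 0 < n →
    0 < ε → ε ≤ 1 → (∀ x, L ≤ x ↔ clusters p x ≤ k) → Located p k ε L s S →
    Tri (refine d) s (C * (n / ε ^ d)) fun s' => L ≤ s'.reg 0 ∧ s'.reg 0 ≤ (1 + ε) * L := by
  have hd1 : (1 : ℝ) ≤ d := by exact_mod_cast hd
  obtain ⟨C, hC, hbody⟩ := refineBody_spec hd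
  set t : Test := .lt (.mul (.reg 2) (.reg 9)) (.sub (.reg 10) (.reg 9)) with ht
  set κ : ℝ := 48 * d ^ 2 * (4 * d + 2) with hκ
  have hκ2 : 2 ≤ κ := by
    have : (1 : ℝ) ≤ d ^ 2 := one_le_pow₀ hd1
    nlinarith
  -- The number `14 * d + 1` is `2 * (6 * d)` from the searched radius plus `2 * d + 1` from the
  -- blur and the central cell; both are scaled by `κ` times `l₀` over the gap, which is at least
  -- `1`.
  set A : ℝ := 2 * C * (κ * (14 * d + 1)) ^ d + (t.cost + 1) * κ ^ d with hA
  have hA0 : 0 ≤ A := by positivity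
  refine ⟨A * (2 * (3 / 2) ^ d) + (t.cost + 20), by positivity, ?_⟩
  intro n p k ε L s S hn hε hε1 hL h
  have hn1 : (1 : ℝ) ≤ n := by exact_mod_cast hn
  set l₀ : ℝ := s.reg 9 with hl₀
  have hl : 0 < l₀ := h.pos
  have hpow : ((3 : ℝ) / 2) ^ d ≥ 3 / 2 := le_self_pow₀ (by norm_num) hd.ne'
  set I : State → Prop := fun s' => (∃ S', Base p k ε s' S') ∧ s'.reg 3 = 0 ∧ s'.reg 4 = n ∧
    l₀ ≤ s'.reg 9 ∧ s'.reg 9 ≤ L ∧ L ≤ s'.reg 10 ∧ s'.reg 10 ≤ κ * l₀ ∧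
    2 / 3 * (ε * l₀) ≤ s'.reg 10 - s'.reg 9 with hI
  have hloop : ∀ s₁, I s₁ → Tri (.loop t (refineBody d)) s₁
      (t.cost + 1 + A * n * (2 * (3 / 2) ^ d / ε ^ d)) fun s' => I s' ∧ ¬ t.Holds s' := by
    intro s₁ hs₁
    -- In one iteration `(l₀ / gap) ^ d` grows by the factor `(3 / 2) ^ d ≥ 3 / 2`, that is, by at
    -- least half its value; the factor `2` turns this into the full cost.
    refine (Tri.loop I (fun s' => A * n * (2 * (3 / 2) ^ d / ε ^ d -
      2 * (l₀ / (s'.reg 10 - s'.reg 9)) ^ d)) ?_ ?_ hs₁).mono ?_ fun _ _ h => h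
    · rintro s' ⟨-, -, -, -, -, -, -, hg⟩
      have hg0 : 0 < s'.reg 10 - s'.reg 9 := lt_of_lt_of_le (by positivity) hg
      refine mul_nonneg (by positivity) (sub_nonneg.2 ?_)
      rw [mul_div_assoc, ← div_pow]
      refine mul_le_mul_of_nonneg_left (pow_le_pow_left₀ (by positivity) ?_ d) (by norm_num)
      rw [div_le_div_iff₀ hg0 hε]
      linarith
    · rintro s' ⟨⟨S', hb⟩, h3, h4, g1, g2, g3, g4, g5⟩ hh
      rw [ht, Test.holds_lt] at hh
      simp only [Expr.eval, hb.r2] at hh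
      set lo := s'.reg 9 with hlo
      set hi := s'.reg 10 with hhi
      have hlo0 : 0 < lo := hl.trans_le g1
      have hεlo : 0 < ε * lo := by positivity
      set g := hi - lo with hg
      have hg0 : 0 < g := by linarith
      refine ⟨_, (hbody hb h3 h4 rfl rfl hlo0 (by linarith)).mono le_rfl ?_⟩
      rintro s'' - ⟨hb', h3', h4', hcases⟩
      have hεl : ε * l₀ ≤ ε * lo := by gcongr
      have hgap : s''.reg 10 - s''.reg 9 = 2 / 3 * g := by
        rcases hcases with ⟨-, e9, e10⟩ | ⟨-, e9, e10⟩ <;> rw [e9, e10, hg] <;> ring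
      refine ⟨⟨⟨_, hb'⟩, h3', h4', ?_⟩, ?_⟩
      · rw [hgap]
        rcases hcases with ⟨hc, e9, e10⟩ | ⟨hc, e9, e10⟩
        · rw [e9, e10]
          exact ⟨g1, g2, (hL _).2 hc, by linarith, by linarith⟩
        · rw [e9, e10]
          refine ⟨by linarith, ?_, g3, g4, by linarith⟩
          by_contra hn
          have := (hL _).1 (not_le.1 hn).le
          omega
      · rw [hgap]
        set ρ : ℝ := (l₀ / g) ^ d with hρ
        have hρ0 : 0 ≤ ρ := by positivity
        have e1 : (l₀ / (2 / 3 * g)) ^ d = (3 / 2) ^ d * ρ := by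
          rw [hρ, ← mul_pow]
          congr 1
          field_simp
        have hgκ : g ≤ κ * l₀ := by linarith
        have hκl : 1 ≤ κ * (l₀ / g) := by
          rw [← mul_div_assoc, le_div_iff₀ hg0]
          linarith
        have e2 : (2 * ((lo + g / 3) / (g / 3 / (2 * d)) + d) + 1) ^ d ≤
            (κ * (14 * d + 1)) ^ d * ρ := by
          rw [hρ, ← mul_pow]
          refine pow_le_pow_left₀ (by positivity) ?_ d
          have h1 : (lo + g / 3) / (g / 3 / (2 * d)) ≤ 6 * d * (κ * (l₀ / g)) := by
            have h2 : lo + g / 3 ≤ κ * l₀ := by linarith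
            calc (lo + g / 3) / (g / 3 / (2 * d)) = 6 * d * ((lo + g / 3) / g) := by
                  field_simp; norm_num
              _ ≤ 6 * d * (κ * l₀ / g) := by gcongr
              _ = _ := by ring
          have h2 : (2 * d + 1) * 1 ≤ (2 * d + 1) * (κ * (l₀ / g)) := by gcongr
          linarith
        have e3 : (1 : ℝ) ≤ κ ^ d * ρ := by
          rw [hρ, ← mul_pow]
          exact one_le_pow₀ hκl
        have e4 : C * (n + 1) * (2 * ((lo + g / 3) / (g / 3 / (2 * d)) + d) + 1) ^ d ≤
            2 * C * (κ * (14 * d + 1)) ^ d * n * ρ := by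
          calc _ ≤ C * (n + n) * ((κ * (14 * d + 1)) ^ d * ρ) := by gcongr
            _ = _ := by ring
        have e5 : (t.cost : ℝ) + 1 ≤ (t.cost + 1) * κ ^ d * n * ρ := by
          calc (t.cost : ℝ) + 1 = (t.cost + 1) * 1 * 1 := by ring
            _ ≤ (t.cost + 1) * n * (κ ^ d * ρ) := by gcongr
            _ = _ := by ring
        have e6 : t.cost + 1 + C * (n + 1) *
            (2 * ((lo + g / 3) / (g / 3 / (2 * d)) + d) + 1) ^ d ≤ A * n * ρ := by
          rw [hA]
          linarith
        have e7 : A * n * ρ * 1 ≤ A * n * ρ * (2 * (3 / 2) ^ d - 2) :=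
          mul_le_mul_of_nonneg_left (by linarith) (by positivity)
        rw [e1]
        linarith
    · have : 0 ≤ A * n * (2 * (l₀ / (s₁.reg 10 - s₁.reg 9)) ^ d) := by
        obtain ⟨-, -, -, -, -, -, -, hg⟩ := hs₁
        have hg0 : 0 < s₁.reg 10 - s₁.reg 9 := lt_of_lt_of_le (by positivity) hg
        positivity
      linarith
  refine (Tri.seq (Tri.of_flat (P := .assign 3 (lit 0)) trivial (Q := fun s' => s' = s.setReg 3 0)
      (by simp [Program.sem, Expr.eval])) fun s₁ _ hs₁ =>
    Tri.seq (Tri.of_flat (P := .assign 4 (.reg 0)) trivial (Q := fun s' => s' = s₁.setReg 4 n)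
      (by rw [hs₁]; simp [Program.sem, Expr.eval, h.base.r0])) fun s₂ _ hs₂ =>
    Tri.seq (hloop s₂ ?_) fun s₃ _ hs₃ => Tri.of_flat (P := .assign 0 (.reg 10)) trivial ?_).mono ?_
      fun _ _ h => h
  · rw [hs₂, hs₁]
    refine ⟨⟨S, ⟨?_, ?_, ?_, ?_, h.base.pos, h.base.fresh, h.base.pts⟩⟩, ?_, ?_, ?_, ?_, ?_, ?_, ?_⟩
    · simp [h.base.r0]
    · simp [h.base.r1]
    · simp [h.base.r2]
    · simp [h.base.r7]
    · simp
    · simp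
    · simp [hl₀]
    · simpa using h.lo
    · simpa using h.hi
    · simpa using h.ratio.le
    · have : 2 / 3 * (ε * l₀) ≤ s.reg 10 - l₀ := by
        rw [h.ratio, ← hl₀, ← hκ]
        nlinarith
      simpa using this
  · obtain ⟨⟨⟨S', hb⟩, -, -, g1, g2, g3, -, -⟩, hh⟩ := hs₃
    rw [ht, Test.holds_lt] at hh
    simp only [Expr.eval, hb.r2, not_lt] at hh
    simp only [Program.sem, Expr.eval, State.reg_setReg, if_true]
    refine ⟨g3, ?_⟩
    have : ε * s₃.reg 9 ≤ ε * L := by gcongr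
    linarith
  · simp only [Program.bound, Expr.cost]
    push_cast
    have hq : (1 : ℝ) ≤ n / ε ^ d := by
      rw [le_div_iff₀ (by positivity), one_mul]
      exact (pow_le_one₀ hε.le hε1).trans hn1
    have h1 : (t.cost : ℝ) + 20 ≤ (t.cost + 20) * (n / ε ^ d) :=
      le_mul_of_one_le_right (by positivity) hq
    have h2 : A * n * (2 * (3 / 2) ^ d / ε ^ d) = A * (2 * (3 / 2) ^ d) * (n / ε ^ d) := by ring
    rw [h2]
    linarith

end RealRAM

/-! ### Initialization and the complete algorithms -/

namespace RealRAM

open EuclideanMST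
open scoped ENNReal

variable {d : ℕ}

/-- Copy the point `reg 17` of the input. -/
def inputBody (d : ℕ) : Program :=
  .seq (copyCode d 0 [17] 3 17) (.assign 17 (.add (.reg 17) (lit 1)))

/-- Copy the input to generation `0` and initialize the registers. -/
def initCode (d : ℕ) : Program :=
  .seq (block [.assign 3 (lit 0), .assign 4 (.reg 0), .assign 5 (.reg 1), .assign 6 (lit 1),
    .assign 7 (lit 1), .assign 17 (lit 0)]) (.loop (.lt (.reg 17) (.reg 0)) (inputBody d))

theorem flat_inputBody (d : ℕ) : (inputBody d).Flat := ⟨flat_copyCode _ _ _ _ _, trivial⟩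

theorem inputMem_point {n : ℕ} (p : Fin n → EuclideanSpace ℝ (Fin d)) (i : Fin n) (j : Fin d) :
    inputMem p 0 [((i : ℕ) : ℤ), ((j : ℕ) : ℤ)] = p i j := by
  have h : inputMem p 0 [((i : ℕ) : ℤ), ((j : ℕ) : ℤ)] =
      if h : (i : ℕ) < n ∧ (j : ℕ) < d then p ⟨i, h.1⟩ ⟨j, h.2⟩ else 0 := rfl
  rw [h, dif_pos ⟨i.2, j.2⟩]

theorem inputMem_of_pos {n : ℕ} (p : Fin n → EuclideanSpace ℝ (Fin d)) {a : ℕ} (ha : 1 ≤ a)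
    (key : List ℤ) : inputMem p a key = 0 := by
  obtain ⟨a, rfl⟩ := Nat.exists_eq_add_of_le' ha
  rfl

theorem initCode_spec (d : ℕ) : ∃ C : ℝ, 0 ≤ C ∧ ∀ {n k : ℕ}
    {p : Fin n → EuclideanSpace ℝ (Fin d)} {ε L : ℝ}, Approx p k L 1 0 →
    Tri (initCode d) (input p k ε) (C * (n + 1)) fun s => Outer p k ε L s n 0 1 k 1 0 := by
  set t : Test := .lt (.reg 17) (.reg 0) with ht
  set b : ℝ := t.cost + 1 + (inputBody d).bound with hb
  have hb0 : 0 ≤ b := by positivity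
  refine ⟨b + (t.cost + 40), by positivity, ?_⟩
  intro n k p ε L happ
  set pre : Program := block [.assign 3 (lit 0), .assign 4 (.reg 0), .assign 5 (.reg 1),
    .assign 6 (lit 1), .assign 7 (lit 1), .assign 17 (lit 0)] with hpre
  have hflat : pre.Flat := by simp [hpre, flat_block, Program.Flat]
  set s₀ : State := pre.sem (input p k ε) with hs₀
  have hmem : s₀.mem = inputMem p := rfl
  have e0 : s₀.reg 0 = n := rfl
  have e3 : s₀.reg 3 = 0 := by
    simp [hs₀, hpre, sem_block_cons, sem_block_nil, Program.sem, Expr.eval]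
  have e17 : s₀.reg 17 = 0 := by
    simp [hs₀, hpre, sem_block_cons, sem_block_nil, Program.sem, Expr.eval]
  have hw : ∀ x < 9, ¬ (inputBody d).Writes x := by
    intro x hx
    simp only [inputBody, copyCode, Program.Writes, writes_unroll, writes_block, List.mem_cons,
      List.not_mem_nil, or_false, exists_eq_or_imp, exists_eq_left, not_or, not_exists, not_and]
    repeat' (first | omega | exact not_false | refine And.intro ?_ ?_)
  have hloop := Tri.loop (t := t) (P := inputBody d)
    (fun s => (∀ x < 9, s.reg x = s₀.reg x) ∧ (∀ key, s.mem 0 key = inputMem p 0 key) ∧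
      (∀ (a g : ℕ), 1 ≤ a → 1 ≤ g → ∀ key, s.mem a ((g : ℤ) :: key) = 0) ∧
      ∃ i : ℕ, i ≤ n ∧ s.reg 17 = i ∧ ∀ l : Fin n, (l : ℕ) < i → pt d s 0 l = p l)
    (fun s => b * (n - s.reg 17)) ?_ ?_ (s := s₀) ?_
  · refine (Tri.seq (Tri.of_flat hflat (Q := fun s => s = s₀) rfl) (B' := t.cost + 1 + b * n)
      (Q' := fun s => Outer p k ε L s n 0 1 k 1 0) ?_).mono ?_ fun _ _ h => h
    · rintro _ - rfl
      refine hloop.mono (by simp [e17]) ?_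
      rintro s - ⟨⟨hr, -, hz, i, hi, h17, hpts⟩, hn⟩
      rw [ht, Test.holds_lt] at hn
      simp only [Expr.eval, h17, hr 0 (by simp), e0, Nat.cast_lt, not_lt] at hn
      have hpts' : ∀ l : Fin n, pt d s 0 l = p l := fun l => hpts l (l.2.trans_le hn)
      refine ⟨⟨?_, ?_, ?_, ?_, Nat.one_pos, fun a ha g hg key => hz a g ha hg key, hpts'⟩, ?_, ?_,
        ?_, ?_, ?_, Nat.one_pos, ?_⟩
      · rw [hr 0 (by simp), e0]
      · rw [hr 1 (by simp)]; rfl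
      · rw [hr 2 (by simp)]; rfl
      · rw [hr 7 (by simp)]
        simp [hs₀, hpre, sem_block_cons, sem_block_nil, Program.sem, Expr.eval]
      · rw [hr 3 (by simp), e3, Nat.cast_zero]
      · rw [hr 4 (by simp)]
        simp [hs₀, hpre, sem_block_cons, sem_block_nil, Program.sem, Expr.eval, input, inputReg]
      · rw [hr 5 (by simp)]
        simp [hs₀, hpre, sem_block_cons, sem_block_nil, Program.sem, Expr.eval, input, inputReg]
      · rw [hr 6 (by simp)]
        simp [hs₀, hpre, sem_block_cons, sem_block_nil, Program.sem, Expr.eval]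
      · rw [hr 8 (by simp)]; rfl
      · rw [show (fun i : Fin n => pt d s 0 i) = p from funext hpts']
        exact happ
    · have hbd : (pre.bound : ℝ) = 19 := by
        norm_num [hpre, block, Program.bound, Expr.cost]
      rw [hbd]
      have : (0 : ℝ) ≤ n := Nat.cast_nonneg _
      have : (0 : ℝ) ≤ t.cost := Nat.cast_nonneg _
      nlinarith
  · rintro s ⟨-, -, -, i, hi, h17, -⟩
    rw [h17]
    have : (i : ℝ) ≤ n := by exact_mod_cast hi
    exact mul_nonneg hb0 (by linarith)
  · rintro s ⟨hr, h0, hz, i, hi, h17, hpts⟩ hh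
    rw [ht, Test.holds_lt] at hh
    simp only [Expr.eval, h17, hr 0 (by simp), e0, Nat.cast_lt] at hh
    obtain ⟨c1, c2, c3⟩ := sem_copyCode (d := d) (src := 0) (ks := [17]) (s := s) (x := 3)
      (y := 17) (g := 0) (i := i) (by rw [hr 3 (by simp), e3, Nat.cast_zero]) h17 (by simp)
      (by simp) (by simp) (by simp)
    have f17 : ((inputBody d).sem s).reg 17 = (i + 1 : ℕ) := by
      simp only [inputBody, Program.sem, Expr.eval, State.reg_setReg, if_true,
        c3 17 (by simp) (by simp), h17]
      push_cast
      rfl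
    have fmem : ((inputBody d).sem s).mem = ((copyCode d 0 [17] 3 17).sem s).mem := rfl
    refine ⟨_, Tri.of_flat (flat_inputBody d) ⟨⟨fun x hx => ?_, fun key => ?_, fun a g ha hg key => ?_,
      i + 1, hh, f17, fun l hl => ?_⟩, ?_⟩⟩
    · rw [(flat_inputBody d).reg_eq s (hw x hx), hr x hx]
    · rw [fmem, c2 0 key (by simp), h0]
    · rw [fmem, c2 a _ fun _ j hj => ?_, hz a g ha hg]
      have := (List.cons.inj hj).1
      rw [Nat.cast_inj] at this
      omega
    · rcases Nat.lt_succ_iff_lt_or_eq.1 hl with hl | hl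
      · rw [← hpts l hl]
        simp only [pt, fmem]
        congr 1
        funext j
        refine c2 1 _ fun _ j' hj' => ?_
        simp only [List.cons.injEq, Nat.cast_inj] at hj'
        omega
      · subst hl
        ext j
        simp only [pt, fmem]
        rw [c1 j]
        simp only [key_cons, key_nil, h17, Int.floor_natCast, List.cons_append, List.nil_append, h0]
        exact inputMem_point p l j
    · rw [f17, h17]
      push_cast
      rw [hb]
      linarith
  · exact ⟨fun _ _ => rfl, fun _ => rfl, fun a g ha _ key => inputMem_of_pos p ha _, 0,
      Nat.zero_le _, by simpa using e17, by simp⟩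

theorem ec_halted {F : State → ℝ≥0∞} {s : State} (hs : F s = 0) (N : ℕ) : ec F N ([], s) = 0 := by
  induction N with
  | zero => rfl
  | succ N ih =>
    have hstep : step ([], s) = PMF.pure ([], s) := rfl
    rw [ec, hstep, tsum_pure, ih]
    simp [weight, hs]

/-- The algorithm for the `k`-th longest edge. -/
def kthLongestCode (d : ℕ) : Program := .seq (initCode d) (.seq (pruneLoop d) (refine d))

/-- The algorithm for the `k`-th shortest edge. -/
def kthShortestCode (d : ℕ) : Program :=
  .seq (.assign 1 (.sub (.reg 0) (.reg 1))) (kthLongestCode d)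

open Classical in
/-- Infinite if register `0` is not an approximation of `L`, else `0`. -/
noncomputable def penalty (L ε : ℝ) (s : State) : ℝ≥0∞ :=
  if L ≤ s.reg 0 ∧ s.reg 0 ≤ (1 + ε) * L then 0 else ⊤

/-- The pruning phase starts with the input itself, at scale `1` and with error `0`. The refinement
ends in a state without penalty, so halting adds no cost. -/
theorem ec_kthLongestCode_le (hd : 0 < d) : ∃ C : ℝ, 0 ≤ C ∧ ∀ {n k : ℕ}
    {p : Fin n → EuclideanSpace ℝ (Fin d)} {ε : ℝ} {T : SimpleGraph (Fin n)},
    Function.Injective p → 1 ≤ k → k < n → 0 < ε → ε ≤ 1 → IsMST p T → ∀ N,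
    ec (penalty (kthLongest p T k) ε) N ([kthLongestCode d], input p k ε) ≤
      ENNReal.ofReal (C * (n / ε ^ d)) := by
  obtain ⟨C₁, hC₁, hinit⟩ := initCode_spec d
  obtain ⟨C₂, hC₂, hprune⟩ := ec_pruneLoop_le hd
  obtain ⟨C₃, hC₃, hrefine⟩ := refine_spec hd
  refine ⟨2 * C₁ + C₂ + C₃ + 6, by positivity, ?_⟩
  intro n k p ε T hp h1 hk hε hε1 hT N
  set L := kthLongest p T k with hL
  have hiff : ∀ x, L ≤ x ↔ clusters p x ≤ k := fun x => hT.kthLongest_le_iff h1 hk x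
  -- Distinct points form `n > k` clusters at distance `0`.
  have hLpos : 0 < L := by
    by_contra hn
    have h0 := (hiff 0).1 (not_lt.1 hn)
    rw [clusters_of_lt fun i j hij => dist_pos.2 (hp.ne hij), Nat.card_eq_fintype_card,
      Fintype.card_fin] at h0
    omega
  have happ : Approx p k L 1 0 :=
    ⟨h1, hk, one_pos, hp, le_rfl, by positivity, fun i j _ => by positivity, by
      simpa using hT.brackets h1 hk⟩
  have hloc : ∀ s S, Located p k ε L s S → ∀ N, ec (penalty L ε) N ([refine d], s) ≤
      ENNReal.ofReal (C₃ * (n / ε ^ d)) := by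
    intro s S hs N
    obtain ⟨s', hq, hle⟩ := (hrefine (by omega) hε hε1 hiff hs).ec_le (penalty L ε) N []
    rw [ec_halted (by simp [penalty, hq])] at hle
    simpa using hle
  have hn1 : (1 : ℝ) ≤ n := by exact_mod_cast h1.trans hk.le
  refine (ec_le_of_step _ (c := (initCode d :: .seq (pruneLoop d) (refine d) :: [],
    input p k ε)) rfl N).trans ?_
  obtain ⟨s', hq, hle⟩ := (hinit (ε := ε) happ).ec_le (penalty L ε) N
    [.seq (pruneLoop d) (refine d)]
  refine (add_le_add_right hle _).trans ?_
  refine (add_le_add_right (add_le_add_right (ec_le_of_step _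
    (c := (pruneLoop d :: refine d :: [], s')) rfl N) _) _).trans ?_
  refine (add_le_add_right (add_le_add_right (add_le_add_right (hprune hloc N s' n
    (.inl ⟨_, _, _, _, _, _, hq, rfl⟩)) _) _) _).trans ?_
  have hq1 : (n : ℝ) ≤ n / ε ^ d := by
    rw [le_div_iff₀ (by positivity)]
    exact mul_le_of_le_one_right (by positivity) (pow_le_one₀ hε.le hε1)
  have c₁ : stepCost ([kthLongestCode d], input p k ε) = 1 := rfl
  have c₂ : stepCost ([.seq (pruneLoop d) (refine d)], s') = 1 := rfl
  rw [c₁, c₂, Nat.cast_one, ← ENNReal.ofReal_one, ← ENNReal.ofReal_add (by positivity) (by positivity),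
    ← ENNReal.ofReal_add (by positivity) (by positivity),
    ← ENNReal.ofReal_add (by positivity) (by positivity),
    ← ENNReal.ofReal_add (by positivity) (by positivity)]
  refine ENNReal.ofReal_le_ofReal ?_
  have e1 : C₁ * (n + 1) ≤ C₁ * (2 * (n / ε ^ d)) := by
    gcongr
    linarith
  have e2 : C₂ * n ≤ C₂ * (n / ε ^ d) := by gcongr
  linarith

/-- After one assignment the state is literally the input for `n - k`, so the bound for the longest
edges applies unchanged. -/
theorem input_setReg {n k : ℕ} (hk : k < n) (p : Fin n → EuclideanSpace ℝ (Fin d)) (ε : ℝ) :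
    (input p k ε).setReg 1 ((n : ℝ) - k) = input p (n - k) ε := by
  simp only [input, State.setReg, State.mk.injEq, and_true]
  funext x
  rcases x with _ | _ | _ | x
  · simp [inputReg]
  · simp [inputReg, Nat.cast_sub hk.le]
  · simp [inputReg]
  · simp [inputReg]

theorem ec_kthShortestCode_le (hd : 0 < d) : ∃ C : ℝ, 0 ≤ C ∧ ∀ {n k : ℕ}
    {p : Fin n → EuclideanSpace ℝ (Fin d)} {ε : ℝ} {T : SimpleGraph (Fin n)},
    Function.Injective p → 1 ≤ k → k < n → 0 < ε → ε ≤ 1 → IsMST p T → ∀ N,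
    ec (penalty (kthShortest p T k) ε) N ([kthShortestCode d], input p k ε) ≤
      ENNReal.ofReal (C * (n / ε ^ d)) := by
  obtain ⟨C, hC, h⟩ := ec_kthLongestCode_le hd
  refine ⟨C + 5, by positivity, ?_⟩
  intro n k p ε T hp h1 hk hε hε1 hT N
  rw [hT.kthShortest_eq h1 hk]
  have hn1 : (1 : ℝ) ≤ n := by exact_mod_cast h1.trans hk.le
  have hq1 : (1 : ℝ) ≤ n / ε ^ d := by
    rw [le_div_iff₀ (by positivity), one_mul]
    exact (pow_le_one₀ hε.le hε1).trans hn1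
  have hstep : step (.assign 1 (.sub (.reg 0) (.reg 1)) :: kthLongestCode d :: [], input p k ε) =
      PMF.pure ([kthLongestCode d], input p (n - k) ε) := by
    rw [← input_setReg hk]
    rfl
  refine (ec_le_of_step _ (c := (.assign 1 (.sub (.reg 0) (.reg 1)) :: kthLongestCode d :: [],
    input p k ε)) rfl N).trans ?_
  refine (add_le_add_right (ec_le_of_step _ hstep N) _).trans ?_
  refine (add_le_add_right (add_le_add_right (h hp (by omega) (by omega) hε hε1 hT N) _) _).trans ?_
  have c₁ : stepCost ([kthShortestCode d], input p k ε) = 1 := rfl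
  have c₂ : stepCost ([.assign 1 (.sub (.reg 0) (.reg 1)), kthLongestCode d], input p k ε) = 4 := rfl
  rw [c₁, c₂, ← ENNReal.ofReal_natCast, ← ENNReal.ofReal_natCast,
    ← ENNReal.ofReal_add (by positivity) (by positivity),
    ← ENNReal.ofReal_add (by positivity) (by positivity)]
  refine ENNReal.ofReal_le_ofReal ?_
  push_cast
  linarith

theorem of_penalty_ne_top {L ε : ℝ} {s : State} (h : penalty L ε s ≠ ⊤) :
    L ≤ s.reg 0 ∧ s.reg 0 ≤ (1 + ε) * L := by
  by_contra hn
  exact h (if_neg hn)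

end RealRAM

theorem theoremm (d : ℕ) :
    (∃ (P : RealRAM.Program) (C : ℝ),
      ∀ (n k : ℕ) (p : Fin n → EuclideanSpace ℝ (Fin d)) (ε : ℝ),
        Function.Injective p → 1 ≤ k → k < n → 0 < ε → ε ≤ 1 →
        RealRAM.expectedTime P (RealRAM.input p k ε) ≤ ENNReal.ofReal (C * ((n : ℝ) / ε ^ d)) ∧
        ∀ r : ℝ, RealRAM.IsOutput P (RealRAM.input p k ε) r →
          ∀ T : SimpleGraph (Fin n), EuclideanMST.IsMST p T →
            EuclideanMST.kthLongest p T k ≤ r ∧ r ≤ (1 + ε) * EuclideanMST.kthLongest p T k) ∧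
    (∃ (P : RealRAM.Program) (C : ℝ),
      ∀ (n k : ℕ) (p : Fin n → EuclideanSpace ℝ (Fin d)) (ε : ℝ),
        Function.Injective p → 1 ≤ k → k < n → 0 < ε → ε ≤ 1 →
        RealRAM.expectedTime P (RealRAM.input p k ε) ≤ ENNReal.ofReal (C * ((n : ℝ) / ε ^ d)) ∧
        ∀ r : ℝ, RealRAM.IsOutput P (RealRAM.input p k ε) r →
          ∀ T : SimpleGraph (Fin n), EuclideanMST.IsMST p T →
            EuclideanMST.kthShortest p T k ≤ r ∧
              r ≤ (1 + ε) * EuclideanMST.kthShortest p T k) := by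
  -- In dimension `0` there is at most one point, so no admissible `k` exists.
  rcases Nat.eq_zero_or_pos d with rfl | hd
  · have key : ∀ (n k : ℕ) (p : Fin n → EuclideanSpace ℝ (Fin 0)), Function.Injective p → 1 ≤ k →
        k < n → False := by
      intro n k p hp h1 hk
      have := congrArg Fin.val (hp (Subsingleton.elim (p ⟨0, by omega⟩) (p ⟨1, by omega⟩)))
      simp at this
    exact ⟨⟨.skip, 0, fun n k p _ hp h1 hk => (key n k p hp h1 hk).elim⟩,
      ⟨.skip, 0, fun n k p _ hp h1 hk => (key n k p hp h1 hk).elim⟩⟩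
  · obtain ⟨C, -, h⟩ := RealRAM.ec_kthLongestCode_le hd
    obtain ⟨C', -, h'⟩ := RealRAM.ec_kthShortestCode_le hd
    refine ⟨⟨RealRAM.kthLongestCode d, C, fun n k p ε hp h1 hk hε hε1 => ⟨?_, fun r hr T hT => ?_⟩⟩,
      ⟨RealRAM.kthShortestCode d, C', fun n k p ε hp h1 hk hε hε1 => ⟨?_, fun r hr T hT => ?_⟩⟩⟩
    -- The time bound does not mention a tree, but the penalty does; any minimum spanning tree
    -- serves. Correctness is then obtained for each tree from its own penalty.
    · obtain ⟨T, hT⟩ := EuclideanMST.exists_isMST p (by omega)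
      exact RealRAM.expectedTime_le (h hp h1 hk hε hε1 hT)
    · exact RealRAM.of_isOutput (Q := fun r => EuclideanMST.kthLongest p T k ≤ r ∧
        r ≤ (1 + ε) * EuclideanMST.kthLongest p T k) (fun s => RealRAM.of_penalty_ne_top)
        ENNReal.ofReal_ne_top (h hp h1 hk hε hε1 hT) hr
    · obtain ⟨T, hT⟩ := EuclideanMST.exists_isMST p (by omega)
      exact RealRAM.expectedTime_le (h' hp h1 hk hε hε1 hT)
    · exact RealRAM.of_isOutput (Q := fun r => EuclideanMST.kthShortest p T k ≤ r ∧
        r ≤ (1 + ε) * EuclideanMST.kthShortest p T k) (fun s => RealRAM.of_penalty_ne_top)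
        ENNReal.ofReal_ne_top (h' hp h1 hk hε hε1 hT) hr
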